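/- **Conventions.** A map $f:X\to Y$ is a quasi-isometry if there are $K\ge 1$, $C\ge 0$ with $K^{-1}d(x,x')-C\le d(f(x),f(x'))\le Kd(x,x')+C$ for all $x,x'\in X$ and every point of $Y$ is within $C$ of $f(X)$. In a CAT(0) space $X$, let $\alpha:I\to X$ be a unit-speed geodesic on a closed interval $I\subseteq\mathbb R$, $\pi_\alpha$ the closest-point projection to $\alpha$, and $r$ such that $[r-\frac12,r+\frac12]\subset\operatorname{int} I$. The curtain dual to $\alpha$ at $r$ is $h=\pi_\alpha^{-1}(\alpha[r-\frac12,r+\frac12])$; it separates $A$ from $B$ if, for some such $\alpha$ and $r$ defining $h$, $\pi_\alpha(A)\subset\alpha(I\cap(-\infty,r-\frac12))$ and $\pi_\alpha(B)\subset\alpha(I\cap(r+\frac12,\infty))$. A chain is a sequence $(h_i)$ of pairwise disjoint curtains such that $h_i$ separates $h_{i-1}$ from $h_{i+1}$ for all $i$. Disjoint curtains $h,h'$ are $L$-separated if every chain all of whose members meet both $h$ and $h'$ has at most $L$ members; an $L$-chain is a chain whose members are pairwise $L$-separated. Put $d_L(x,x)=0$ and, for $x\ne y$, $d_L(x,y)=1+\max\{|c|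 : c \text{ an } L\text{-chain each of whose members separates } x \text{ from } y\}$. Fix $\lambda_L\in(0,1)$, $L\ge 1$, with $\sum\lambda_L<\sum L\lambda_L<\sum L^2\lambda_L<\infty$. The curtain model $\widehat X$ is the set $X$ with the distance $\hat d(x,y)=\sum_{L\ge1}\lambda_L d_L(x,y)$. **Theorem.** Let $X$ be the universal cover of $\{z\in\mathbb R^2: |z|\ge 1\}$ with the induced length metric, in polar coordinates $(t,r)\in\mathbb R\times[1,\infty)$ (covering map $(t,r)\mapsto re^{it}$). Let $W$, respectively $Z$, be obtained from $X$ by gluing the origin of a ray $[0,\infty)$ to each of the points $(i,2^i)$, respectively $(0,2^i)$, $i\in\mathbb N=\{0,1,2,\dots\}$. Then, for every choice of $(\lambda_L)$ as above: 1. $X$ is a CAT(0) space, the map $\phi(t,r)=(t-\log_2 r,\,r)$ is a quasi-isometry $X\to X$, and the same map $\phi$, regarded as a map $\widehat X\to\widehat X$, is not a quasi-isometry. 2. $W$ and $Z$ are CAT(0) spaces that are quasi-isometric to each other, but $\widehat W$ and $\widehat Z$ are not quasi-isometric. 3. $\widehat W$ is quasi-isometric to the real line with a ray glued at each positive integer,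 and $\widehat Z$ is quasi-isometric to the wedge of countably infinitely many rays. -/

import Mathlib

noncomputable section

namespace CurtainModels

open Set
open scoped ENNReal

/-! ## Quasi-isometries -/

/-- `f` is a quasi-isometry: a quasi-isometric embedding with coarsely dense image. -/
def IsQuasiIsometry {X Y : Type*} [Dist X] [Dist Y] (f : X → Y) : Prop :=
  ∃ K C : ℝ, 1 ≤ K ∧ 0 ≤ C ∧
    (∀ x x' : X, K⁻¹ * dist x x' - C ≤ dist (f x) (f x') ∧
      dist (f x) (f x') ≤ K * dist x x' + C) ∧
    ∀ y : Y, ∃ x : X, dist (f x) y ≤ C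

def QuasiIsometric (X Y : Type*) [Dist X] [Dist Y] : Prop :=
  ∃ f : X → Y, IsQuasiIsometry f

/-! ## CAT(0) spaces -/

/-- `c` restricted to `[0,1]` is a geodesic from `x` to `y`, parametrized proportionally to
arc length. -/
def IsGeodesicFromTo {X : Type*} [MetricSpace X] (c : ℝ → X) (x y : X) : Prop :=
  c 0 = x ∧ c 1 = y ∧
    ∀ s ∈ Icc (0 : ℝ) 1, ∀ t ∈ Icc (0 : ℝ) 1, dist (c s) (c t) = |s - t| * dist x y

/-- A CAT(0) space: any two points are joined by a geodesic, and geodesic triangles are no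
fatter than their comparison triangles in the Euclidean plane. Any two points on different
sides of a triangle lie on the two sides issuing from some vertex `p`. -/
def IsCAT0 (X : Type*) [MetricSpace X] : Prop :=
  (∀ x y : X, ∃ c : ℝ → X, IsGeodesicFromTo c x y) ∧
  ∀ (p q r : X) (c c' : ℝ → X), IsGeodesicFromTo c p q → IsGeodesicFromTo c' p r →
    ∀ p' q' r' : EuclideanSpace ℝ (Fin 2),
      dist p' q' = dist p q → dist p' r' = dist p r → dist q' r' = dist q r →
      ∀ s ∈ Icc (0 : ℝ) 1, ∀ t ∈ Icc (0 : ℝ) 1,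
        dist (c s) (c' t) ≤ dist (AffineMap.lineMap p' q' s) (AffineMap.lineMap p' r' t)

/-! ## Curtains, chains and the curtain model -/

section Curtains

variable {X : Type*} [MetricSpace X]

/-- A unit speed geodesic on the closed interval `I` (a segment, a ray or a line). -/
def IsGeodesicOn (I : Set ℝ) (α : ℝ → X) : Prop :=
  IsClosed I ∧ I.OrdConnected ∧ ∀ s ∈ I, ∀ t ∈ I, dist (α s) (α t) = |s - t|

/-- The preimage of `α '' J` under the closest point projection to the geodesic `α '' I`. -/
def projPreimage (I : Set ℝ) (α : ℝ → X) (J : Set ℝ) : Set X :=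
  {x | ∃ s ∈ I ∩ J, ∀ t ∈ I, dist x (α s) ≤ dist x (α t)}

/-- The curtain dual to `α` at `r`. -/
def curtain (I : Set ℝ) (α : ℝ → X) (r : ℝ) : Set X :=
  projPreimage I α (Icc (r - 1 / 2) (r + 1 / 2))

/-- The half-space `h⁻` of the curtain dual to `α` at `r`. -/
def halfMinus (I : Set ℝ) (α : ℝ → X) (r : ℝ) : Set X :=
  projPreimage I α (Iio (r - 1 / 2))

/-- The half-space `h⁺` of the curtain dual to `α` at `r`. -/
def halfPlus (I : Set ℝ) (α : ℝ → X) (r : ℝ) : Set X :=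
  projPreimage I α (Ioi (r + 1 / 2))

/-- `h` is the curtain dual to the geodesic `α : I → X` at `r`. -/
def IsCurtainAt (h : Set X) (I : Set ℝ) (α : ℝ → X) (r : ℝ) : Prop :=
  IsGeodesicOn I α ∧ Icc (r - 1 / 2) (r + 1 / 2) ⊆ interior I ∧ h = curtain I α r

def IsCurtain (h : Set X) : Prop :=
  ∃ (I : Set ℝ) (α : ℝ → X) (r : ℝ), IsCurtainAt h I α r

/-- The curtain `h` separates `A` from `B`. The relation is symmetric in `A` and `B`, since the
geodesic can be reversed. -/
def Separates (h A B : Set X) : Prop :=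
  ∃ (I : Set ℝ) (α : ℝ → X) (r : ℝ),
    IsCurtainAt h I α r ∧ A ⊆ halfMinus I α r ∧ B ⊆ halfPlus I α r

/-- A (finite) chain of `n` curtains. -/
def IsCurtainChain {n : ℕ} (c : Fin n → Set X) : Prop :=
  (∀ i, IsCurtain (c i)) ∧ (∀ i j, i ≠ j → Disjoint (c i) (c j)) ∧
    ∀ i j k : Fin n, (i : ℕ) + 1 = j → (j : ℕ) + 1 = k → Separates (c j) (c i) (c k)

/-- `h` and `h'` are `L`-separated: they are disjoint and every chain all of whose members meet
both `h` and `h'` has at most `L` members. (Bounding the finite chains bounds all chains.) -/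
def LSeparated (L : ℕ) (h h' : Set X) : Prop :=
  Disjoint h h' ∧ ∀ (n : ℕ) (c : Fin n → Set X), IsCurtainChain c →
    (∀ i, (c i ∩ h).Nonempty ∧ (c i ∩ h').Nonempty) → n ≤ L

def IsLChain (L : ℕ) {n : ℕ} (c : Fin n → Set X) : Prop :=
  IsCurtainChain c ∧ ∀ i j, i ≠ j → LSeparated L (c i) (c j)

open Classical in
/-- The metric `d_L`: one plus the maximal length of an `L`-chain separating `x` from `y`, for
`x ≠ y`. In a CAT(0) space such a chain has at most `dist x y` members. -/
def dL (L : ℕ) (x y : X) : ℝ :=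
  if x = y then 0
  else 1 + ((sSup {n : ℕ | ∃ c : Fin n → Set X,
    IsLChain L c ∧ ∀ i, Separates (c i) {x} {y}} : ℕ) : ℝ)

end Curtains

/-- The condition on the weights `λ_1, λ_2, …` used to form the curtain model. -/
def IsWeight (lam : ℕ+ → ℝ) : Prop :=
  (∀ L, lam L ∈ Ioo (0 : ℝ) 1) ∧ Summable (fun L : ℕ+ => (L : ℝ) ^ 2 * lam L) ∧
    ∑' L : ℕ+, lam L < ∑' L : ℕ+, (L : ℝ) * lam L ∧
    ∑' L : ℕ+, (L : ℝ) * lam L < ∑' L : ℕ+, (L : ℝ) ^ 2 * lam L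

/-- The curtain model of `X`: the set `X` with the distance `∑_{L ≥ 1} λ_L d_L`. -/
@[ext]
structure CurtainModel (lam : ℕ+ → ℝ) (X : Type*) where
  point : X

instance (lam : ℕ+ → ℝ) (X : Type*) [MetricSpace X] : Dist (CurtainModel lam X) where
  dist x y := ∑' L : ℕ+, lam L * dL (L : ℕ) x.point y.point

/-- The map of curtain models given by `f` on the underlying sets. -/
def curtainModelMap (lam : ℕ+ → ℝ) {X Y : Type*} (f : X → Y) (x : CurtainModel lam X) :
    CurtainModel lam Y := ⟨f x.point⟩

/-! ## The infinite parking lot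

Polar coordinates identify the universal cover of `{z : ℂ | 1 ≤ ‖z‖}` with `ℝ × [1, ∞)`; the
covering map is `(t, r) ↦ r e^{it}`, and the distance is the induced length metric. -/

/-- The set `ℝ × [1, ∞)` with its usual topology. -/
abbrev Strip : Type := {p : ℝ × ℝ // 1 ≤ p.2}

/-- The covering map `(t, r) ↦ r e^{it}`. -/
def cover (p : Strip) : ℂ := (p.1.2 : ℂ) * Complex.exp ((p.1.1 : ℂ) * Complex.I)

/-- The length of a path in the universal cover is the Euclidean length of its image in the
plane. -/
def pathLength {x y : Strip} (γ : Path x y) : ℝ≥0∞ :=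
  eVariationOn (fun s : unitInterval => cover (γ s)) univ

def lengthDist (x y : Strip) : ℝ≥0∞ := ⨅ γ : Path x y, pathLength γ

theorem lengthDist_self (x : Strip) : lengthDist x x = 0 := by
  refine le_antisymm ((iInf_le _ (Path.refl x)).trans ?_) zero_le
  refine (eVariationOn.constant_on ?_).le
  rintro _ ⟨a, -, rfl⟩ _ ⟨b, -, rfl⟩
  rfl

theorem lengthDist_comm_le (x y : Strip) : lengthDist x y ≤ lengthDist y x := by
  refine le_iInf fun γ => (iInf_le _ γ.symm).trans ?_
  exact eVariationOn.comp_le_of_antitoneOn (fun s : unitInterval => cover (γ s)) (s := univ) (t := univ)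
    unitInterval.symm (fun a _ b _ h => by simpa using h) (fun _ _ => mem_univ _)

theorem pathLength_trans_le {x y z : Strip} (γ : Path x y) (δ : Path y z) :
    pathLength (γ.trans δ) ≤ pathLength γ + pathLength δ := by
  let m : unitInterval := ⟨1 / 2, by norm_num, by norm_num⟩
  have hu : (univ : Set unitInterval) = Iic m ∪ Ici m := by
    ext s; simp
  unfold pathLength
  rw [hu, eVariationOn.union _ (x := m) isGreatest_Iic isLeast_Ici, ← hu]
  refine add_le_add ?_ ?_
  · have : EqOn (fun s : unitInterval => cover ((γ.trans δ) s))
        ((fun s : unitInterval => cover (γ s)) ∘ fun s : unitInterval => projIcc 0 1 zero_le_one (2 * (s : ℝ)))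
        (Iic m) := by
      intro s hs
      have hs' : (s : ℝ) ≤ 1 / 2 := hs
      simp only [Path.trans_apply, Function.comp_apply, hs', dif_pos]
      congr 2
      rw [projIcc_of_mem]
    rw [eVariationOn.congr this]
    exact eVariationOn.comp_le_of_monotoneOn _ _
      (fun a _ b _ h => monotone_projIcc _ (by
        have : (a : ℝ) ≤ b := h
        linarith)) (fun _ _ => mem_univ _)
  · have : EqOn (fun s : unitInterval => cover ((γ.trans δ) s))
        ((fun s : unitInterval => cover (δ s)) ∘ fun s : unitInterval => projIcc 0 1 zero_le_one (2 * (s : ℝ) - 1))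
        (Ici m) := by
      intro s hs
      have hs' : 1 / 2 ≤ (s : ℝ) := hs
      rcases hs'.eq_or_lt with h | h
      · have h1 : (s : ℝ) = 1 / 2 := h.symm
        simp [Path.trans_apply, h1]
      · simp only [Path.trans_apply, Function.comp_apply, not_le.2 h, dif_neg,
          not_false_eq_true]
        congr 2
        rw [projIcc_of_mem]
    rw [eVariationOn.congr this]
    exact eVariationOn.comp_le_of_monotoneOn _ _
      (fun a _ b _ h => monotone_projIcc _ (by
        have : (a : ℝ) ≤ b := h
        linarith)) (fun _ _ => mem_univ _)

theorem lengthDist_triangle (x y z : Strip) :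
    lengthDist x z ≤ lengthDist x y + lengthDist y z := by
  unfold lengthDist
  rw [ENNReal.iInf_add]
  refine le_iInf fun γ => ?_
  rw [ENNReal.add_iInf]
  exact le_iInf fun δ => (iInf_le _ (γ.trans δ)).trans (pathLength_trans_le γ δ)

theorem lengthDist_ne_top (x y : Strip) : lengthDist x y ≠ ⊤ := by
  let T : ℝ → ℝ := fun s => (1 - s) * x.1.1 + s * y.1.1
  let R : ℝ → ℝ := fun s => (1 - s) * x.1.2 + s * y.1.2
  have hR : ∀ s : unitInterval, 1 ≤ R s := fun s => by
    have h1 := s.2.1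
    have h2 := s.2.2
    have hx := x.2
    have hy := y.2
    simp only [R]
    nlinarith
  let γ : Path x y :=
    { toFun := fun s => ⟨(T s, R s), hR s⟩
      continuous_toFun := by
        simp only [T, R]
        fun_prop
      source' := by ext <;> simp [T, R]
      target' := by ext <;> simp [T, R] }
  let g : ℝ → ℂ := fun s => (R s : ℂ) * Complex.exp ((T s : ℂ) * Complex.I)
  have hlin : ∀ a b : ℝ, ContDiff ℝ 1 (fun s : ℝ => (1 - s) * a + s * b) := fun a b => by
    fun_prop
  have hRd : ContDiff ℝ 1 (fun s => (R s : ℂ)) :=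
    Complex.ofRealCLM.contDiff.comp (hlin _ _)
  have hTd : ContDiff ℝ 1 (fun s => (T s : ℂ)) :=
    Complex.ofRealCLM.contDiff.comp (hlin _ _)
  have hg : ContDiff ℝ 1 g := hRd.mul (hTd.mul contDiff_const).cexp
  obtain ⟨K, hK⟩ := hg.contDiffOn.exists_lipschitzOnWith one_ne_zero (convex_Icc (0 : ℝ) 1)
    isCompact_Icc
  have hbv : eVariationOn g (Icc 0 1) ≠ ⊤ := by
    have := hK.locallyBoundedVariationOn 0 1 (by simp) (by simp)
    rwa [inter_self] at this
  refine ne_top_of_le_ne_top hbv ((iInf_le _ γ).trans ?_)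
  exact eVariationOn.comp_le_of_monotoneOn g (t := univ) (fun s : unitInterval => (s : ℝ))
    (fun a _ b _ h => h) (fun s _ => s.2)

theorem eq_of_lengthDist_eq_zero {x y : Strip} (h : lengthDist x y = 0) : x = y := by
  by_contra hxy
  suffices H : ∃ e : ℝ≥0∞, 0 < e ∧ ∀ γ : Path x y, e ≤ pathLength γ by
    obtain ⟨e, he, H⟩ := H
    exact absurd (he.trans_le (le_iInf H)) (by rw [← lengthDist, h]; simp)
  by_cases hc : cover x = cover y
  · have hn : ∀ z : Strip, ‖cover z‖ = z.1.2 := fun z => by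
      rw [cover, norm_mul, Complex.norm_exp_ofReal_mul_I, mul_one, Complex.norm_real,
        Real.norm_of_nonneg (zero_le_one.trans z.2)]
    have hr : x.1.2 = y.1.2 := by rw [← hn, ← hn, hc]
    have hx0 : (x.1.2 : ℂ) ≠ 0 := by
      exact_mod_cast (zero_lt_one.trans_le x.2).ne'
    have he : Complex.exp ((x.1.1 : ℂ) * Complex.I) = Complex.exp ((y.1.1 : ℂ) * Complex.I) := by
      have := hc
      rw [cover, cover, ← hr] at this
      exact mul_left_cancel₀ hx0 this
    obtain ⟨n, hn'⟩ := Complex.exp_eq_exp_iff_exists_int.1 he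
    have ht : x.1.1 = y.1.1 + n * (2 * Real.pi) := by
      have := congrArg Complex.im hn'
      simpa using this
    have hn0 : n ≠ 0 := by
      rintro rfl
      exact hxy (Subtype.ext (Prod.ext (by simpa using ht) hr))
    have hpi := Real.pi_pos
    refine ⟨1, one_pos, fun γ => ?_⟩
    have hcont : Continuous fun s : unitInterval => (γ s).1.1 := by fun_prop
    have key : ∃ e : ℝ, (e = Real.pi ∨ e = -Real.pi) ∧ ∃ s, (γ s).1.1 = x.1.1 + e := by
      rcases lt_or_gt_of_ne hn0 with hneg | hpos
      · have : (n : ℝ) ≤ -1 := by exact_mod_cast Int.le_sub_one_of_lt hneg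
        obtain ⟨s, hs⟩ := mem_range_of_exists_le_of_exists_ge hcont
          (c := x.1.1 + Real.pi) ⟨0, by simp [hpi.le]⟩ ⟨1, by simp; nlinarith⟩
        exact ⟨_, Or.inl rfl, s, hs⟩
      · have : (1 : ℝ) ≤ n := by exact_mod_cast hpos
        obtain ⟨s, hs⟩ := mem_range_of_exists_le_of_exists_ge hcont
          (c := x.1.1 + -Real.pi) ⟨1, by simp; nlinarith⟩ ⟨0, by simp [hpi.le]⟩
        exact ⟨_, Or.inr rfl, s, hs⟩
    obtain ⟨e, he, s, hs⟩ := key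
    have hexp : Complex.exp ((e : ℂ) * Complex.I) = -1 := by
      rcases he with rfl | rfl
      · exact Complex.exp_pi_mul_I
      · push_cast
        rw [neg_mul, Complex.exp_neg, Complex.exp_pi_mul_I]
        norm_num
    have hcs : cover (γ s) = -(((γ s).1.2 : ℂ) * Complex.exp ((x.1.1 : ℂ) * Complex.I)) := by
      rw [cover, hs]
      push_cast
      rw [add_mul, Complex.exp_add, hexp]
      ring
    have hd : 1 ≤ dist (cover (γ 0)) (cover (γ s)) := by
      have h1 := (γ s).2
      have h2 := x.2
      rw [hcs, dist_eq_norm, γ.source, cover, sub_neg_eq_add, ← add_mul, norm_mul,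
        Complex.norm_exp_ofReal_mul_I, mul_one, ← Complex.ofReal_add, Complex.norm_real,
        Real.norm_of_nonneg (by linarith)]
      linarith
    have h3 := eVariationOn.edist_le (fun s : unitInterval => cover (γ s))
      (mem_univ (0 : unitInterval)) (mem_univ s)
    refine le_trans ?_ h3
    rw [edist_dist]
    exact ENNReal.one_le_ofReal.2 hd
  · refine ⟨edist (cover x) (cover y), edist_pos.2 hc, fun γ => ?_⟩
    have := eVariationOn.edist_le (fun s : unitInterval => cover (γ s))
      (mem_univ (0 : unitInterval)) (mem_univ (1 : unitInterval))
    rw [γ.source, γ.target] at this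
    exact this

/-- The infinite parking lot: the universal cover of the plane minus the open unit disc, in
polar coordinates and with its length metric. -/
@[ext]
structure ParkingLot where
  angle : ℝ
  radius : ℝ
  one_le_radius : 1 ≤ radius

def ParkingLot.toStrip (x : ParkingLot) : Strip := ⟨(x.angle, x.radius), x.one_le_radius⟩

instance : MetricSpace ParkingLot where
  dist x y := (lengthDist x.toStrip y.toStrip).toReal
  dist_self x := by simp [lengthDist_self]
  dist_comm x y := by
    rw [le_antisymm (lengthDist_comm_le x.toStrip y.toStrip) (lengthDist_comm_le _ _)]
  dist_triangle x y z := by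
    rw [← ENNReal.toReal_add (lengthDist_ne_top _ _) (lengthDist_ne_top _ _)]
    exact ENNReal.toReal_mono
      (ENNReal.add_ne_top.2 ⟨lengthDist_ne_top _ _, lengthDist_ne_top _ _⟩)
      (lengthDist_triangle _ _ _)
  eq_of_dist_eq_zero {x y} h := by
    have := eq_of_lengthDist_eq_zero
      (((ENNReal.toReal_eq_zero_iff _).1 h).resolve_right (lengthDist_ne_top _ _))
    simp only [ParkingLot.toStrip, Subtype.mk.injEq, Prod.mk.injEq] at this
    exact ParkingLot.ext this.1 this.2

/-- The logarithmic spiral map `(t, r) ↦ (t - log₂ r, r)`. -/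
def spiralMap (x : ParkingLot) : ParkingLot :=
  ⟨x.angle - Real.logb 2 x.radius, x.radius, x.one_le_radius⟩

/-! ## Gluing rays -/

/-- The space obtained from `X` by gluing, for each `i`, the origin of a ray `[0, ∞)` to the
point `p i`: its points are those of `X` and the points at distance `s > 0` from the origin of
the `i`-th ray. -/
inductive AttachRays {X ι : Type*} (p : ι → X)
  | base (x : X) : AttachRays p
  | ray (i : ι) (s : ℝ) (hs : 0 < s) : AttachRays p

namespace AttachRays

variable {X ι : Type*} [MetricSpace X] {p : ι → X}

open Classical in
/-- The gluing metric. -/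
def gdist : AttachRays p → AttachRays p → ℝ
  | base x, base y => dist x y
  | base x, ray j t _ => dist x (p j) + t
  | ray i s _, base y => s + dist (p i) y
  | ray i s _, ray j t _ => if i = j then |s - t| else s + dist (p i) (p j) + t

instance : MetricSpace (AttachRays p) where
  dist := gdist
  dist_self u := by cases u <;> simp [gdist]
  dist_comm u v := by
    rcases u with x | ⟨i, s, hs⟩ <;> rcases v with y | ⟨j, t, ht⟩
    · exact dist_comm x y
    · simp only [gdist, dist_comm x]; ring
    · simp only [gdist, dist_comm (p i)]; ring
    · by_cases h : i = j
      · simp [gdist, h, abs_sub_comm]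
      · simp only [gdist, h, Ne.symm h, if_false, dist_comm (p i)]; ring
  dist_triangle u v w := by
    have tri := fun a b c : X => dist_triangle a b c
    rcases u with x | ⟨i, s, hs⟩ <;> rcases v with y | ⟨j, t, ht⟩ <;>
      rcases w with z | ⟨k, r, hr⟩ <;> simp only [gdist]
    · exact tri x y z
    · linarith [tri x y (p k)]
    · linarith [tri x (p j) z]
    · split_ifs with h
      · subst h
        linarith [neg_abs_le (t - r)]
      · linarith [tri x (p j) (p k)]
    · linarith [tri (p i) y z]
    · split_ifs with h
      · subst h
        have := tri (p i) y (p i)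
        rw [dist_self] at this
        exact abs_le.2 ⟨by linarith, by linarith⟩
      · linarith [tri (p i) y (p k)]
    · split_ifs with h
      · subst h
        linarith [le_abs_self (s - t)]
      · linarith [tri (p i) (p j) z]
    · by_cases hij : i = j <;> by_cases hjk : j = k
      · subst hij hjk
        simpa using abs_sub_le s t r
      · subst hij
        simp only [hjk, if_true, if_false]
        linarith [le_abs_self (s - t)]
      · subst hjk
        simp only [hij, if_true, if_false]
        linarith [neg_abs_le (t - r)]
      · simp only [hij, hjk, if_false]
        have := tri (p i) (p j) (p k)
        split_ifs with hik
        · subst hik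
          rw [dist_self] at this
          exact abs_le.2 ⟨by linarith, by linarith⟩
        · linarith
  eq_of_dist_eq_zero {u v} h := by
    change gdist u v = 0 at h
    rcases u with x | ⟨i, s, hs⟩ <;> rcases v with y | ⟨j, t, ht⟩ <;> simp only [gdist] at h
    · rw [eq_of_dist_eq_zero h]
    · linarith [dist_nonneg (x := x) (y := p j)]
    · linarith [dist_nonneg (x := p i) (y := y)]
    · split_ifs at h with hij
      · subst hij
        have : s = t := sub_eq_zero.1 (abs_eq_zero.1 h)
        subst this
        rfl
      · linarith [dist_nonneg (x := p i) (y := p j)]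

end AttachRays

/-- The parking lot with a ray glued at each point `(i, 2^i)`, `i ∈ ℕ`. -/
abbrev SpaceW : Type :=
  AttachRays fun i : ℕ => ParkingLot.mk (i : ℝ) (2 ^ i) (one_le_pow₀ one_le_two)

/-- The parking lot with a ray glued at each point `(0, 2^i)`, `i ∈ ℕ`. -/
abbrev SpaceZ : Type :=
  AttachRays fun i : ℕ => ParkingLot.mk 0 (2 ^ i) (one_le_pow₀ one_le_two)

/-- The real line with a ray glued at each positive integer. -/
abbrev LineWithRays : Type := AttachRays fun n : ℕ+ => (n : ℝ)

/-- The wedge of countably infinitely many rays, glued at their origins. -/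
abbrev WedgeOfRays : Type := AttachRays fun _ : ℕ => PUnit.unit

end CurtainModels

end

/-!
A space is CAT(0) as soon as every point `z` of a geodesic from `x` to `y` has a logarithm map, a
non-expanding map to the plane which preserves the distances to `z` and sends `x` and `y` to
opposite directions. In the parking lot a logarithm map is written down from the tangents to the
unit circle, and it is extended to the attached rays by mapping them to rays of the plane.

Along the boundary circle of the parking lot, unrolled to a line, the curtains dual at angles far
enough from each other are `L`-separated for `L ≥ 2`: geodesics between points of distant angles run
along the circle, so that a curtain which meets both contains one of two given points of the circle.
Hence `d_L` is at least linear in the difference of the angles. Conversely a curtain that goes to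
infinity in the direction of the angle `k` meets the curtains dual to the radial ray at `k` far out,
so an `L`-chain contains at most one such curtain for each `k`, and `d_L` is at most linear in the
difference of the angles. Attached rays survive unchanged. Hence the curtain model is, up to
quasi-isometry, the real line of angles with rays attached at the angles of their origins: a tree
with branch points going to infinity for `W`, and a wedge of rays for `Z`. A quasi-isometric
embedding cannot send branch points far out on a ray of the wedge, where two of the three legs would
have to leave in the same direction.

The spiral map is a shear of the parking lot, locally bi-Lipschitz and therefore globally so, but it
turns the point of radius `r` by `log₂ r`, while the curtain model sees angles only.
-/

noncomputable section

namespace CurtainModels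

open Set
open scoped ENNReal

/-! ## Quasi-isometric embeddings -/

section QIEmbedding

variable {X Y Z : Type*}

/-- A quasi-isometric embedding. The lower bound on distances is written as an upper bound for
`dist x x'`, so that no inverse of the constant occurs. -/
def IsQIEmbedding [Dist X] [Dist Y] (f : X → Y) : Prop :=
  ∃ K C : ℝ, 1 ≤ K ∧ 0 ≤ C ∧ ∀ x x' : X,
    dist (f x) (f x') ≤ K * dist x x' + C ∧ dist x x' ≤ K * dist (f x) (f x') + C

theorem IsQuasiIsometry.isQIEmbedding [Dist X] [Dist Y] {f : X → Y} (h : IsQuasiIsometry f) :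
    IsQIEmbedding f := by
  obtain ⟨K, C, hK, hC, h, -⟩ := h
  have hK0 : 0 < K := one_pos.trans_le hK
  refine ⟨K, K * C, hK, by positivity, fun x x' => ⟨(h x x').2.trans ?_, ?_⟩⟩
  · gcongr
    exact le_mul_of_one_le_left hC hK
  · rw [← mul_add, ← inv_mul_le_iff₀ hK0]
    linarith [(h x x').1]

theorem IsQIEmbedding.isQuasiIsometry [Dist X] [PseudoMetricSpace Y] {f : X → Y}
    (h : IsQIEmbedding f) (hs : Function.Surjective f) : IsQuasiIsometry f := by
  obtain ⟨K, C, hK, hC, h⟩ := h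
  have hK0 : 0 < K := one_pos.trans_le hK
  refine ⟨K, C, hK, hC, fun x x' => ⟨?_, (h x x').1⟩, fun y => ?_⟩
  · rw [sub_le_iff_le_add, inv_mul_le_iff₀ hK0, mul_add]
    exact (h x x').2.trans (by gcongr; exact le_mul_of_one_le_left hC hK)
  · obtain ⟨x, rfl⟩ := hs y
    exact ⟨x, by rwa [dist_self]⟩

theorem IsQIEmbedding.comp [Dist X] [Dist Y] [Dist Z] {g : Y → Z} {f : X → Y}
    (hg : IsQIEmbedding g) (hf : IsQIEmbedding f) : IsQIEmbedding (g ∘ f) := by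
  obtain ⟨K, C, hK, hC, hf⟩ := hf
  obtain ⟨K', C', hK', hC', hg⟩ := hg
  have hK0 : 0 ≤ K := zero_le_one.trans hK
  have hK0' : 0 ≤ K' := zero_le_one.trans hK'
  have hKC : 0 ≤ K * C' := by positivity
  have hKC' : 0 ≤ K' * C := by positivity
  refine ⟨K * K', K' * C + C' + (K * C' + C), one_le_mul_of_one_le_of_one_le hK hK',
    by positivity, fun x x' => ?_⟩
  simp only [Function.comp_apply]
  constructor
  · linarith [(hg (f x) (f x')).1, mul_le_mul_of_nonneg_left (hf x x').1 hK0']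
  · linarith [(hf x x').2, mul_le_mul_of_nonneg_left (hg (f x) (f x')).2 hK0]

theorem IsQIEmbedding.of_rightInverse [Dist X] [Dist Y] {f : X → Y} {g : Y → X}
    (h : IsQIEmbedding f) (hg : Function.RightInverse g f) : IsQIEmbedding g := by
  obtain ⟨K, C, hK, hC, h⟩ := h
  refine ⟨K, C, hK, hC, fun y y' => ?_⟩
  simpa only [hg y, hg y'] using (h (g y) (g y')).symm

open scoped NNReal in
theorem isQIEmbedding_of_lipschitz [PseudoMetricSpace X] [PseudoMetricSpace Y] {f : X → Y}
    {K K' : ℝ≥0} (hf : LipschitzWith K f) (hf' : AntilipschitzWith K' f) : IsQIEmbedding f := by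
  refine ⟨max 1 (max K K'), 0, le_max_left _ _, le_rfl, fun x x' => ⟨?_, ?_⟩⟩ <;> rw [add_zero]
  · refine (hf.dist_le_mul x x').trans (mul_le_mul_of_nonneg_right ?_ dist_nonneg)
    exact (le_max_left _ _).trans (le_max_right _ _)
  · refine (hf'.le_mul_dist x x').trans (mul_le_mul_of_nonneg_right ?_ dist_nonneg)
    exact (le_max_right _ _).trans (le_max_right _ _)

end QIEmbedding

/-! ## Geodesics -/

section Geodesics

variable {X : Type*} [MetricSpace X] {x y z : X}

/-- `x` and `y` are the endpoints of a geodesic. -/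
def JoinedByGeodesic (x y : X) : Prop :=
  ∃ c : ℝ → X, IsGeodesicFromTo c x y

theorem JoinedByGeodesic.symm (h : JoinedByGeodesic x y) : JoinedByGeodesic y x := by
  obtain ⟨c, c0, c1, hc⟩ := h
  refine ⟨fun s => c (1 - s), by simpa using c1, by simpa using c0, fun s hs t ht => ?_⟩
  rw [hc _ ⟨by linarith [hs.2], by linarith [hs.1]⟩ _ ⟨by linarith [ht.2], by linarith [ht.1]⟩,
    dist_comm y, sub_sub_sub_cancel_left, abs_sub_comm]

theorem JoinedByGeodesic.of_dist_le (g : ℝ → X) (h0 : g 0 = x) (h1 : g (dist x y) = y)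
    (hg : ∀ s t, 0 ≤ s → s ≤ t → t ≤ dist x y → dist (g s) (g t) ≤ t - s) :
    JoinedByGeodesic x y := by
  have hD : 0 ≤ dist x y := dist_nonneg
  refine ⟨fun s => g (s * dist x y), by simpa using h0, by simpa using h1, fun s hs t ht => ?_⟩
  wlog hst : s ≤ t generalizing s t
  · rw [dist_comm, abs_sub_comm]
    exact this t ht s hs (le_of_not_ge hst)
  have b1 := mul_nonneg hs.1 hD
  have b2 := mul_le_mul_of_nonneg_right hst hD
  have b3 := mul_le_mul_of_nonneg_right ht.2 hD
  rw [abs_sub_comm, abs_of_nonneg (by linarith)]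
  have a1 := hg 0 _ le_rfl b1 (by linarith)
  have a2 := hg _ _ b1 b2 (by linarith)
  have a3 := hg _ _ (b1.trans b2) (by linarith) le_rfl
  rw [h0] at a1
  rw [h1] at a3
  linarith [dist_triangle4 x (g (s * dist x y)) (g (t * dist x y)) y]

theorem JoinedByGeodesic.exists_unit_speed (h : JoinedByGeodesic x y) :
    ∃ g : ℝ → X, g 0 = x ∧ g (dist x y) = y ∧
      ∀ s t, 0 ≤ s → s ≤ t → t ≤ dist x y → dist (g s) (g t) = t - s := by
  obtain ⟨c, c0, c1, hc⟩ := h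
  rcases (dist_nonneg (x := x) (y := y)).eq_or_lt with h0 | hpos
  · refine ⟨fun _ => x, rfl, dist_eq_zero.1 h0.symm, fun s t hs hst ht => ?_⟩
    rw [dist_self]
    linarith
  · refine ⟨fun s => c (s / dist x y), by simpa using c0, by simpa [hpos.ne'] using c1,
      fun s t hs hst ht => ?_⟩
    rw [hc _ ⟨by positivity, (div_le_one hpos).2 (hst.trans ht)⟩ _
      ⟨div_nonneg (hs.trans hst) hpos.le, (div_le_one hpos).2 ht⟩, ← sub_div, abs_div,
      abs_of_pos hpos, div_mul_cancel₀ _ hpos.ne', abs_sub_comm, abs_of_nonneg (sub_nonneg.2 hst)]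

theorem JoinedByGeodesic.trans (hxz : JoinedByGeodesic x z) (hzy : JoinedByGeodesic z y)
    (hz : dist x z + dist z y = dist x y) : JoinedByGeodesic x y := by
  obtain ⟨g, g0, g1, hg⟩ := hxz.exists_unit_speed
  obtain ⟨k, k0, k1, hk⟩ := hzy.exists_unit_speed
  have d2 := dist_nonneg (x := z) (y := y)
  refine .of_dist_le (fun s => if s ≤ dist x z then g s else k (s - dist x z))
    (by simp [g0]) ?_ fun s t hs hst ht => ?_
  · by_cases h : dist x y ≤ dist x z
    · obtain rfl : z = y := dist_eq_zero.1 (by linarith)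
      simp [g1]
    · rw [if_neg h, ← hz, add_sub_cancel_left, k1]
  by_cases htz : t ≤ dist x z
  · simp only [htz, hst.trans htz, if_true]
    exact (hg s t hs hst htz).le
  by_cases hsz : s ≤ dist x z
  · simp only [htz, hsz, if_true, if_false]
    have a1 := hg s _ hs hsz le_rfl
    have a2 := hk 0 (t - dist x z) le_rfl (by linarith) (by linarith)
    rw [g1] at a1
    rw [k0] at a2
    linarith [dist_triangle (g s) z (k (t - dist x z))]
  · simp only [htz, hsz, if_false]
    linarith [hk (s - dist x z) (t - dist x z) (by linarith) (by linarith) (by linarith)]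

theorem exists_dist_eq_mul_of_between (h : dist x z + dist z y = dist x y) :
    ∃ s ∈ Icc (0 : ℝ) 1, dist x z = s * dist x y ∧ dist z y = (1 - s) * dist x y := by
  have hxz := dist_nonneg (x := x) (y := z)
  have hzy := dist_nonneg (x := z) (y := y)
  rcases (dist_nonneg (x := x) (y := y)).eq_or_lt with h0 | hpos
  · exact ⟨0, by simp, by linarith, by linarith⟩
  · have hmul : dist x z / dist x y * dist x y = dist x z := div_mul_cancel₀ _ hpos.ne'
    exact ⟨dist x z / dist x y, ⟨by positivity, (div_le_one hpos).2 (by linarith)⟩,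
      hmul.symm, by linarith⟩

theorem IsGeodesicFromTo.dist_left {c : ℝ → X} (h : IsGeodesicFromTo c x y) {s : ℝ}
    (hs : s ∈ Icc (0 : ℝ) 1) : dist x (c s) = s * dist x y := by
  rw [← congrArg (dist · (c s)) h.1, h.2.2 0 (by simp) s hs, zero_sub, abs_neg, abs_of_nonneg hs.1]

theorem IsGeodesicFromTo.dist_right {c : ℝ → X} (h : IsGeodesicFromTo c x y) {s : ℝ}
    (hs : s ∈ Icc (0 : ℝ) 1) : dist (c s) y = (1 - s) * dist x y := by
  rw [← congrArg (dist (c s)) h.2.1, h.2.2 s hs 1 (by simp), abs_sub_comm,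
    abs_of_nonneg (sub_nonneg.2 hs.2)]

end Geodesics

/-! ## The Bruhat–Tits inequality -/

theorem sq_dist_lineMap {V P : Type*} [NormedAddCommGroup V] [InnerProductSpace ℝ V]
    [MetricSpace P] [NormedAddTorsor V P] (p a b : P) (s : ℝ) :
    dist p (AffineMap.lineMap a b s) ^ 2
      = (1 - s) * dist p a ^ 2 + s * dist p b ^ 2 - s * (1 - s) * dist a b ^ 2 := by
  have e : AffineMap.lineMap a b s -ᵥ p = (1 - s) • (a -ᵥ p) + s • (b -ᵥ p) := by
    rw [AffineMap.lineMap_vsub, AffineMap.lineMap_apply_module]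
  rw [dist_comm p, dist_comm p, dist_comm p, dist_eq_norm_vsub V, dist_eq_norm_vsub V,
    dist_eq_norm_vsub V, dist_eq_norm_vsub V a b, ← vsub_sub_vsub_cancel_right a b p, e,
    norm_add_sq_real, norm_sub_sq_real, norm_smul, norm_smul, real_inner_smul_left,
    real_inner_smul_right, mul_pow, mul_pow, Real.norm_eq_abs, Real.norm_eq_abs, sq_abs, sq_abs]
  ring

/-- The CN inequality of Bruhat and Tits, at all points of geodesics rather than only at midpoints.
A point of a geodesic from `x` to `y` enters through its distances to `x` and `y`, so that no
parametrization is needed. -/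
def BruhatTits (X : Type*) [MetricSpace X] : Prop :=
  ∀ (x y z p : X) (s : ℝ), s ∈ Icc (0 : ℝ) 1 → dist x z = s * dist x y →
    dist z y = (1 - s) * dist x y →
    dist p z ^ 2 ≤ (1 - s) * dist p x ^ 2 + s * dist p y ^ 2 - s * (1 - s) * dist x y ^ 2

section BruhatTits

variable {X : Type*} [MetricSpace X] {x y z z' : X}

theorem BruhatTits.isCAT0 (h : BruhatTits X) (hg : ∀ x y : X, JoinedByGeodesic x y) :
    IsCAT0 X := by
  refine ⟨hg, fun p q r c c' hc hc' p' q' r' hpq hpr hqr s hs t ht => ?_⟩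
  apply le_of_sq_le_sq _ dist_nonneg
  have hct := h p r (c' t) (c s) t ht (hc'.dist_left ht) (hc'.dist_right ht)
  have hcs := h p q (c s) r s hs (hc.dist_left hs) (hc.dist_right hs)
  have hcp := hc.dist_left hs
  have hcp' : dist p' (AffineMap.lineMap p' q' s) = s * dist p q := by
    rw [dist_left_lineMap, Real.norm_of_nonneg hs.1, hpq]
  rw [sq_dist_lineMap, dist_comm _ p', hcp', dist_comm _ r', sq_dist_lineMap, dist_comm r' p',
    dist_comm r' q', hpq, hpr, hqr]
  rw [dist_comm _ p, hcp, dist_comm _ r] at hct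
  rw [dist_comm r p, dist_comm r q] at hcs
  linarith [mul_le_mul_of_nonneg_left hcs ht.1]

theorem BruhatTits.eq_of_dist (h : BruhatTits X) {s : ℝ}
    (hs : s ∈ Icc (0 : ℝ) 1) (h1 : dist x z = s * dist x y) (h2 : dist z y = (1 - s) * dist x y)
    (h1' : dist x z' = s * dist x y) (h2' : dist z' y = (1 - s) * dist x y) : z = z' := by
  have hle := h x y z' z s hs h1' h2'
  rw [dist_comm z x, h1, h2] at hle
  have h0 : dist z z' ^ 2 ≤ 0 := hle.trans_eq (by ring)
  exact dist_eq_zero.1 (sq_nonpos_iff _ |>.1 h0)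

theorem BruhatTits.eq_of_between (h : BruhatTits X)
    (hz : dist x z + dist z y = dist x y) (hz' : dist x z' + dist z' y = dist x y)
    (e : dist x z = dist x z') : z = z' := by
  obtain ⟨s, hs, hxz, hzy⟩ := exists_dist_eq_mul_of_between hz
  exact h.eq_of_dist hs hxz hzy (by linarith) (by linarith)

/-- A logarithm map at `z` adapted to `x` and `y`: a non-expanding map to the plane, sending `z` to
the origin, which preserves the distances to `z` and the distance between `x` and `y`. -/
structure IsLogMap (L : X → ℂ) (x z y : X) : Prop where
  dist_le : ∀ u v, dist (L u) (L v) ≤ dist u v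
  norm_eq : ∀ u, ‖L u‖ = dist z u
  dist_eq : dist (L x) (L y) = dist x y

/-- Every point between `x` and `y` has a logarithm map adapted to `x` and `y`. -/
def HasLogMaps (X : Type*) [MetricSpace X] : Prop :=
  ∀ x z y : X, dist x z + dist z y = dist x y → ∃ L : X → ℂ, IsLogMap L x z y

theorem IsLogMap.symm {L : X → ℂ} (h : IsLogMap L x z y) : IsLogMap L y z x :=
  ⟨h.dist_le, h.norm_eq, by rw [dist_comm, h.dist_eq, dist_comm]⟩

/-- The point of the plane which divides the images of `x` and `y` as `z` divides `x` and `y` is the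
origin, so that the inequality follows from Stewart's theorem in the plane. -/
theorem IsLogMap.sq_dist_le {L : X → ℂ} (hL : IsLogMap L x z y) {s : ℝ} (hs : s ∈ Icc (0 : ℝ) 1)
    (hxz : dist x z = s * dist x y) (hzy : dist z y = (1 - s) * dist x y) (p : X) :
    dist p z ^ 2 ≤ (1 - s) * dist p x ^ 2 + s * dist p y ^ 2 - s * (1 - s) * dist x y ^ 2 := by
  have hzero : AffineMap.lineMap (L x) (L y) s = 0 := by
    rw [← dist_eq_zero, dist_comm, ← sq_eq_zero_iff, sq_dist_lineMap, dist_zero_left,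
      dist_zero_left, hL.norm_eq, hL.norm_eq, hL.dist_eq, dist_comm z x, hxz, hzy]
    ring
  have hp := sq_dist_lineMap (L p) (L x) (L y) s
  rw [hzero, dist_zero_right, hL.norm_eq, dist_comm, hL.dist_eq] at hp
  rw [hp]
  have h1s := sub_nonneg.2 hs.2
  have hs0 := hs.1
  gcongr <;> exact hL.dist_le _ _

theorem HasLogMaps.bruhatTits (h : HasLogMaps X) : BruhatTits X := by
  intro x y z p s hs hxz hzy
  obtain ⟨L, hL⟩ := h x z y (by rw [hxz, hzy]; ring)
  exact hL.sq_dist_le hs hxz hzy p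

/-- A point with a logarithm map is the only one at its distances from `x` and `y`. -/
theorem isLogMap_of_exists {l : X → X → ℂ} (h : ∀ x y : X, ∀ s ∈ Icc (0 : ℝ) 1, ∃ z,
    dist x z = s * dist x y ∧ dist z y = (1 - s) * dist x y ∧ IsLogMap (l z) x z y)
    {x z y : X} (hz : dist x z + dist z y = dist x y) : IsLogMap (l z) x z y := by
  obtain ⟨s, hs, hxz, hzy⟩ := exists_dist_eq_mul_of_between hz
  obtain ⟨z', hxz', hzy', hl⟩ := h x y s hs
  have hle := hl.sq_dist_le hs hxz' hzy' z
  rw [dist_comm z x, hxz, hzy] at hle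
  have hzz' : z = z' := dist_eq_zero.1 ((sq_nonpos_iff _).1 (hle.trans_eq (by ring)))
  exact hzz' ▸ hl

theorem exists_smul_of_norm_sub_eq_add {E : Type*} [NormedAddCommGroup E] [NormedSpace ℝ E]
    [StrictConvexSpace ℝ E] [Nontrivial E] {a b : E} (h : ‖a - b‖ = ‖a‖ + ‖b‖) :
    ∃ v : E, ‖v‖ = 1 ∧ a = -(‖a‖ • v) ∧ b = ‖b‖ • v := by
  have hray : SameRay ℝ (-a) b := by
    rw [sameRay_iff_norm_add, norm_neg, ← h, ← norm_neg, neg_add, neg_neg, sub_eq_add_neg]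
  obtain ⟨u, r, s, hr, hs, -, ha, hb⟩ := hray.exists_eq_smul
  have ha' : a = -(r • u) := by rw [← ha, neg_neg]
  rcases eq_or_ne u 0 with rfl | hu
  · obtain ⟨v, hv⟩ := exists_norm_eq E zero_le_one
    exact ⟨v, hv, by simp [ha'], by simp [hb]⟩
  · have hu' := norm_ne_zero_iff.2 hu
    refine ⟨‖u‖⁻¹ • u, norm_smul_inv_norm hu, ?_, ?_⟩
    · rw [ha', norm_neg, norm_smul, Real.norm_of_nonneg hr, smul_smul, mul_inv_cancel_right₀ hu']
    · rw [hb, norm_smul, Real.norm_of_nonneg hs, smul_smul, mul_inv_cancel_right₀ hu']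

end BruhatTits

/-! ## Closest points on geodesics -/

section ClosestPoints

variable {X : Type*} [MetricSpace X] {I : Set ℝ} {α : ℝ → X} {x : X}

theorem BruhatTits.sq_dist_geodesic_le (hX : BruhatTits X) (hα : IsGeodesicOn I α) (p : X)
    {s₁ s₂ l : ℝ} (h₁ : s₁ ∈ I) (h₂ : s₂ ∈ I) (hl : l ∈ Icc (0 : ℝ) 1) :
    (1 - l) * s₁ + l * s₂ ∈ I ∧ dist p (α ((1 - l) * s₁ + l * s₂)) ^ 2 ≤
      (1 - l) * dist p (α s₁) ^ 2 + l * dist p (α s₂) ^ 2 - l * (1 - l) * (s₁ - s₂) ^ 2 := by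
  obtain ⟨-, hI, hd⟩ := hα
  have hl' : 0 ≤ 1 - l := sub_nonneg.2 hl.2
  have hm : (1 - l) * s₁ + l * s₂ ∈ I := hI.convex h₁ h₂ hl' hl.1 (by ring)
  refine ⟨hm, ?_⟩
  have key := hX (α s₁) (α s₂) (α ((1 - l) * s₁ + l * s₂)) p l hl ?_ ?_
  · rwa [hd _ h₁ _ h₂, sq_abs] at key
  · rw [hd _ h₁ _ hm, hd _ h₁ _ h₂, ← abs_of_nonneg hl.1, ← abs_mul, abs_of_nonneg hl.1]
    congr 1
    ring
  · rw [hd _ hm _ h₂, hd _ h₁ _ h₂, ← abs_of_nonneg hl', ← abs_mul, abs_of_nonneg hl']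
    congr 1
    ring

theorem IsGeodesicOn.exists_eq_of_between (hX : BruhatTits X) (hα : IsGeodesicOn I α) {s s' : ℝ}
    (hs : s ∈ I) (hs' : s' ∈ I) {g : X}
    (hg : dist (α s) g + dist g (α s') = dist (α s) (α s')) : ∃ t ∈ uIcc s s', α t = g := by
  wlog hle : s ≤ s' generalizing s s'
  · rw [uIcc_comm]
    refine this hs' hs ?_ (le_of_not_ge hle)
    rw [add_comm, dist_comm g (α s), dist_comm (α s') g, hg, dist_comm]
  have hmem : s + dist (α s) g ∈ Icc s s' := by
    have hd := hα.2.2 s hs s' hs'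
    rw [abs_sub_comm, abs_of_nonneg (sub_nonneg.2 hle)] at hd
    exact ⟨by linarith [dist_nonneg (x := α s) (y := g)],
      by linarith [dist_nonneg (x := g) (y := α s')]⟩
  have hI := hα.2.1.out hs hs' hmem
  have hst := hα.2.2 s hs _ hI
  have hts' := hα.2.2 _ hI s' hs'
  have hss' := hα.2.2 s hs s' hs'
  rw [abs_sub_comm, abs_of_nonneg (by linarith [hmem.1])] at hst
  rw [abs_sub_comm, abs_of_nonneg (by linarith [hmem.2])] at hts'
  rw [abs_sub_comm, abs_of_nonneg (by linarith)] at hss'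
  exact ⟨_, uIcc_of_le hle ▸ hmem, hX.eq_of_between (by linarith) hg (by linarith)⟩

/-- `α s` is a closest point to `x` on the geodesic `α`. -/
def IsProj (I : Set ℝ) (α : ℝ → X) (x : X) (s : ℝ) : Prop :=
  s ∈ I ∧ ∀ t ∈ I, dist x (α s) ≤ dist x (α t)

theorem mem_projPreimage {J : Set ℝ} : x ∈ projPreimage I α J ↔ ∃ s ∈ J, IsProj I α x s :=
  ⟨fun ⟨s, hs, h⟩ => ⟨s, hs.2, hs.1, h⟩, fun ⟨s, hJ, hs, h⟩ => ⟨s, ⟨hs, hJ⟩, h⟩⟩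

theorem isProj_self {s : ℝ} (hs : s ∈ I) : IsProj I α (α s) s :=
  ⟨hs, fun t _ => by rw [dist_self]; exact dist_nonneg⟩

theorem IsProj.of_between {z : X} {s : ℝ} (h : IsProj I α x s)
    (hz : dist x z + dist z (α s) = dist x (α s)) : IsProj I α z s :=
  ⟨h.1, fun t ht => by linarith [h.2 t ht, dist_triangle x z (α t)]⟩

theorem IsProj.dist_lt (hX : BruhatTits X) (hα : IsGeodesicOn I α) {s₀ s₂ l : ℝ}
    (h : IsProj I α x s₀) (h₂ : s₂ ∈ I) (hne : s₀ ≠ s₂) (hl : l ∈ Ioo (0 : ℝ) 1) :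
    dist x (α ((1 - l) * s₀ + l * s₂)) < dist x (α s₂) := by
  obtain ⟨-, hle⟩ := hX.sq_dist_geodesic_le hα x h.1 h₂ ⟨hl.1.le, hl.2.le⟩
  have hmin := mul_le_mul_of_nonneg_left (pow_le_pow_left₀ dist_nonneg (h.2 s₂ h₂) 2)
    (sub_nonneg.2 hl.2.le)
  have hpos : 0 < l * (1 - l) * (s₀ - s₂) ^ 2 :=
    mul_pos (mul_pos hl.1 (sub_pos.2 hl.2)) (sq_pos_iff.2 (sub_ne_zero.2 hne))
  exact lt_of_pow_lt_pow_left₀ 2 dist_nonneg (by nlinarith)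

theorem IsProj.dist_lt_right (hX : BruhatTits X) (hα : IsGeodesicOn I α) {s₀ s₁ s₂ : ℝ}
    (h : IsProj I α x s₀) (h₂ : s₂ ∈ I) (h01 : s₀ < s₁) (h12 : s₁ < s₂) :
    dist x (α s₁) < dist x (α s₂) := by
  have hp : 0 < s₂ - s₀ := by linarith
  have hl : (s₁ - s₀) / (s₂ - s₀) ∈ Ioo (0 : ℝ) 1 :=
    ⟨div_pos (by linarith) hp, (div_lt_one hp).2 (by linarith)⟩
  convert h.dist_lt hX hα h₂ (by linarith) hl using 3
  field_simp
  ring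

theorem IsProj.dist_lt_left (hX : BruhatTits X) (hα : IsGeodesicOn I α) {s₀ s₁ s₂ : ℝ}
    (h : IsProj I α x s₀) (h₂ : s₂ ∈ I) (h01 : s₁ < s₀) (h12 : s₂ < s₁) :
    dist x (α s₁) < dist x (α s₂) := by
  have hp : 0 < s₀ - s₂ := by linarith
  have hl : (s₀ - s₁) / (s₀ - s₂) ∈ Ioo (0 : ℝ) 1 :=
    ⟨div_pos (by linarith) hp, (div_lt_one hp).2 (by linarith)⟩
  convert h.dist_lt hX hα h₂ (by linarith) hl using 3
  field_simp
  ring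

theorem IsProj.unique (hX : BruhatTits X) (hα : IsGeodesicOn I α) {s s' : ℝ}
    (h : IsProj I α x s) (h' : IsProj I α x s') : s = s' := by
  by_contra hne
  have hlt := h.dist_lt hX hα h'.1 hne (l := 1 / 2) (by norm_num)
  have hmem := (hX.sq_dist_geodesic_le hα x h.1 h'.1 (l := 1 / 2) (by norm_num)).1
  exact hlt.not_ge (h'.2 _ hmem)

theorem isProj_of_local (hX : BruhatTits X) (hα : IsGeodesicOn I α) {r δ : ℝ} (hδ : 0 < δ)
    (hr : r ∈ I) (h : ∀ s ∈ Icc (r - δ) (r + δ), dist x (α r) ≤ dist x (α s)) :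
    IsProj I α x r := by
  refine ⟨hr, fun t ht => ?_⟩
  rcases eq_or_ne t r with rfl | hne
  · exact le_rfl
  have hp : 0 < |t - r| := abs_pos.2 (sub_ne_zero.2 hne)
  set l := min 1 (δ / |t - r|)
  have hl0 : 0 < l := lt_min one_pos (div_pos hδ hp)
  have hl1 : l ≤ 1 := min_le_left _ _
  have hconv := (hX.sq_dist_geodesic_le hα x hr ht ⟨hl0.le, hl1⟩).2
  have hnear : |l * (t - r)| ≤ δ := by
    rw [abs_mul, abs_of_pos hl0, ← le_div_iff₀ hp]
    exact min_le_right _ _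
  have hloc := h ((1 - l) * r + l * t) <| by
    have := abs_le.1 hnear
    constructor <;> linarith
  have hsq := pow_le_pow_left₀ dist_nonneg hloc 2
  have hrem : 0 ≤ l * (1 - l) * (r - t) ^ 2 :=
    mul_nonneg (mul_nonneg hl0.le (sub_nonneg.2 hl1)) (sq_nonneg _)
  have hmul : l * dist x (α r) ^ 2 ≤ l * dist x (α t) ^ 2 := by linarith
  exact le_of_sq_le_sq (le_of_mul_le_mul_left hmul hl0) dist_nonneg

end ClosestPoints

/-! ## Curtains -/

section Curtains

variable {X : Type*} [MetricSpace X] {I : Set ℝ} {α : ℝ → X} {r : ℝ} {h h' A B : Set X}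

theorem IsCurtainAt.mem_iff (hc : IsCurtainAt h I α r) {x : X} :
    x ∈ h ↔ ∃ s ∈ Icc (r - 1 / 2) (r + 1 / 2), IsProj I α x s := by
  rw [hc.2.2, curtain, mem_projPreimage]

theorem IsCurtainAt.Icc_subset (hc : IsCurtainAt h I α r) : Icc (r - 1 / 2) (r + 1 / 2) ⊆ I :=
  hc.2.1.trans interior_subset

theorem IsCurtainAt.apply_mem (hc : IsCurtainAt h I α r) {s : ℝ}
    (hs : s ∈ Icc (r - 1 / 2) (r + 1 / 2)) : α s ∈ h :=
  hc.mem_iff.2 ⟨s, hs, isProj_self (hc.Icc_subset hs)⟩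

theorem isCurtainAt_curtain (hα : IsGeodesicOn I α)
    (hr : Icc (r - 1 / 2) (r + 1 / 2) ⊆ interior I) : IsCurtainAt (curtain I α r) I α r :=
  ⟨hα, hr, rfl⟩

theorem Separates.exists_injOn (hX : BruhatTits X) {x y : X} (hs : Separates h {x} {y}) :
    ∃ (I : Set ℝ) (α : ℝ → X) (r : ℝ), IsCurtainAt h I α r ∧
      InjOn (fun s => dist x (α s) - dist y (α s)) (Icc (r - 1 / 2) (r + 1 / 2)) := by
  obtain ⟨I, α, r, hc, hx, hy⟩ := hs
  refine ⟨I, α, r, hc, StrictMonoOn.injOn fun s₁ h₁ s₂ h₂ hlt => ?_⟩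
  obtain ⟨sx, hsx, hx⟩ := mem_projPreimage.1 (hx rfl)
  obtain ⟨sy, hsy, hy⟩ := mem_projPreimage.1 (hy rfl)
  have hltx := hx.dist_lt_right hX hc.1 (hc.Icc_subset h₂) (lt_of_lt_of_le hsx h₁.1) hlt
  have hlty := hy.dist_lt_left hX hc.1 (hc.Icc_subset h₁) (lt_of_le_of_lt h₂.2 hsy) hlt
  linarith

theorem IsCurtain.mem_of_cut (hX : BruhatTits X) (hc : IsCurtain h) {g : X}
    (hAB : A ∪ B = univ) (hg : ∀ a ∈ A, ∀ b ∈ B, dist a g + dist g b = dist a b)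
    (hA : (h ∩ A).Nonempty) (hB : (h ∩ B).Nonempty) : g ∈ h := by
  obtain ⟨I, α, r, hc⟩ := hc
  obtain ⟨z, hz, hzA⟩ := hA
  obtain ⟨z', hz', hzB⟩ := hB
  obtain ⟨s, hs, hp⟩ := hc.mem_iff.1 hz
  obtain ⟨s', hs', hp'⟩ := hc.mem_iff.1 hz'
  have side (u : X) : u ∈ A ∨ u ∈ B := hAB.ge (mem_univ u)
  rcases side (α s) with hsA | hsB
  · rcases side (α s') with hsA' | hsB'
    · have hd := hg _ hsA' _ hzB
      refine hc.mem_iff.2 ⟨s', hs', hp'.of_between ?_⟩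
      rw [dist_comm z' g, dist_comm g (α s'), dist_comm z' (α s'), add_comm, hd]
    · obtain ⟨t, ht, rfl⟩ := hc.1.exists_eq_of_between hX (hc.Icc_subset hs) (hc.Icc_subset hs')
        (hg _ hsA _ hsB')
      exact hc.apply_mem (ordConnected_Icc.uIcc_subset hs hs' ht)
  · exact hc.mem_iff.2 ⟨s, hs, hp.of_between (hg _ hzA _ hsB)⟩

theorem disjoint_curtain (hX : BruhatTits X) (hα : IsGeodesicOn I α) {r' : ℝ} (hr : 1 < |r - r'|) :
    Disjoint (curtain I α r) (curtain I α r') := by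
  rw [disjoint_left]
  intro x hx hx'
  obtain ⟨s, hs, hp⟩ := mem_projPreimage.1 hx
  obtain ⟨s', hs', hp'⟩ := mem_projPreimage.1 hx'
  obtain rfl := hp.unique hX hα hp'
  refine hr.not_ge (abs_le.2 ⟨?_, ?_⟩) <;> linarith [hs.1, hs.2, hs'.1, hs'.2]

theorem separates_curtain (hα : IsGeodesicOn I α) (hr : Icc (r - 1 / 2) (r + 1 / 2) ⊆ interior I)
    {r₁ r₂ : ℝ} (h₁ : r₁ + 1 < r) (h₂ : r + 1 < r₂) :
    Separates (curtain I α r) (curtain I α r₁) (curtain I α r₂) := by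
  refine ⟨_, _, _, isCurtainAt_curtain hα hr, fun x hx => ?_, fun x hx => ?_⟩
  · obtain ⟨s, hs, hp⟩ := mem_projPreimage.1 hx
    exact mem_projPreimage.2 ⟨s, mem_Iio.2 (by linarith [hs.2]), hp⟩
  · obtain ⟨s, hs, hp⟩ := mem_projPreimage.1 hx
    exact mem_projPreimage.2 ⟨s, mem_Ioi.2 (by linarith [hs.1]), hp⟩

theorem isCurtainChain_curtain (hX : BruhatTits X) (hα : IsGeodesicOn I α) {D : ℝ} (hD : 1 < D)
    {n : ℕ}
    (hr : ∀ j : Fin n, Icc (r + D * (j : ℕ) - 1 / 2) (r + D * (j : ℕ) + 1 / 2) ⊆ interior I) :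
    IsCurtainChain (fun j : Fin n => curtain I α (r + D * (j : ℕ))) := by
  refine ⟨fun j => ⟨_, _, _, isCurtainAt_curtain hα (hr j)⟩, fun i j hij => ?_,
    fun i j k hij hjk => separates_curtain hα (hr j) ?_ ?_⟩
  · apply disjoint_curtain hX hα
    rw [add_sub_add_left_eq_sub, ← mul_sub, abs_mul, abs_of_pos (by linarith)]
    have hij' : ((i : ℕ) : ℤ) - ((j : ℕ) : ℤ) ≠ 0 := by
      rw [sub_ne_zero]
      exact_mod_cast Fin.val_ne_of_ne hij
    have hone : (1 : ℝ) ≤ |((i : ℕ) : ℝ) - ((j : ℕ) : ℝ)| := by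
      exact_mod_cast Int.one_le_abs hij'
    exact hD.trans_le (le_mul_of_one_le_right (by linarith) hone)
  · rw [← hij]
    push_cast
    linarith
  · rw [← hjk]
    push_cast
    linarith

theorem projPreimage_neg (I : Set ℝ) (α : ℝ → X) (J : Set ℝ) :
    projPreimage (Neg.neg ⁻¹' I) (fun s => α (-s)) (Neg.neg ⁻¹' J) = projPreimage I α J := by
  ext x
  constructor
  · rintro ⟨s, hs, hx⟩
    exact ⟨-s, hs, fun t ht => by simpa using hx (-t) (by simpa using ht)⟩
  · rintro ⟨s, hs, hx⟩
    exact ⟨-s, by simpa using hs, fun t ht => by simpa using hx (-t) ht⟩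

theorem IsGeodesicOn.comp_neg (hα : IsGeodesicOn I α) :
    IsGeodesicOn (Neg.neg ⁻¹' I) (fun s => α (-s)) := by
  obtain ⟨hI, hI', hd⟩ := hα
  refine ⟨hI.preimage continuous_neg, ?_, fun s hs t ht => ?_⟩
  · exact ⟨fun a ha b hb s hs => hI'.out hb ha ⟨neg_le_neg hs.2, neg_le_neg hs.1⟩⟩
  · rw [hd _ hs _ ht, neg_sub_neg, abs_sub_comm]

theorem Separates.symm (hs : Separates h A B) : Separates h B A := by
  obtain ⟨I, α, r, ⟨hα, hr, rfl⟩, hA, hB⟩ := hs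
  have hIcc : Neg.neg ⁻¹' Icc (r - 1 / 2) (r + 1 / 2) = Icc (-r - 1 / 2) (-r + 1 / 2) := by
    rw [neg_preimage, neg_Icc, neg_add, neg_sub, ← sub_eq_add_neg, sub_eq_add_neg _ r, add_comm]
  have hIio : Neg.neg ⁻¹' Iio (r - 1 / 2) = Ioi (-r + 1 / 2) := by
    rw [neg_preimage, neg_Iio, neg_sub, sub_eq_add_neg, add_comm]
  have hIoi : Neg.neg ⁻¹' Ioi (r + 1 / 2) = Iio (-r - 1 / 2) := by
    rw [neg_preimage, neg_Ioi, neg_add, ← sub_eq_add_neg]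
  refine ⟨Neg.neg ⁻¹' I, fun s => α (-s), -r, ⟨hα.comp_neg, ?_, ?_⟩, ?_, ?_⟩
  · rw [← hIcc]
    exact (preimage_mono hr).trans (preimage_interior_subset_interior_preimage continuous_neg)
  · rw [curtain, curtain, ← hIcc, projPreimage_neg]
  · rwa [halfMinus, ← hIoi, projPreimage_neg]
  · rwa [halfPlus, ← hIio, projPreimage_neg]

theorem LSeparated.symm {L : ℕ} (hs : LSeparated L h h') : LSeparated L h' h :=
  ⟨hs.1.symm, fun n c hc hm => hs.2 n c hc fun i => (hm i).symm⟩

theorem LSeparated.mono {L L' : ℕ} (hs : LSeparated L h h') (hL : L ≤ L') : LSeparated L' h h' :=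
  ⟨hs.1, fun n c hc hm => (hs.2 n c hc hm).trans hL⟩

theorem isLChain_curtain (hX : BruhatTits X) (hα : IsGeodesicOn I α) {D : ℝ} (hD : 1 < D) {n L : ℕ}
    (hr : ∀ j : Fin n, Icc (r + D * (j : ℕ) - 1 / 2) (r + D * (j : ℕ) + 1 / 2) ⊆ interior I)
    (hL : ∀ j k : Fin n, r + D * (j : ℕ) + D ≤ r + D * (k : ℕ) →
      LSeparated L (curtain I α (r + D * (j : ℕ))) (curtain I α (r + D * (k : ℕ)))) :
    IsLChain L (fun j : Fin n => curtain I α (r + D * (j : ℕ))) := by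
  refine ⟨isCurtainChain_curtain hX hα hD hr, ?_⟩
  have hlt (i j : Fin n) (hij : i < j) : r + D * ((i : ℕ) : ℝ) + D ≤ r + D * ((j : ℕ) : ℝ) := by
    have hcast : ((i : ℕ) : ℝ) + 1 ≤ ((j : ℕ) : ℝ) := by exact_mod_cast hij
    nlinarith
  intro i j hij
  rcases lt_or_gt_of_ne hij with hij | hij
  · exact hL i j (hlt i j hij)
  · exact (hL j i (hlt j i hij)).symm

end Curtains

/-! ## The distances `d_L` -/

section SeparatingChains

variable {X : Type*} [MetricSpace X] {L : ℕ} {x y : X}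

/-- The lengths of the `L`-chains separating `x` from `y`, the set over which the supremum is taken
in the definition of `d_L`. -/
def chainLengths (L : ℕ) (x y : X) : Set ℕ :=
  {n | ∃ c : Fin n → Set X, IsLChain L c ∧ ∀ i, Separates (c i) {x} {y}}

/-- Every `L`-chain separating `x` from `y` has at most `B` members. -/
def ChainBound (L : ℕ) (x y : X) (B : ℝ) : Prop :=
  ∀ (n : ℕ) (c : Fin n → Set X), IsLChain L c → (∀ i, Separates (c i) {x} {y}) → (n : ℝ) ≤ B

theorem dL_self (L : ℕ) (x : X) : dL L x x = 0 := if_pos rfl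

theorem dL_of_ne (hxy : x ≠ y) : dL L x y = 1 + ((sSup (chainLengths L x y) : ℕ) : ℝ) :=
  if_neg hxy

theorem dL_nonneg (L : ℕ) (x y : X) : 0 ≤ dL L x y := by
  unfold dL
  split_ifs <;> positivity

theorem ChainBound.dL_le {B : ℝ} (hB : 0 ≤ B) (h : ChainBound L x y B) : dL L x y ≤ 1 + B := by
  rcases eq_or_ne x y with rfl | hxy
  · rw [dL_self]
    positivity
  · rw [dL_of_ne hxy, add_le_add_iff_left, ← Nat.le_floor_iff hB]
    exact csSup_le' fun n ⟨c, hc, hs⟩ => Nat.le_floor (h n c hc hs)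

theorem ChainBound.le_dL {B : ℝ} (h : ChainBound L x y B) (hxy : x ≠ y) {n : ℕ}
    {c : Fin n → Set X} (hc : IsLChain L c) (hs : ∀ i, Separates (c i) {x} {y}) :
    1 + (n : ℝ) ≤ dL L x y := by
  rw [dL_of_ne hxy, add_le_add_iff_left, Nat.cast_le]
  exact le_csSup ⟨⌊B⌋₊, fun n ⟨c, hc, hs⟩ => Nat.le_floor (h n c hc hs)⟩ ⟨c, hc, hs⟩

theorem chainLengths_comm (L : ℕ) (x y : X) : chainLengths L x y = chainLengths L y x := by
  ext n
  exact exists_congr fun c => and_congr_right fun _ =>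
    forall_congr' fun i => ⟨Separates.symm, Separates.symm⟩

theorem dL_comm (L : ℕ) (x y : X) : dL L x y = dL L y x := by
  rcases eq_or_ne x y with rfl | hxy
  · rfl
  · rw [dL_of_ne hxy, dL_of_ne hxy.symm, chainLengths_comm]

/-- The curtains dual to `α` at distance `D` from each other, the first of which is dual at
`s + D / 2`, form an `L`-chain. -/
theorem ChainBound.sub_div_le_dL {B : ℝ} (hB : ChainBound L x y B) (hX : BruhatTits X)
    {I : Set ℝ} {α : ℝ → X} (hα : IsGeodesicOn I α) {D : ℝ} (hD : 1 < D) {s t : ℝ}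
    (hs : IsProj I α x s) (ht : IsProj I α y t)
    (hL : ∀ r r', s ≤ r → r + D ≤ r' → LSeparated L (curtain I α r) (curtain I α r')) :
    (t - s) / D ≤ dL L x y := by
  have hD0 : 0 < D := one_pos.trans hD
  rcases le_or_gt t s with hle | hlt
  · exact (div_nonpos_of_nonpos_of_nonneg (sub_nonpos.2 hle) hD0.le).trans (dL_nonneg L x y)
  have hxy : x ≠ y := by
    rintro rfl
    exact hlt.ne (hs.unique hX hα ht)
  set n := ⌊(t - s) / D⌋₊
  have hn : D * n ≤ t - s := by
    rw [mul_comm, ← le_div_iff₀ hD0]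
    exact Nat.floor_le (div_nonneg (sub_nonneg.2 hlt.le) hD0.le)
  have hnonneg : ∀ j : Fin n, 0 ≤ D * ((j : ℕ) : ℝ) := fun j => by positivity
  have hj : ∀ j : Fin n, D * ((j : ℕ) : ℝ) + D ≤ t - s := fun j => by
    have hjn : ((j : ℕ) : ℝ) + 1 ≤ n := by exact_mod_cast j.2
    nlinarith
  have hI : ∀ j : Fin n, Icc (s + D / 2 + D * (j : ℕ) - 1 / 2) (s + D / 2 + D * (j : ℕ) + 1 / 2)
      ⊆ interior I := fun j => by
    refine Subset.trans ?_ (interior_mono (hα.2.1.out hs.1 ht.1))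
    rw [interior_Icc]
    exact Icc_subset_Ioo (by linarith [hnonneg j]) (by linarith [hj j])
  have hchain := isLChain_curtain hX hα hD hI fun j k => hL _ _ (by linarith [hnonneg j])
  refine (Nat.lt_floor_add_one _).le.trans <| (add_comm _ _).trans_le <|
    hB.le_dL hxy hchain fun j => ?_
  refine ⟨I, α, _, isCurtainAt_curtain hα (hI j), singleton_subset_iff.2 ?_,
    singleton_subset_iff.2 ?_⟩
  · exact mem_projPreimage.2 ⟨s, by rw [mem_Iio]; linarith [hnonneg j], hs⟩
  · exact mem_projPreimage.2 ⟨t, by rw [mem_Ioi]; linarith [hj j], ht⟩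

end SeparatingChains

section Isometry

variable {X Y : Type*} [MetricSpace X] [MetricSpace Y] (e : X ≃ᵢ Y)

theorem image_projPreimage (I : Set ℝ) (α : ℝ → X) (J : Set ℝ) :
    e '' projPreimage I α J = projPreimage I (e ∘ α) J := by
  ext y
  constructor
  · rintro ⟨x, ⟨s, hs, h⟩, rfl⟩
    exact ⟨s, hs, fun t ht => by simpa only [Function.comp_apply, e.dist_eq] using h t ht⟩
  · rintro ⟨s, hs, h⟩
    refine ⟨e.symm y, ⟨s, hs, fun t ht => ?_⟩, by simp⟩
    rw [← e.dist_eq, ← e.dist_eq (e.symm y) (α t)]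
    simpa using h t ht

variable {I : Set ℝ} {α : ℝ → X} {h h' A B : Set X} {L n : ℕ} {c : Fin n → Set X}

theorem IsCurtainAt.image {r : ℝ} (hc : IsCurtainAt h I α r) :
    IsCurtainAt (e '' h) I (e ∘ α) r := by
  obtain ⟨⟨hI, hI', hd⟩, hr, rfl⟩ := hc
  refine ⟨⟨hI, hI', fun s hs t ht => ?_⟩, hr, image_projPreimage e _ _ _⟩
  rw [Function.comp_apply, Function.comp_apply, e.dist_eq, hd s hs t ht]

theorem Separates.image (hs : Separates h A B) : Separates (e '' h) (e '' A) (e '' B) := by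
  obtain ⟨I, α, r, hc, hA, hB⟩ := hs
  refine ⟨I, e ∘ α, r, hc.image e, ?_, ?_⟩
  · rw [halfMinus, ← image_projPreimage]
    exact image_mono hA
  · rw [halfPlus, ← image_projPreimage]
    exact image_mono hB

theorem IsCurtainChain.image (hc : IsCurtainChain c) : IsCurtainChain (fun i => e '' c i) := by
  refine ⟨fun i => ?_, fun i j hij => ?_, fun i j k hij hjk => (hc.2.2 i j k hij hjk).image e⟩
  · obtain ⟨I, α, r, h⟩ := hc.1 i
    exact ⟨I, e ∘ α, r, h.image e⟩
  · exact (disjoint_image_iff e.injective).2 (hc.2.1 i j hij)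

theorem LSeparated.image (hs : LSeparated L h h') : LSeparated L (e '' h) (e '' h') := by
  refine ⟨(disjoint_image_iff e.injective).2 hs.1, fun n c hc hm => ?_⟩
  refine hs.2 n (fun i => e.symm '' c i) (hc.image e.symm) fun i => ?_
  obtain ⟨⟨_, hz, x, hx, rfl⟩, ⟨_, hz', x', hx', rfl⟩⟩ := hm i
  exact ⟨⟨x, ⟨_, hz, by simp⟩, hx⟩, ⟨x', ⟨_, hz', by simp⟩, hx'⟩⟩

theorem chainLengths_subset (L : ℕ) (x y : X) :
    chainLengths L x y ⊆ chainLengths L (e x) (e y) := by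
  rintro n ⟨c, ⟨hc, hL⟩, hs⟩
  refine ⟨fun i => e '' c i, ⟨hc.image e, fun i j hij => (hL i j hij).image e⟩, fun i => ?_⟩
  simpa only [image_singleton] using (hs i).image e

theorem dL_isometryEquiv (L : ℕ) (x y : X) : dL L (e x) (e y) = dL L x y := by
  rcases eq_or_ne x y with rfl | hxy
  · rw [dL_self, dL_self]
  have hsub := chainLengths_subset e.symm L (e x) (e y)
  rw [e.symm_apply_apply, e.symm_apply_apply] at hsub
  rw [dL_of_ne hxy, dL_of_ne (e.injective.ne hxy), hsub.antisymm (chainLengths_subset e L x y)]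

end Isometry

/-! ## Gluing rays -/

namespace AttachRays

variable {X ι : Type*} {p : ι → X}

section Rays

/-- The point of the base space from which the ray through `u` issues. -/
def foot : AttachRays p → X
  | base x => x
  | ray i _ _ => p i

/-- The distance to the base space. -/
def height : AttachRays p → ℝ
  | base _ => 0
  | ray _ s _ => s

theorem height_nonneg (u : AttachRays p) : 0 ≤ u.height := by
  cases u with
  | base x => exact le_rfl
  | ray i s hs => exact hs.le

/-- The point at distance `t` from the origin on the `i`-th ray, as a function of `t : ℝ`; for
`t ≤ 0` it is the origin of the ray. -/
def rayPoint (p : ι → X) (i : ι) (t : ℝ) : AttachRays p :=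
  if h : 0 < t then ray i t h else base (p i)

theorem rayPoint_of_pos (i : ι) {t : ℝ} (h : 0 < t) : rayPoint p i t = ray i t h := dif_pos h

theorem rayPoint_zero (i : ι) : rayPoint p i 0 = base (p i) := dif_neg (lt_irrefl _)

/-- The point `u` lies on the `i`-th ray, away from its origin. -/
def OnRay (i : ι) (u : AttachRays p) : Prop := ∃ t ht, u = ray i t ht

/-- The points `u` and `v` lie on the same ray, away from its origin. -/
def OnSameRay (u v : AttachRays p) : Prop := ∃ i, OnRay i u ∧ OnRay i v

open Classical in
/-- The position of the projection of `u` to the `i`-th ray. -/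
def rayHeight (i : ι) (u : AttachRays p) : ℝ := if OnRay i u then u.height else 0

theorem onRay_ray (i : ι) (t : ℝ) (ht : 0 < t) : OnRay i (ray i t ht : AttachRays p) :=
  ⟨t, ht, rfl⟩

theorem onRay_ray_iff {i j : ι} {t : ℝ} {ht : 0 < t} :
    OnRay i (ray j t ht : AttachRays p) ↔ j = i := by
  refine ⟨fun ⟨s, hs, h⟩ => (ray.inj h).1, ?_⟩
  rintro rfl
  exact onRay_ray j t ht

theorem exists_onRay_of_height_pos {u : AttachRays p} (h : 0 < u.height) : ∃ i, OnRay i u := by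
  rcases u with x | ⟨i, s, hs⟩
  · exact absurd h (lt_irrefl 0)
  · exact ⟨i, onRay_ray i s hs⟩

theorem rayHeight_of_onRay {i : ι} {u : AttachRays p} (h : OnRay i u) :
    rayHeight i u = u.height := if_pos h

theorem rayHeight_of_not_onRay {i : ι} {u : AttachRays p} (h : ¬ OnRay i u) :
    rayHeight i u = 0 := if_neg h

theorem rayHeight_nonneg (i : ι) (u : AttachRays p) : 0 ≤ rayHeight i u := by
  unfold rayHeight
  split_ifs
  exacts [u.height_nonneg, le_rfl]

theorem eq_rayPoint_of_rayHeight_pos {i : ι} {u : AttachRays p} (h : 0 < rayHeight i u) :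
    u = rayPoint p i (rayHeight i u) := by
  by_cases hu : OnRay i u
  · obtain ⟨t, ht, rfl⟩ := hu
    rw [rayHeight_of_onRay (onRay_ray i t ht)]
    exact (rayPoint_of_pos i ht).symm
  · exact absurd h (rayHeight_of_not_onRay hu).not_gt

end Rays

section Distances

variable [MetricSpace X]

theorem dist_base_base (x y : X) : dist (base x : AttachRays p) (base y) = dist x y := rfl

theorem dist_base_ray (x : X) (i : ι) (s : ℝ) (hs : 0 < s) :
    dist (base x : AttachRays p) (ray i s hs) = dist x (p i) + s := rfl

theorem dist_ray_base (x : X) (i : ι) (s : ℝ) (hs : 0 < s) :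
    dist (ray i s hs : AttachRays p) (base x) = s + dist (p i) x := rfl

theorem dist_ray_same (i : ι) (s t : ℝ) (hs : 0 < s) (ht : 0 < t) :
    dist (ray i s hs : AttachRays p) (ray i t ht) = |s - t| := if_pos rfl

theorem dist_ray_ray {i j : ι} (h : i ≠ j) (s t : ℝ) (hs : 0 < s) (ht : 0 < t) :
    dist (ray i s hs : AttachRays p) (ray j t ht) = s + dist (p i) (p j) + t := if_neg h

theorem dist_base (z : X) (u : AttachRays p) : dist (base z) u = dist z u.foot + u.height := by
  cases u with
  | base x => exact (add_zero _).symm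
  | ray i s hs => rfl

theorem dist_eq_of_not_onSameRay {u v : AttachRays p} (h : ¬ OnSameRay u v) :
    dist u v = u.height + dist u.foot v.foot + v.height := by
  rcases u with x | ⟨i, s, hs⟩
  · rw [dist_base, height, zero_add]
    rfl
  rcases v with y | ⟨j, t, ht⟩
  · exact (add_zero _).symm
  · refine dist_ray_ray ?_ s t hs ht
    rintro rfl
    exact h ⟨i, onRay_ray i s hs, onRay_ray i t ht⟩

/-- The signed position of `u` with respect to the `i`-th ray: the points off the ray have their
distance to its origin as negative coordinates. -/
def rayCoord (i : ι) (u : AttachRays p) : ℝ := by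
  classical exact if OnRay i u then u.height else -dist (base (p i)) u

theorem rayCoord_of_onRay {i : ι} {u : AttachRays p} (h : OnRay i u) :
    rayCoord i u = u.height := if_pos h

theorem rayCoord_of_not_onRay {i : ι} {u : AttachRays p} (h : ¬ OnRay i u) :
    rayCoord i u = -dist (base (p i)) u := if_neg h

theorem onRay_of_rayCoord_pos {i : ι} {u : AttachRays p} (h : 0 < rayCoord i u) : OnRay i u := by
  by_contra hu
  rw [rayCoord_of_not_onRay hu, neg_pos] at h
  exact h.not_ge dist_nonneg

theorem rayHeight_eq_max (i : ι) (u : AttachRays p) : rayHeight i u = max 0 (rayCoord i u) := by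
  by_cases h : OnRay i u
  · rw [rayHeight_of_onRay h, rayCoord_of_onRay h, max_eq_right u.height_nonneg]
  · rw [rayHeight_of_not_onRay h, rayCoord_of_not_onRay h, max_eq_left (by simp)]

theorem dist_ray (i : ι) (s : ℝ) (hs : 0 < s) (u : AttachRays p) :
    dist (ray i s hs) u = |s - rayCoord i u| := by
  by_cases h : OnRay i u
  · rw [rayCoord_of_onRay h]
    obtain ⟨t, ht, rfl⟩ := h
    exact dist_ray_same i s t hs ht
  · rw [rayCoord_of_not_onRay h, sub_neg_eq_add, abs_of_nonneg (by positivity)]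
    rcases u with x | ⟨j, t, ht⟩
    · rfl
    · rw [dist_ray_ray, dist_base_ray, add_assoc]
      rintro rfl
      exact h (onRay_ray i t ht)

theorem dist_rayPoint (i : ι) {s : ℝ} (hs : 0 ≤ s) (u : AttachRays p) :
    dist (rayPoint p i s) u = |s - rayCoord i u| := by
  rcases hs.eq_or_lt with rfl | hs
  · rw [rayPoint_zero, zero_sub, abs_neg]
    by_cases h : OnRay i u
    · rw [rayCoord_of_onRay h, abs_of_nonneg u.height_nonneg]
      obtain ⟨t, ht, rfl⟩ := h
      rw [dist_base_ray, dist_self, zero_add]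
      rfl
    · rw [rayCoord_of_not_onRay h, abs_neg, abs_of_nonneg dist_nonneg]
  · rw [rayPoint_of_pos i hs, dist_ray]

theorem rayCoord_rayPoint (i : ι) {t : ℝ} (ht : 0 ≤ t) : rayCoord i (rayPoint p i t) = t := by
  have h := dist_rayPoint i ht (rayPoint p i t)
  rw [dist_self, eq_comm, abs_eq_zero, sub_eq_zero] at h
  exact h.symm

theorem rayHeight_rayPoint (i : ι) {t : ℝ} (ht : 0 ≤ t) : rayHeight i (rayPoint p i t) = t := by
  rw [rayHeight_eq_max, rayCoord_rayPoint i ht, max_eq_right ht]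

theorem dist_rayPoint_rayPoint (i : ι) {s t : ℝ} (hs : 0 ≤ s) (ht : 0 ≤ t) :
    dist (rayPoint p i s) (rayPoint p i t) = |s - t| := by
  rw [dist_rayPoint i hs, rayCoord_rayPoint i ht]

theorem dist_rayPoint_rayPoint_of_ne {i j : ι} (hij : i ≠ j) {s t : ℝ} (hs : 0 ≤ s) (ht : 0 ≤ t) :
    dist (rayPoint p i s) (rayPoint p j t) = s + dist (p i) (p j) + t := by
  rcases hs.eq_or_lt with rfl | hs <;> rcases ht.eq_or_lt with rfl | ht
  · rw [rayPoint_zero, rayPoint_zero, dist_base_base, zero_add, add_zero]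
  · rw [rayPoint_zero, rayPoint_of_pos j ht, dist_base_ray, zero_add]
  · rw [rayPoint_zero, rayPoint_of_pos i hs, dist_ray_base, add_zero]
  · rw [rayPoint_of_pos i hs, rayPoint_of_pos j ht, dist_ray_ray hij]

theorem dist_eq_abs_rayCoord_sub {i : ι} {u : AttachRays p} (hu : OnRay i u) (v : AttachRays p) :
    dist u v = |rayCoord i u - rayCoord i v| := by
  rw [rayCoord_of_onRay hu]
  obtain ⟨t, ht, rfl⟩ := hu
  exact dist_ray i t ht v

theorem abs_rayCoord_sub_le (i : ι) (u v : AttachRays p) :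
    |rayCoord i u - rayCoord i v| ≤ dist u v := by
  by_cases hu : OnRay i u
  · exact (dist_eq_abs_rayCoord_sub hu v).ge
  by_cases hv : OnRay i v
  · rw [abs_sub_comm, dist_comm]
    exact (dist_eq_abs_rayCoord_sub hv u).ge
  · rw [rayCoord_of_not_onRay hu, rayCoord_of_not_onRay hv, neg_sub_neg, abs_sub_comm,
      dist_comm _ u, dist_comm _ v]
    exact abs_dist_sub_le _ _ _

end Distances

/-! ## Gluing rays to CAT(0) spaces -/

section ExtendLog

variable {E : Type*} [NormedAddCommGroup E] [NormedSpace ℝ E] {L : X → E} {e : ι → E}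

/-- The extension of `L` to the attached rays, the `i`-th of which is mapped to the ray issuing from
`L (p i)` with direction `e i`. -/
def extendLog (L : X → E) (e : ι → E) : AttachRays p → E
  | base x => L x
  | ray i s _ => L (p i) + s • e i

theorem extendLog_eq_smul {w : E} {u : AttachRays p} (hw : L u.foot = ‖L u.foot‖ • w)
    (he : ∀ i, OnRay i u → e i = w) : extendLog L e u = (‖L u.foot‖ + u.height) • w := by
  rcases u with x | ⟨i, s, hs⟩
  · exact hw.trans (by simp [height])
  · rw [add_smul, ← hw, ← he i (onRay_ray i s hs)]
    rfl

/-- The directions can be chosen so that `extendLog L e` preserves the distances to the zero of `L`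
and maps `x` and `y` to opposite half-lines. -/
theorem exists_ray_directions [StrictConvexSpace ℝ E] [Nontrivial E] {x y : AttachRays p} {v : E}
    (hxy : ¬ OnSameRay x y) (hv : ‖v‖ = 1) (hx : L x.foot = ‖L x.foot‖ • -v)
    (hy : L y.foot = ‖L y.foot‖ • v) :
    ∃ e : ι → E, (∀ i, ‖e i‖ = 1) ∧ (∀ i, L (p i) = ‖L (p i)‖ • e i) ∧
      (∀ i, OnRay i x → e i = -v) ∧ ∀ i, OnRay i y → e i = v := by
  suffices h : ∀ i, ∃ w : E, ‖w‖ = 1 ∧ L (p i) = ‖L (p i)‖ • w ∧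
      (OnRay i x → w = -v) ∧ (OnRay i y → w = v) by
    choose e h1 h2 h3 h4 using h
    exact ⟨e, h1, h2, h3, h4⟩
  intro i
  by_cases hix : OnRay i x
  · refine ⟨-v, by rwa [norm_neg], ?_, fun _ => rfl, fun hiy => (hxy ⟨i, hix, hiy⟩).elim⟩
    obtain ⟨s, hs, rfl⟩ := hix
    exact hx
  by_cases hiy : OnRay i y
  · refine ⟨v, hv, ?_, fun h => (hix h).elim, fun _ => rfl⟩
    obtain ⟨s, hs, rfl⟩ := hiy
    exact hy
  obtain ⟨w, hw, -, hpw⟩ := exists_smul_of_norm_sub_eq_add (a := (0 : E)) (b := L (p i)) (by simp)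
  exact ⟨w, hw, hpw, fun h => (hix h).elim, fun h => (hiy h).elim⟩

variable [MetricSpace X]

theorem dist_extendLog_le (hL : ∀ x y, dist (L x) (L y) ≤ dist x y) (he : ∀ i, ‖e i‖ = 1)
    (u v : AttachRays p) : dist (extendLog L e u) (extendLog L e v) ≤ dist u v := by
  have hfoot : ∀ u : AttachRays p, dist (extendLog L e u) (L u.foot) = u.height := by
    rintro (x | ⟨i, s, hs⟩)
    · exact dist_self _
    · change dist (L (p i) + s • e i) (L (p i)) = s
      rw [dist_self_add_left, norm_smul, he, mul_one, Real.norm_of_nonneg hs.le]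
  by_cases h : OnSameRay u v
  · obtain ⟨i, ⟨s, hs, rfl⟩, ⟨t, ht, rfl⟩⟩ := h
    simp only [extendLog]
    rw [dist_add_left, dist_eq_norm, ← sub_smul, norm_smul, he, mul_one, dist_ray_same,
      Real.norm_eq_abs]
  · rw [dist_eq_of_not_onSameRay h]
    refine (dist_triangle4 _ (L u.foot) (L v.foot) _).trans ?_
    rw [hfoot u, dist_comm _ (extendLog L e v), hfoot v]
    gcongr
    exact hL _ _

theorem norm_extendLog {z : X} (hL : ∀ x, ‖L x‖ = dist z x) (he : ∀ i, ‖e i‖ = 1)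
    (hp : ∀ i, L (p i) = ‖L (p i)‖ • e i) (u : AttachRays p) :
    ‖extendLog L e u‖ = dist (base z) u := by
  rcases u with x | ⟨i, s, hs⟩
  · exact hL x
  · rw [extendLog_eq_smul (hp i) fun j hj => by rw [onRay_ray_iff.1 hj], norm_smul, he, mul_one,
      Real.norm_of_nonneg (add_nonneg (norm_nonneg _) (height_nonneg _)), hL, dist_base]

end ExtendLog

section CAT0

variable [MetricSpace X]

theorem joinedByGeodesic_rayPoint (i : ι) {s t : ℝ} (hs : 0 ≤ s) (ht : 0 ≤ t) :
    JoinedByGeodesic (rayPoint p i s) (rayPoint p i t) := by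
  have hnonneg : ∀ r ∈ Icc (0 : ℝ) 1, 0 ≤ (1 - r) * s + r * t := fun r hr =>
    add_nonneg (mul_nonneg (sub_nonneg.2 hr.2) hs) (mul_nonneg hr.1 ht)
  refine ⟨fun r => rayPoint p i ((1 - r) * s + r * t), by simp, by simp, fun r hr r' hr' => ?_⟩
  rw [dist_rayPoint_rayPoint i (hnonneg r hr) (hnonneg r' hr'), dist_rayPoint_rayPoint i hs ht,
    ← abs_mul, ← abs_neg]
  congr 1
  ring

theorem joinedByGeodesic (hX : ∀ x y : X, JoinedByGeodesic x y) (u v : AttachRays p) :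
    JoinedByGeodesic u v := by
  have hbase : ∀ x y : X, JoinedByGeodesic (base x : AttachRays p) (base y) := fun x y => by
    obtain ⟨c, c0, c1, hc⟩ := hX x y
    exact ⟨fun s => base (c s), congrArg base c0, congrArg base c1, hc⟩
  have hfoot : ∀ u : AttachRays p, JoinedByGeodesic (base u.foot) u := by
    rintro (u | ⟨i, s, hs⟩)
    · exact hbase u u
    · have h := joinedByGeodesic_rayPoint (p := p) i le_rfl hs.le
      rwa [rayPoint_zero, rayPoint_of_pos i hs] at h
  by_cases h : OnSameRay u v
  · obtain ⟨i, ⟨s, hs, rfl⟩, ⟨t, ht, rfl⟩⟩ := h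
    simpa only [rayPoint_of_pos i hs, rayPoint_of_pos i ht] using
      joinedByGeodesic_rayPoint (p := p) i hs.le ht.le
  · have hd := dist_eq_of_not_onSameRay h
    refine (hfoot u).symm.trans ((hbase _ _).trans (hfoot v) ?_) ?_
    · rw [dist_base, dist_base, dist_base, dist_self, zero_add]
      exact congrArg (· + _) (add_zero _)
    · rw [hd, dist_comm u, dist_base, dist_base, dist_self]
      ring

theorem exists_isLogMap_base (hX : HasLogMaps X) {x y : AttachRays p} {z : X}
    (hxy : dist x (base z) + dist (base z) y = dist x y) :
    ∃ L : AttachRays p → ℂ, IsLogMap L x (base z) y := by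
  have hns : ¬ OnSameRay x y := by
    rintro ⟨i, ⟨s, hs, rfl⟩, ⟨t, ht, rfl⟩⟩
    rw [dist_ray_same, dist_ray_base, dist_base_ray] at hxy
    have h : |s - t| < s + t := abs_lt.2 ⟨by linarith, by linarith⟩
    linarith [dist_nonneg (x := p i) (y := z), dist_nonneg (x := z) (y := p i)]
  have hfoot : dist x.foot z + dist z y.foot = dist x.foot y.foot := by
    rw [dist_eq_of_not_onSameRay hns, dist_comm x, dist_base, dist_base, dist_comm z] at hxy
    linarith
  obtain ⟨L, hL⟩ := hX x.foot z y.foot hfoot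
  obtain ⟨v, hv, hx, hy⟩ := exists_smul_of_norm_sub_eq_add (a := L x.foot) (b := L y.foot)
    (by rw [← dist_eq_norm, hL.dist_eq, hL.norm_eq, hL.norm_eq, dist_comm z x.foot, hfoot])
  rw [← smul_neg] at hx
  obtain ⟨e, he, hp, hex, hey⟩ := exists_ray_directions hns hv hx hy
  refine ⟨extendLog L e, dist_extendLog_le hL.dist_le he, norm_extendLog hL.norm_eq he hp, ?_⟩
  have hnonneg : ∀ u : AttachRays p, 0 ≤ ‖L u.foot‖ + u.height := fun u =>
    add_nonneg (norm_nonneg _) u.height_nonneg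
  rw [extendLog_eq_smul hx hex, extendLog_eq_smul hy hey, smul_neg, dist_eq_norm, ← neg_add',
    ← add_smul, norm_neg, norm_smul, hv, mul_one,
    Real.norm_of_nonneg (add_nonneg (hnonneg x) (hnonneg y)), ← hxy, dist_comm x, dist_base,
    dist_base, hL.norm_eq, hL.norm_eq]

/-- At a point of a ray, the signed position along the ray is a logarithm map. -/
theorem exists_isLogMap_ray {x y : AttachRays p} (i : ι) {s : ℝ} {hs : 0 < s}
    (hxy : dist x (ray i s hs) + dist (ray i s hs) y = dist x y) :
    ∃ L : AttachRays p → ℂ, IsLogMap L x (ray i s hs) y := by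
  have hdist : ∀ u v : AttachRays p,
      dist ((rayCoord i u - s : ℝ) : ℂ) ((rayCoord i v - s : ℝ) : ℂ)
        = |rayCoord i u - rayCoord i v| := fun u v => by
    rw [Complex.isometry_ofReal.dist_eq, Real.dist_eq, sub_sub_sub_cancel_right]
  refine ⟨fun u => (rayCoord i u - s : ℝ), fun u v => ?_, fun u => ?_, ?_⟩
  · rw [hdist]
    exact abs_rayCoord_sub_le i u v
  · rw [Complex.norm_real, Real.norm_eq_abs, dist_ray, abs_sub_comm]
  · rw [hdist]
    by_cases hx : OnRay i x
    · exact (dist_eq_abs_rayCoord_sub hx y).symm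
    by_cases hy : OnRay i y
    · rw [abs_sub_comm, dist_comm]
      exact (dist_eq_abs_rayCoord_sub hy x).symm
    rw [dist_comm x, dist_ray, dist_ray, rayCoord_of_not_onRay hx, rayCoord_of_not_onRay hy,
      sub_neg_eq_add, sub_neg_eq_add, abs_of_nonneg (by positivity),
      abs_of_nonneg (by positivity)] at hxy
    linarith [dist_triangle_left x y (base (p i))]

theorem hasLogMaps (hX : HasLogMaps X) : HasLogMaps (AttachRays p) := by
  intro x z y hxy
  rcases z with z | ⟨i, s, hs⟩
  · exact exists_isLogMap_base hX hxy
  · exact exists_isLogMap_ray i hxy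

end CAT0

end AttachRays

/-! ## Curtains along a ray -/

namespace AttachRays

section RayCurtains

variable {X ι : Type*} [MetricSpace X] {p : ι → X}

theorem isGeodesicOn_rayPoint (p : ι → X) (i : ι) : IsGeodesicOn (Ici 0) (rayPoint p i) :=
  ⟨isClosed_Ici, ordConnected_Ici, fun _ hs _ ht => dist_rayPoint_rayPoint i hs ht⟩

theorem isProj_rayPoint (i : ι) (u : AttachRays p) :
    IsProj (Ici 0) (rayPoint p i) u (rayHeight i u) := by
  refine ⟨rayHeight_nonneg i u, fun t (ht : 0 ≤ t) => ?_⟩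
  rw [dist_comm, dist_rayPoint i (rayHeight_nonneg i u), dist_comm, dist_rayPoint i ht,
    rayHeight_eq_max]
  rcases le_total 0 (rayCoord i u) with h | h
  · rw [max_eq_right h, sub_self, abs_zero]
    exact abs_nonneg _
  · rw [max_eq_left h, abs_of_nonneg (by linarith), abs_of_nonneg (by linarith)]
    linarith

theorem dist_add_dist_rayPoint {i : ι} {s t : ℝ} (hs : 0 ≤ s) (hst : s ≤ t) {u : AttachRays p}
    (hu : rayHeight i u ≤ s) :
    dist (rayPoint p i t) (rayPoint p i s) + dist (rayPoint p i s) u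
      = dist (rayPoint p i t) u := by
  rw [rayHeight_eq_max] at hu
  have hu' : rayCoord i u ≤ s := (le_max_right _ _).trans hu
  rw [dist_rayPoint i (hs.trans hst), rayCoord_rayPoint i hs, dist_rayPoint i hs,
    dist_rayPoint i (hs.trans hst), abs_of_nonneg (by linarith), abs_of_nonneg (by linarith),
    abs_of_nonneg (by linarith), sub_add_sub_cancel]

theorem rayPoint_mem_of_isCurtain (hW : BruhatTits (AttachRays p)) {h : Set (AttachRays p)}
    (hc : IsCurtain h) {i : ι} {s : ℝ} (hs : 0 ≤ s) {u v : AttachRays p} (huh : u ∈ h)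
    (hu : rayHeight i u ≤ s) (hvh : v ∈ h) (hv : s < rayHeight i v) : rayPoint p i s ∈ h := by
  refine hc.mem_of_cut hW (A := {w | s < rayHeight i w}) (B := {w | rayHeight i w ≤ s})
    (eq_univ_of_forall fun w => lt_or_ge s (rayHeight i w))
    (fun a (ha : s < rayHeight i a) b hb => ?_) ⟨v, hvh, hv⟩ ⟨u, huh, hu⟩
  rw [eq_rayPoint_of_rayHeight_pos (hs.trans_lt ha)]
  exact dist_add_dist_rayPoint hs ha.le hb

theorem lSeparated_ray (hW : BruhatTits (AttachRays p)) (i : ι) {s t : ℝ} (hs : 0 ≤ s)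
    (hst : s + 2 ≤ t) :
    LSeparated 1 (curtain (Ici 0) (rayPoint p i) s) (curtain (Ici 0) (rayPoint p i) t) := by
  have hα := isGeodesicOn_rayPoint p i
  have hmem : ∀ {r : ℝ} {u : AttachRays p}, u ∈ curtain (Ici 0) (rayPoint p i) r →
      rayHeight i u ∈ Icc (r - 1 / 2) (r + 1 / 2) := fun {r u} hu => by
    obtain ⟨a, ha, hproj⟩ := mem_projPreimage.1 hu
    rwa [(isProj_rayPoint i u).unique hW hα hproj]
  refine ⟨disjoint_curtain hW hα ?_, fun n c hc hm => ?_⟩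
  · rw [abs_sub_comm]
    exact lt_abs.2 (Or.inl (by linarith))
  have key : ∀ k, rayPoint p i (s + 1) ∈ c k := fun k => by
    obtain ⟨⟨u, hu, hus⟩, ⟨v, hv, hvt⟩⟩ := hm k
    exact rayPoint_mem_of_isCurtain hW (hc.1 k) (by linarith) hu (by linarith [(hmem hus).2]) hv
      (by linarith [(hmem hvt).1])
  by_contra! hn
  exact disjoint_left.1 (hc.2.1 ⟨0, by lia⟩ ⟨1, by lia⟩ (by simp)) (key _) (key _)

theorem rayHeight_sub_le_dL (hW : BruhatTits (AttachRays p)) (i : ι) {L : ℕ} (hL : 1 ≤ L)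
    {x y : AttachRays p} {B : ℝ} (hB : ChainBound L x y B) :
    (rayHeight i y - rayHeight i x) / 2 ≤ dL L x y :=
  hB.sub_div_le_dL hW (isGeodesicOn_rayPoint p i) one_lt_two (isProj_rayPoint i x)
    (isProj_rayPoint i y) fun _ _ hr hrr' =>
      (lSeparated_ray hW i ((rayHeight_nonneg i x).trans hr) hrr').mono hL

end RayCurtains
/-! ## Maps between spaces with rays attached -/

section Map

variable {X Y ι κ : Type*} {p : ι → X} {q : κ → Y} {f : X → Y} {σ : ι → κ} {K : NNReal}

/-- The map which is `f` on the base space and takes the `i`-th ray to the `σ i`-th ray. -/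
def map (p : ι → X) (q : κ → Y) (f : X → Y) (σ : ι → κ) : AttachRays p → AttachRays q
  | base x => base (f x)
  | ray i s hs => ray (σ i) s hs

theorem map_surjective (hf : Function.Surjective f) (hσ : Function.Surjective σ) :
    Function.Surjective (map p q f σ) := by
  rintro (y | ⟨j, s, hs⟩)
  · obtain ⟨x, rfl⟩ := hf y
    exact ⟨base x, rfl⟩
  · obtain ⟨i, rfl⟩ := hσ j
    exact ⟨ray i s hs, rfl⟩

theorem height_map (u : AttachRays p) : (map p q f σ u).height = u.height := by
  cases u <;> rfl

theorem foot_map (hp : ∀ i, f (p i) = q (σ i)) (u : AttachRays p) :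
    (map p q f σ u).foot = f u.foot := by
  rcases u with x | ⟨i⟩
  · rfl
  · exact (hp i).symm

theorem onSameRay_of_map (hσ : Function.Injective σ) {u v : AttachRays p}
    (h : OnSameRay (map p q f σ u) (map p q f σ v)) : OnSameRay u v := by
  obtain ⟨k, ⟨s, hs, hu⟩, ⟨t, ht, hv⟩⟩ := h
  rcases u with x | ⟨i, s', hs'⟩
  · cases hu
  rcases v with y | ⟨j, t', ht'⟩
  · cases hv
  have hij : i = j := hσ ((ray.inj hu).1.trans (ray.inj hv).1.symm)
  exact ⟨i, onRay_ray i s' hs', onRay_ray_iff.2 hij.symm⟩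

variable [MetricSpace Y]

theorem dist_map_of_not_onSameRay (hp : ∀ i, f (p i) = q (σ i)) (hσ : Function.Injective σ)
    {u v : AttachRays p} (h : ¬ OnSameRay u v) : dist (map p q f σ u) (map p q f σ v)
      = u.height + dist (f u.foot) (f v.foot) + v.height := by
  rw [dist_eq_of_not_onSameRay (mt (onSameRay_of_map hσ) h), height_map, height_map,
    foot_map hp, foot_map hp]

variable [MetricSpace X]

theorem dist_map_of_onSameRay {u v : AttachRays p} (h : OnSameRay u v) :
    dist (map p q f σ u) (map p q f σ v) = dist u v := by
  obtain ⟨i, ⟨s, hs, rfl⟩, ⟨t, ht, rfl⟩⟩ := h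
  simp only [map, dist_ray_same]

theorem lipschitzWith_map (hp : ∀ i, f (p i) = q (σ i)) (hσ : Function.Injective σ) (hK : 1 ≤ K)
    (hf : LipschitzWith K f) : LipschitzWith K (map p q f σ) := by
  have hscale : ∀ s : ℝ, 0 ≤ s → s ≤ K * s := fun s hs => le_mul_of_one_le_left hs hK
  refine LipschitzWith.of_dist_le_mul fun u v => ?_
  by_cases h : OnSameRay u v
  · rw [dist_map_of_onSameRay h]
    exact hscale _ dist_nonneg
  · rw [dist_map_of_not_onSameRay hp hσ h, dist_eq_of_not_onSameRay h, mul_add, mul_add]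
    gcongr
    exacts [hscale _ u.height_nonneg, hf.dist_le_mul _ _, hscale _ v.height_nonneg]

theorem antilipschitzWith_map (hp : ∀ i, f (p i) = q (σ i)) (hσ : Function.Injective σ)
    (hK : 1 ≤ K) (hf : AntilipschitzWith K f) : AntilipschitzWith K (map p q f σ) := by
  have hscale : ∀ s : ℝ, 0 ≤ s → s ≤ K * s := fun s hs => le_mul_of_one_le_left hs hK
  refine AntilipschitzWith.of_le_mul_dist fun u v => ?_
  by_cases h : OnSameRay u v
  · rw [dist_map_of_onSameRay h]
    exact hscale _ dist_nonneg
  · rw [dist_map_of_not_onSameRay hp hσ h, dist_eq_of_not_onSameRay h, mul_add, mul_add]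
    gcongr
    exacts [hscale _ u.height_nonneg, hf.le_mul_dist _ _, hscale _ v.height_nonneg]

end Map

end AttachRays

/-! ## The metric of the parking lot -/

theorem dist_exp_mul_I_mul (β : ℝ) (w w' : ℂ) :
    dist (Complex.exp (β * Complex.I) * w) (Complex.exp (β * Complex.I) * w') = dist w w' := by
  rw [dist_eq_norm, ← mul_sub, norm_mul, Complex.norm_exp_ofReal_mul_I, one_mul, dist_eq_norm]

theorem dist_ofReal_mul_ofReal_mul {v : ℂ} (hv : ‖v‖ = 1) (a b : ℝ) :
    dist (a * v) (b * v) = |a - b| := by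
  rw [dist_eq_norm, ← sub_mul, norm_mul, hv, mul_one, ← Complex.ofReal_sub, Complex.norm_real,
    Real.norm_eq_abs]

theorem dist_exp_mul_I_exp_mul_I_le (a b : ℝ) :
    dist (Complex.exp (a * Complex.I)) (Complex.exp (b * Complex.I)) ≤ |a - b| := by
  have hfactor : Complex.exp (a * Complex.I)
      = Complex.exp (b * Complex.I) * Complex.exp (Complex.I * ((a - b : ℝ) : ℂ)) := by
    rw [← Complex.exp_add]
    push_cast
    ring_nf
  rw [hfactor, ← mul_one (Complex.exp (b * Complex.I)), mul_assoc, dist_exp_mul_I_mul, one_mul,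
    dist_eq_norm]
  exact Real.norm_exp_I_mul_ofReal_sub_one_le

theorem two_mul_sin_half_eq (t : ℝ) : 2 * Real.sin (t / 2) = t * Real.sinc (t / 2) := by
  rcases eq_or_ne t 0 with rfl | ht
  · simp
  · rw [Real.sinc_of_ne_zero (by positivity)]
    field

theorem cos_eq_one_sub_two_mul_sin_sq_half (t : ℝ) :
    Real.cos t = 1 - 2 * Real.sin (t / 2) ^ 2 := by
  rw [Real.sin_sq_eq_half_sub, mul_div_cancel₀ _ two_ne_zero]
  ring

theorem eVariationOn_id_unitInterval_le_one :
    eVariationOn (id : unitInterval → unitInterval) univ ≤ 1 := by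
  have hmono : MonotoneOn (fun s : unitInterval => (s : ℝ)) univ := fun _ _ _ _ h => h
  have hvar := hmono.eVariationOn_eq (a := 0) (b := 1) (mem_univ _) (mem_univ _)
  have hIcc : (univ : Set unitInterval) ∩ Icc 0 1 = univ := by
    ext s
    simp [unitInterval.le_one']
  rw [hIcc] at hvar
  exact hvar.le.trans_eq (by simp)

theorem lengthDist_add_lengthDist_le {x y : Strip} (γ : Path x y) (τ : unitInterval) :
    lengthDist x (γ τ) + lengthDist (γ τ) y ≤ pathLength γ := by
  let γ₁ : Path x (γ τ) :=
    { toFun := fun s => γ (min s τ)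
      continuous_toFun := by fun_prop
      source' := by simp
      target' := by simp [unitInterval.le_one'] }
  let γ₂ : Path (γ τ) y :=
    { toFun := fun s => γ (max s τ)
      continuous_toFun := by fun_prop
      source' := by simp
      target' := by simp [unitInterval.le_one'] }
  have hsplit : pathLength γ = eVariationOn (fun s : unitInterval => cover (γ s)) (Iic τ)
      + eVariationOn (fun s : unitInterval => cover (γ s)) (Ici τ) := by
    rw [← eVariationOn.union _ (x := τ) isGreatest_Iic isLeast_Ici, Iic_union_Ici, pathLength]
  rw [hsplit]
  refine add_le_add ((iInf_le _ γ₁).trans ?_) ((iInf_le _ γ₂).trans ?_)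
  · exact eVariationOn.comp_le_of_monotoneOn (fun s : unitInterval => cover (γ s)) (min · τ)
      (fun _ _ _ _ h => min_le_min_right _ h) (fun s _ => min_le_right s τ)
  · exact eVariationOn.comp_le_of_monotoneOn (fun s : unitInterval => cover (γ s)) (max · τ)
      (fun _ _ _ _ h => max_le_max_right _ h) (fun s _ => le_max_right s τ)

namespace ParkingLot

/-- The image of a point under the covering map to the plane. -/
def toPlane (x : ParkingLot) : ℂ := cover x.toStrip

theorem toPlane_eq (x : ParkingLot) :
    x.toPlane = x.radius * Complex.exp (x.angle * Complex.I) := rfl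

theorem radius_pos (x : ParkingLot) : 0 < x.radius := zero_lt_one.trans_le x.one_le_radius

theorem norm_toPlane (x : ParkingLot) : ‖x.toPlane‖ = x.radius := by
  rw [toPlane_eq, norm_mul, Complex.norm_exp_ofReal_mul_I, mul_one, Complex.norm_real,
    Real.norm_of_nonneg x.radius_pos.le]

theorem ofReal_dist (x y : ParkingLot) :
    ENNReal.ofReal (dist x y) = lengthDist x.toStrip y.toStrip :=
  ENNReal.ofReal_toReal (lengthDist_ne_top _ _)

theorem dist_toPlane_le (x y : ParkingLot) : dist x.toPlane y.toPlane ≤ dist x y := by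
  rw [← ENNReal.ofReal_le_ofReal_iff dist_nonneg, ofReal_dist, ← edist_dist]
  refine le_iInf fun γ => ?_
  have hle := eVariationOn.edist_le (fun s : unitInterval => cover (γ s))
    (mem_univ (0 : unitInterval)) (mem_univ (1 : unitInterval))
  rwa [γ.source, γ.target] at hle

theorem abs_radius_sub_le (x y : ParkingLot) : |x.radius - y.radius| ≤ dist x y := by
  rw [← norm_toPlane, ← norm_toPlane]
  exact (abs_norm_sub_norm_le _ _).trans ((dist_eq_norm _ _).symm.trans_le (dist_toPlane_le x y))

theorem exists_crossing {F : ParkingLot → ℝ}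
    (hF : Continuous fun p : Strip => F ⟨p.1.1, p.1.2, p.2⟩) {x y : ParkingLot} (hx : F x ≤ 0)
    (hy : 0 ≤ F y) {ε : ℝ} (hε : 0 < ε) :
    ∃ z, F z = 0 ∧ dist x z + dist z y ≤ dist x y + ε := by
  have hlt : lengthDist x.toStrip y.toStrip < ENNReal.ofReal (dist x y + ε) := by
    rw [← ofReal_dist]
    exact (ENNReal.ofReal_lt_ofReal_iff (by positivity)).2 (by linarith)
  obtain ⟨γ, hγ⟩ := iInf_lt_iff.1 hlt
  let G (p : Strip) : ℝ := F ⟨p.1.1, p.1.2, p.2⟩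
  obtain ⟨τ, hτ⟩ := mem_range_of_exists_le_of_exists_ge (hF.comp γ.continuous)
    (c := 0) ⟨0, (congrArg G γ.source).trans_le hx⟩ ⟨1, hy.trans (congrArg G γ.target).ge⟩
  refine ⟨⟨(γ τ).1.1, (γ τ).1.2, (γ τ).2⟩, hτ, ?_⟩
  rw [← ENNReal.ofReal_le_ofReal_iff (by positivity), ENNReal.ofReal_add dist_nonneg dist_nonneg,
    ofReal_dist, ofReal_dist]
  exact (lengthDist_add_lengthDist_le γ τ).trans hγ.le

theorem exists_angle_eq {x y : ParkingLot} {θ : ℝ} (hx : x.angle ≤ θ) (hy : θ ≤ y.angle) {ε : ℝ}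
    (hε : 0 < ε) : ∃ z : ParkingLot, z.angle = θ ∧ dist x z + dist z y ≤ dist x y + ε := by
  obtain ⟨z, hz, hd⟩ := exists_crossing (F := fun z => z.angle - θ) (by fun_prop) (x := x) (y := y)
    (sub_nonpos.2 hx) (sub_nonneg.2 hy) hε
  exact ⟨z, sub_eq_zero.1 hz, hd⟩

theorem dist_le_of_path {x y : ParkingLot} (γ : Path x.toStrip y.toStrip) {C : ℝ} (hC : 0 ≤ C)
    (h : ∀ s s' : unitInterval, dist (cover (γ s)) (cover (γ s')) ≤ C * |(s : ℝ) - s'|) :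
    dist x y ≤ C := by
  have hL : LipschitzWith C.toNNReal (fun s : unitInterval => cover (γ s)) :=
    LipschitzWith.of_dist_le_mul fun s s' => by
      rw [Real.coe_toNNReal _ hC]
      exact h s s'
  rw [← ENNReal.ofReal_le_ofReal_iff hC, ofReal_dist]
  calc lengthDist x.toStrip y.toStrip ≤ pathLength γ := iInf_le _ γ
    _ ≤ C.toNNReal * eVariationOn (id : unitInterval → unitInterval) univ :=
        hL.lipschitzOnWith.comp_eVariationOn_le fun _ _ => mem_univ _
    _ ≤ C.toNNReal * 1 := by gcongr; exact eVariationOn_id_unitInterval_le_one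
    _ = ENNReal.ofReal C := mul_one _

theorem dist_le_of_radius_eq {x y : ParkingLot} (h : x.radius = y.radius) :
    dist x y ≤ x.radius * |x.angle - y.angle| := by
  let γ : Path x.toStrip y.toStrip :=
    { toFun := fun s => ⟨(x.angle + s * (y.angle - x.angle), x.radius), x.one_le_radius⟩
      continuous_toFun := by fun_prop
      source' := by simp [toStrip]
      target' := by simp [toStrip, h] }
  refine dist_le_of_path γ (mul_nonneg x.radius_pos.le (abs_nonneg _)) fun s s' => ?_
  calc dist (cover (γ s)) (cover (γ s'))
      = x.radius * dist (Complex.exp ((x.angle + s * (y.angle - x.angle) : ℝ) * Complex.I))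
          (Complex.exp ((x.angle + s' * (y.angle - x.angle) : ℝ) * Complex.I)) := by
        rw [← Real.norm_of_nonneg x.radius_pos.le, ← Complex.norm_real, dist_eq_norm, dist_eq_norm,
          ← norm_mul, mul_sub]
        rfl
    _ ≤ x.radius * |(x.angle + s * (y.angle - x.angle)) - (x.angle + s' * (y.angle - x.angle))| :=
        mul_le_mul_of_nonneg_left (dist_exp_mul_I_exp_mul_I_le _ _) x.radius_pos.le
    _ = x.radius * |x.angle - y.angle| * |(s : ℝ) - s'| := by
        rw [add_sub_add_left_eq_sub, ← sub_mul, abs_mul, abs_sub_comm y.angle]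
        ring

/-- The parametrization, by the half-plane `1 ≤ re w`, of the part of the parking lot beyond the
tangent line to the unit circle at the angle `β`. -/
def ofHalfPlane (β : ℝ) (w : ℂ) (hw : 1 ≤ w.re) : ParkingLot :=
  ⟨β + w.arg, ‖w‖, hw.trans (Complex.re_le_norm w)⟩

theorem toPlane_ofHalfPlane (β : ℝ) (w : ℂ) (hw : 1 ≤ w.re) :
    (ofHalfPlane β w hw).toPlane = Complex.exp (β * Complex.I) * w := by
  rw [toPlane_eq]
  conv_rhs => rw [← Complex.norm_mul_exp_arg_mul_I w]
  simp only [ofHalfPlane]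
  push_cast
  rw [add_mul, Complex.exp_add]
  ring

theorem one_le_re_lineMap {w w' : ℂ} (hw : 1 ≤ w.re) (hw' : 1 ≤ w'.re) {s : ℝ}
    (hs : s ∈ Icc (0 : ℝ) 1) : 1 ≤ (AffineMap.lineMap w w' s : ℂ).re :=
  (convex_halfSpace_re_ge 1).lineMap_mem hw hw' hs

theorem dist_ofHalfPlane (β : ℝ) (w w' : ℂ) (hw : 1 ≤ w.re) (hw' : 1 ≤ w'.re) :
    dist (ofHalfPlane β w hw) (ofHalfPlane β w' hw') = dist w w' := by
  apply le_antisymm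
  · have hre (s : unitInterval) := one_le_re_lineMap hw hw' s.2
    have hc : Continuous fun s : unitInterval => (AffineMap.lineMap w w' (s : ℝ) : ℂ) := by
      simp only [AffineMap.lineMap_apply_module]
      fun_prop
    let γ : Path (ofHalfPlane β w hw).toStrip (ofHalfPlane β w' hw').toStrip :=
      { toFun := fun s => (ofHalfPlane β (AffineMap.lineMap w w' (s : ℝ)) (hre s)).toStrip
        continuous_toFun := by
          refine Continuous.subtype_mk (Continuous.prodMk ?_ hc.norm) _
          refine continuous_const.add (continuous_iff_continuousAt.2 fun s => ?_)
          exact (Complex.continuousAt_arg (Or.inl (by linarith [hre s]))).comp hc.continuousAt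
        source' := by simp
        target' := by simp }
    refine dist_le_of_path γ dist_nonneg fun s s' => ?_
    have hγ (s) : cover (γ s) = Complex.exp (β * Complex.I) * AffineMap.lineMap w w' (s : ℝ) :=
      toPlane_ofHalfPlane β _ (hre s)
    rw [hγ, hγ, dist_exp_mul_I_mul, dist_lineMap_lineMap, mul_comm, Real.dist_eq]
  · rw [← dist_exp_mul_I_mul β, ← toPlane_ofHalfPlane β w hw, ← toPlane_ofHalfPlane β w' hw']
    exact dist_toPlane_le _ _

/-- The length of the tangent segments from `x` to the unit circle. -/
def tangentLength (x : ParkingLot) : ℝ := √(x.radius ^ 2 - 1)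

/-- Half the angle under which the tangent points from `x` to the unit circle are seen from the
centre. -/
def tangentAngle (x : ParkingLot) : ℝ := Real.arctan x.tangentLength

theorem tangentLength_nonneg (x : ParkingLot) : 0 ≤ x.tangentLength := Real.sqrt_nonneg _

theorem sq_tangentLength (x : ParkingLot) : x.tangentLength ^ 2 = x.radius ^ 2 - 1 :=
  Real.sq_sqrt (by nlinarith [x.one_le_radius])

theorem sqrt_one_add_sq_tangentLength (x : ParkingLot) :
    √(1 + x.tangentLength ^ 2) = x.radius := by
  rw [sq_tangentLength, add_sub_cancel, Real.sqrt_sq x.radius_pos.le]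

theorem tangentAngle_nonneg (x : ParkingLot) : 0 ≤ x.tangentAngle :=
  Real.arctan_nonneg.2 x.tangentLength_nonneg

theorem tangentAngle_lt (x : ParkingLot) : x.tangentAngle < Real.pi / 2 :=
  Real.arctan_lt_pi_div_two _

theorem radius_mul_cos_tangentAngle (x : ParkingLot) : x.radius * Real.cos x.tangentAngle = 1 := by
  rw [tangentAngle, Real.cos_arctan, sqrt_one_add_sq_tangentLength,
    mul_one_div_cancel x.radius_pos.ne']

theorem one_le_radius_mul_cos {x : ParkingLot} {β : ℝ} (h : |x.angle - β| ≤ x.tangentAngle) :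
    1 ≤ x.radius * Real.cos (x.angle - β) := by
  rw [← x.radius_mul_cos_tangentAngle, ← Real.cos_abs (x.angle - β)]
  exact mul_le_mul_of_nonneg_left (Real.cos_le_cos_of_nonneg_of_le_pi (abs_nonneg _)
    (by linarith [x.tangentAngle_lt, Real.pi_pos]) h) x.radius_pos.le

theorem exists_eq_ofHalfPlane {x : ParkingLot} {β : ℝ} (h : |x.angle - β| ≤ x.tangentAngle) :
    ∃ w hw, x = ofHalfPlane β w hw := by
  obtain ⟨h₁, h₂⟩ := abs_le.1 h
  have hlt := x.tangentAngle_lt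
  refine ⟨x.radius * Complex.exp ((x.angle - β : ℝ) * Complex.I), ?_, ?_⟩
  · rw [Complex.re_ofReal_mul, Complex.exp_ofReal_mul_I_re]
    exact one_le_radius_mul_cos h
  · ext
    · simp only [ofHalfPlane]
      rw [Complex.exp_mul_I, Complex.arg_mul_cos_add_sin_mul_I x.radius_pos
        ⟨by linarith [Real.pi_pos], by linarith [Real.pi_pos]⟩]
      ring
    · simp only [ofHalfPlane]
      rw [norm_mul, Complex.norm_exp_ofReal_mul_I, mul_one, Complex.norm_real,
        Real.norm_of_nonneg x.radius_pos.le]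

theorem angle_ofHalfPlane (β : ℝ) (w : ℂ) (hw : 1 ≤ w.re) :
    (ofHalfPlane β w hw).angle = β + Real.arctan (w.im / w.re) := by
  have harg := abs_lt.1 (Complex.abs_arg_lt_pi_div_two_iff.2 (Or.inl (zero_lt_one.trans_le hw)))
  rw [← Complex.tan_arg, Real.arctan_tan harg.1 harg.2, ofHalfPlane]

theorem abs_angle_sub_le_tangentAngle_ofHalfPlane (β : ℝ) (w : ℂ) (hw : 1 ≤ w.re) :
    |(ofHalfPlane β w hw).angle - β| ≤ (ofHalfPlane β w hw).tangentAngle := by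
  have hre : 0 < w.re := zero_lt_one.trans_le hw
  have hslope : |w.im / w.re| ≤ (ofHalfPlane β w hw).tangentLength := by
    apply Real.abs_le_sqrt
    rw [div_pow, div_le_iff₀ (pow_pos hre 2)]
    simp only [ofHalfPlane]
    rw [Complex.sq_norm, Complex.normSq_apply]
    have hsq : 0 ≤ w.re ^ 2 - 1 := by nlinarith
    nlinarith [mul_nonneg hsq (sq_nonneg w.re), mul_nonneg hsq (sq_nonneg w.im)]
  obtain ⟨h₁, h₂⟩ := abs_le.1 hslope
  rw [angle_ofHalfPlane, add_sub_cancel_left, tangentAngle, abs_le, ← Real.arctan_neg]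
  exact ⟨Real.arctan_mono h₁, Real.arctan_mono h₂⟩

theorem dist_eq_of_halfPlane {x y : ParkingLot} {β : ℝ} (hx : |x.angle - β| ≤ x.tangentAngle)
    (hy : |y.angle - β| ≤ y.tangentAngle) : dist x y = dist x.toPlane y.toPlane := by
  obtain ⟨w, hw, rfl⟩ := exists_eq_ofHalfPlane hx
  obtain ⟨w', hw', rfl⟩ := exists_eq_ofHalfPlane hy
  rw [dist_ofHalfPlane, toPlane_ofHalfPlane, toPlane_ofHalfPlane, dist_exp_mul_I_mul]

theorem exists_halfPlane {x y : ParkingLot}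
    (h : |y.angle - x.angle| ≤ x.tangentAngle + y.tangentAngle) :
    ∃ β, |x.angle - β| ≤ x.tangentAngle ∧ |y.angle - β| ≤ y.tangentAngle := by
  have hx := x.tangentAngle_nonneg
  have hy := y.tangentAngle_nonneg
  obtain ⟨h₁, h₂⟩ := abs_le.1 h
  refine ⟨max (x.angle - x.tangentAngle) (y.angle - y.tangentAngle), ?_, ?_⟩ <;> rw [abs_le] <;>
    constructor <;> grind

theorem dist_eq_of_visible {x y : ParkingLot}
    (h : |y.angle - x.angle| ≤ x.tangentAngle + y.tangentAngle) :
    dist x y = dist x.toPlane y.toPlane := by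
  obtain ⟨β, hx, hy⟩ := exists_halfPlane h
  exact dist_eq_of_halfPlane hx hy

theorem dist_eq_of_angle_eq {x y : ParkingLot} (h : x.angle = y.angle) :
    dist x y = |x.radius - y.radius| := by
  have hvis : |y.angle - x.angle| ≤ x.tangentAngle + y.tangentAngle := by
    rw [h, sub_self, abs_zero]
    exact add_nonneg x.tangentAngle_nonneg y.tangentAngle_nonneg
  rw [dist_eq_of_visible hvis, toPlane_eq, toPlane_eq, h,
    dist_ofReal_mul_ofReal_mul (Complex.norm_exp_ofReal_mul_I _)]

theorem sq_dist_toPlane (x y : ParkingLot) : dist x.toPlane y.toPlane ^ 2 =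
    (x.radius - y.radius) ^ 2
      + 4 * x.radius * y.radius * Real.sin ((x.angle - y.angle) / 2) ^ 2 := by
  rw [dist_eq_norm, Complex.sq_norm, Complex.normSq_apply, toPlane_eq, toPlane_eq]
  simp only [Complex.sub_re, Complex.sub_im, Complex.re_ofReal_mul, Complex.im_ofReal_mul,
    Complex.exp_ofReal_mul_I_re, Complex.exp_ofReal_mul_I_im]
  have hcos := cos_eq_one_sub_two_mul_sin_sq_half (x.angle - y.angle)
  rw [Real.cos_sub] at hcos
  linear_combination x.radius ^ 2 * Real.sin_sq_add_cos_sq x.angle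
    + y.radius ^ 2 * Real.sin_sq_add_cos_sq y.angle - 2 * x.radius * y.radius * hcos

theorem two_mul_sin_le_dist (x y : ParkingLot) :
    2 * Real.sin ((x.angle - y.angle) / 2) ≤ dist x y := by
  refine le_trans ?_ (dist_toPlane_le x y)
  apply le_of_sq_le_sq _ dist_nonneg
  rw [sq_dist_toPlane, mul_pow]
  have hmul : 1 ≤ x.radius * y.radius :=
    one_le_mul_of_one_le_of_one_le x.one_le_radius y.one_le_radius
  nlinarith [sq_nonneg (x.radius - y.radius), sq_nonneg (Real.sin ((x.angle - y.angle) / 2))]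

/-- A nearly shortest path may be cut into `2 ^ n` pieces of equal angle; the distance between the
ends of a piece is at least the chord of the unit circle with the same angle. -/
theorem mul_sinc_le_dist (n : ℕ) {x y : ParkingLot} (h : x.angle ≤ y.angle) :
    (y.angle - x.angle) * Real.sinc ((y.angle - x.angle) / 2 ^ (n + 1)) ≤ dist x y := by
  induction n generalizing x y with
  | zero =>
    rw [zero_add, pow_one, ← two_mul_sin_half_eq, dist_comm]
    exact two_mul_sin_le_dist y x
  | succ n ih =>
    refine le_of_forall_pos_le_add fun ε hε => ?_
    obtain ⟨z, hz, hd⟩ := exists_angle_eq (x := x) (y := y) (θ := (x.angle + y.angle) / 2)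
      (by linarith) (by linarith) hε
    have hxz := ih (x := x) (y := z) (by linarith)
    have hzy := ih (x := z) (y := y) (by linarith)
    have hx : z.angle - x.angle = (y.angle - x.angle) / 2 := by linarith
    have hy : y.angle - z.angle = (y.angle - x.angle) / 2 := by linarith
    rw [hx, div_div, ← pow_succ'] at hxz
    rw [hy, div_div, ← pow_succ'] at hzy
    linarith

theorem abs_angle_sub_le (x y : ParkingLot) : |x.angle - y.angle| ≤ dist x y := by
  wlog h : x.angle ≤ y.angle generalizing x y
  · rw [abs_sub_comm, dist_comm]
    exact this y x (le_of_not_ge h)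
  rw [abs_sub_comm, abs_of_nonneg (sub_nonneg.2 h)]
  have hzero : Filter.Tendsto (fun n : ℕ => (y.angle - x.angle) / 2 ^ (n + 1)) Filter.atTop
      (nhds 0) :=
    tendsto_const_nhds.div_atTop
      ((tendsto_pow_atTop_atTop_of_one_lt one_lt_two).comp (Filter.tendsto_add_atTop_nat 1))
  have hlim := ((Real.continuous_sinc.tendsto 0).comp hzero).const_mul (y.angle - x.angle)
  rw [Real.sinc_zero, mul_one] at hlim
  exact le_of_tendsto hlim (.of_forall fun n => mul_sinc_le_dist n h)

/-- The point of the unit circle with angle `T`. -/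
def circlePoint (T : ℝ) : ParkingLot := ⟨T, 1, le_rfl⟩

@[simp]
theorem angle_circlePoint (T : ℝ) : (circlePoint T).angle = T := rfl

@[simp]
theorem tangentLength_circlePoint (T : ℝ) : (circlePoint T).tangentLength = 0 := by
  simp [tangentLength, circlePoint]

@[simp]
theorem tangentAngle_circlePoint (T : ℝ) : (circlePoint T).tangentAngle = 0 := by
  simp [tangentAngle]

theorem dist_circlePoint (S T : ℝ) : dist (circlePoint S) (circlePoint T) = |S - T| := by
  refine le_antisymm ?_ (abs_angle_sub_le (circlePoint S) (circlePoint T))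
  simpa [circlePoint] using dist_le_of_radius_eq (x := circlePoint S) (y := circlePoint T) rfl

/-- The point at signed distance `e` from the tangent point on the line which is tangent to the
unit circle at the angle `T`. -/
def tangentLine (T e : ℝ) : ParkingLot := ofHalfPlane T (1 + e * Complex.I) (by simp)

theorem dist_tangentLine (T e e' : ℝ) : dist (tangentLine T e) (tangentLine T e') = |e - e'| := by
  rw [tangentLine, tangentLine, dist_ofHalfPlane, dist_add_left,
    dist_ofReal_mul_ofReal_mul Complex.norm_I]

theorem toPlane_tangentLine (T e : ℝ) :
    (tangentLine T e).toPlane = Complex.exp (T * Complex.I) * (1 + e * Complex.I) :=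
  toPlane_ofHalfPlane _ _ _

theorem angle_tangentLine (T e : ℝ) : (tangentLine T e).angle = T + Real.arctan e := by
  simp [tangentLine, angle_ofHalfPlane]

theorem radius_tangentLine (T e : ℝ) : (tangentLine T e).radius = √(1 + e ^ 2) := by
  simp [tangentLine, ofHalfPlane, Complex.norm_def, Complex.normSq_apply, sq]

theorem tangentLength_tangentLine (T e : ℝ) : (tangentLine T e).tangentLength = |e| := by
  rw [tangentLength, radius_tangentLine, Real.sq_sqrt (by positivity), add_sub_cancel_left,
    Real.sqrt_sq_eq_abs]

theorem tangentAngle_tangentLine (T e : ℝ) : (tangentLine T e).tangentAngle = Real.arctan |e| := by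
  rw [tangentAngle, tangentLength_tangentLine]

theorem tangentLine_zero (T : ℝ) : tangentLine T 0 = circlePoint T := by
  ext
  · rw [angle_tangentLine, Real.arctan_zero, add_zero, angle_circlePoint]
  · simp [radius_tangentLine, circlePoint]

theorem tangentLine_neg_tangentLength (x : ParkingLot) :
    tangentLine (x.angle + x.tangentAngle) (-x.tangentLength) = x := by
  ext
  · rw [angle_tangentLine, Real.arctan_neg, tangentAngle, add_neg_cancel_right]
  · rw [radius_tangentLine, neg_sq, sqrt_one_add_sq_tangentLength]

theorem tangentLine_tangentLength (x : ParkingLot) :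
    tangentLine (x.angle - x.tangentAngle) x.tangentLength = x := by
  ext
  · rw [angle_tangentLine, tangentAngle, sub_add_cancel]
  · rw [radius_tangentLine, sqrt_one_add_sq_tangentLength]

theorem dist_circlePoint_add_tangentAngle (x : ParkingLot) :
    dist x (circlePoint (x.angle + x.tangentAngle)) = x.tangentLength := by
  have h := dist_tangentLine (x.angle + x.tangentAngle) (-x.tangentLength) 0
  rwa [tangentLine_neg_tangentLength, tangentLine_zero, sub_zero, abs_neg,
    abs_of_nonneg x.tangentLength_nonneg] at h

theorem dist_circlePoint_sub_tangentAngle (x : ParkingLot) :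
    dist x (circlePoint (x.angle - x.tangentAngle)) = x.tangentLength := by
  have h := dist_tangentLine (x.angle - x.tangentAngle) x.tangentLength 0
  rwa [tangentLine_tangentLength, tangentLine_zero, sub_zero,
    abs_of_nonneg x.tangentLength_nonneg] at h

theorem tangentLength_le_dist {x z : ParkingLot} (h : |z.angle - x.angle| = x.tangentAngle) :
    x.tangentLength ≤ dist x z := by
  refine le_trans ?_ (dist_toPlane_le x z)
  apply le_of_sq_le_sq _ dist_nonneg
  rw [sq_dist_toPlane, sq_tangentLength]
  have hcos : x.radius * Real.cos (x.angle - z.angle) = 1 := by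
    rw [← Real.cos_abs, abs_sub_comm, h, radius_mul_cos_tangentAngle]
  rw [cos_eq_one_sub_two_mul_sin_sq_half] at hcos
  linear_combination sq_nonneg (z.radius - 1) + 2 * z.radius * hcos

/-- A path from `x` to `y` crosses the radial rays through the tangent points, at distance at least
the tangent lengths from its ends, and in between the angle bounds its length from below. -/
theorem tangentLength_add_le_dist {x y : ParkingLot}
    (h : x.tangentAngle + y.tangentAngle ≤ y.angle - x.angle) :
    x.tangentLength + y.tangentLength + (y.angle - x.angle - x.tangentAngle - y.tangentAngle)
      ≤ dist x y := by
  have hx := x.tangentAngle_nonneg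
  have hy := y.tangentAngle_nonneg
  refine le_of_forall_pos_le_add fun ε hε => ?_
  obtain ⟨z, hz, hxzy⟩ := exists_angle_eq (x := x) (y := y) (θ := x.angle + x.tangentAngle)
    (by linarith) (by linarith) (half_pos hε)
  obtain ⟨w, hw, hzwy⟩ := exists_angle_eq (x := z) (y := y) (θ := y.angle - y.tangentAngle)
    (by linarith) (by linarith) (half_pos hε)
  have hxz : x.tangentLength ≤ dist x z :=
    tangentLength_le_dist (by rw [hz, add_sub_cancel_left, abs_of_nonneg hx])
  have hwy : y.tangentLength ≤ dist w y := dist_comm w y ▸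
    tangentLength_le_dist (by rw [hw, sub_sub_cancel_left, abs_neg, abs_of_nonneg hy])
  have hzw := (le_abs_self _).trans (abs_angle_sub_le w z)
  rw [dist_comm w] at hzw
  linarith

theorem dist_eq_of_shadow {x y : ParkingLot}
    (h : x.tangentAngle + y.tangentAngle ≤ y.angle - x.angle) :
    dist x y = x.tangentLength + y.tangentLength
      + (y.angle - x.angle - x.tangentAngle - y.tangentAngle) := by
  refine le_antisymm ?_ (tangentLength_add_le_dist h)
  have htri := dist_triangle4 x (circlePoint (x.angle + x.tangentAngle))
    (circlePoint (y.angle - y.tangentAngle)) y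
  rw [dist_circlePoint_add_tangentAngle, dist_circlePoint, dist_comm (circlePoint _) y,
    dist_circlePoint_sub_tangentAngle, abs_sub_comm, abs_of_nonneg (by linarith)] at htri
  linarith

theorem dist_add_circlePoint {x y : ParkingLot} {T : ℝ} (hx : x.angle + Real.pi / 2 ≤ T)
    (hy : T + Real.pi / 2 ≤ y.angle) :
    dist x (circlePoint T) + dist (circlePoint T) y = dist x y := by
  have hxlt := x.tangentAngle_lt
  have hylt := y.tangentAngle_lt
  rw [dist_eq_of_shadow (y := y) (x := x) (by linarith),
    dist_eq_of_shadow (x := x) (y := circlePoint T)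
      (by rw [angle_circlePoint, tangentAngle_circlePoint]; linarith),
    dist_eq_of_shadow (x := circlePoint T) (y := y)
      (by rw [angle_circlePoint, tangentAngle_circlePoint]; linarith),
    angle_circlePoint, tangentAngle_circlePoint, tangentLength_circlePoint]
  ring

end ParkingLot

/-! ## The parking lot is a CAT(0) space -/

namespace ParkingLot

/-- The logarithm map at `z`: the tangent vector at `z` of length `dist z y` pointing to `y`,
in the frame where the radial direction is real. -/
def logMap (z y : ParkingLot) : ℂ :=
  if |y.angle - z.angle| ≤ z.tangentAngle + y.tangentAngle then
    Complex.exp ((-z.angle : ℝ) * Complex.I) * (y.toPlane - z.toPlane)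
  else if z.angle < y.angle then
    (dist z y : ℝ) * (Complex.I * Complex.exp (z.tangentAngle * Complex.I))
  else (-dist z y : ℝ) * (Complex.I * Complex.exp ((-z.tangentAngle : ℝ) * Complex.I))

theorem norm_I_mul_exp (t : ℝ) : ‖Complex.I * Complex.exp (t * Complex.I)‖ = 1 := by
  rw [norm_mul, Complex.norm_I, one_mul, Complex.norm_exp_ofReal_mul_I]

theorem logMap_of_visible {z y : ParkingLot}
    (h : |y.angle - z.angle| ≤ z.tangentAngle + y.tangentAngle) :
    logMap z y = Complex.exp ((-z.angle : ℝ) * Complex.I) * (y.toPlane - z.toPlane) := if_pos h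

theorem visible_of_halfPlane {x y : ParkingLot} {β : ℝ} (hx : |x.angle - β| ≤ x.tangentAngle)
    (hy : |y.angle - β| ≤ y.tangentAngle) :
    |y.angle - x.angle| ≤ x.tangentAngle + y.tangentAngle := by
  rw [abs_sub_comm] at hx
  linarith [abs_sub_le y.angle β x.angle]

theorem logMap_tangentLine (T e e' : ℝ) : logMap (tangentLine T e) (tangentLine T e') =
    (e' - e : ℝ) * (Complex.I * Complex.exp ((-Real.arctan e : ℝ) * Complex.I)) := by
  have hT (e : ℝ) : |(tangentLine T e).angle - T| ≤ (tangentLine T e).tangentAngle :=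
    abs_angle_sub_le_tangentAngle_ofHalfPlane T (1 + e * Complex.I) (by simp)
  have hexp : Complex.exp ((-(T + Real.arctan e) : ℝ) * Complex.I) * Complex.exp (T * Complex.I)
      = Complex.exp ((-Real.arctan e : ℝ) * Complex.I) := by
    rw [← Complex.exp_add]
    push_cast
    ring_nf
  rw [logMap_of_visible (visible_of_halfPlane (hT e) (hT e')), toPlane_tangentLine,
    toPlane_tangentLine, ← mul_sub, ← mul_assoc, angle_tangentLine, hexp]
  push_cast
  ring

theorem logMap_of_ahead {z y : ParkingLot}
    (h : z.tangentAngle + y.tangentAngle ≤ y.angle - z.angle) :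
    logMap z y = (dist z y : ℝ) * (Complex.I * Complex.exp (z.tangentAngle * Complex.I)) := by
  have hz := z.tangentAngle_nonneg
  have hy := y.tangentAngle_nonneg
  rcases h.eq_or_lt with h' | h'
  · have hT : z.angle + z.tangentAngle = y.angle - y.tangentAngle := by linarith
    have hlog := logMap_tangentLine (z.angle + z.tangentAngle) (-z.tangentLength) y.tangentLength
    rw [tangentLine_neg_tangentLength, hT, tangentLine_tangentLength, Real.arctan_neg, neg_neg,
      ← tangentAngle] at hlog
    rw [hlog, dist_eq_of_shadow h, ← h']
    ring_nf
  · rw [logMap, if_neg (by rw [abs_of_nonneg] <;> linarith), if_pos (by linarith)]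

theorem logMap_of_behind {z y : ParkingLot}
    (h : z.tangentAngle + y.tangentAngle ≤ z.angle - y.angle) : logMap z y =
      (-dist z y : ℝ) * (Complex.I * Complex.exp ((-z.tangentAngle : ℝ) * Complex.I)) := by
  have hz := z.tangentAngle_nonneg
  have hy := y.tangentAngle_nonneg
  rcases h.eq_or_lt with h' | h'
  · have hT : z.angle - z.tangentAngle = y.angle + y.tangentAngle := by linarith
    have hlog := logMap_tangentLine (z.angle - z.tangentAngle) z.tangentLength (-y.tangentLength)
    rw [tangentLine_tangentLength, hT, tangentLine_neg_tangentLength, ← tangentAngle] at hlog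
    rw [hlog, dist_comm z, dist_eq_of_shadow (x := y) (y := z) (by linarith), ← h']
    ring_nf
  · rw [logMap, if_neg (by rw [abs_of_nonpos] <;> linarith), if_neg (by linarith)]

theorem norm_logMap (z y : ParkingLot) : ‖logMap z y‖ = dist z y := by
  unfold logMap
  split_ifs with hvis
  · rw [norm_mul, Complex.norm_exp_ofReal_mul_I, one_mul, ← dist_eq_norm, dist_comm,
      dist_eq_of_visible hvis]
  · rw [norm_mul, norm_I_mul_exp, mul_one, Complex.norm_real, Real.norm_of_nonneg dist_nonneg]
  · rw [norm_mul, norm_I_mul_exp, mul_one, Complex.norm_real, norm_neg,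
      Real.norm_of_nonneg dist_nonneg]

theorem dist_logMap_of_visible {z u v : ParkingLot}
    (hu : |u.angle - z.angle| ≤ z.tangentAngle + u.tangentAngle)
    (hv : |v.angle - z.angle| ≤ z.tangentAngle + v.tangentAngle) :
    dist (logMap z u) (logMap z v) = dist u.toPlane v.toPlane := by
  rw [logMap_of_visible hu, logMap_of_visible hv, dist_exp_mul_I_mul, dist_sub_right]

theorem lipschitzOnWith_union {E : Type*} [PseudoMetricSpace E] {f : ParkingLot → E} {K : NNReal}
    {F : ParkingLot → ℝ} (hF : Continuous fun p : Strip => F ⟨p.1.1, p.1.2, p.2⟩)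
    {A B : Set ParkingLot} (hA : LipschitzOnWith K f A) (hB : LipschitzOnWith K f B)
    (hFA : ∀ x ∈ A, F x ≤ 0) (hFB : ∀ x ∈ B, 0 ≤ F x) (hAB : ∀ x, F x = 0 → x ∈ A ∩ B) :
    LipschitzOnWith K f (A ∪ B) := by
  have hcross {x y} (hx : x ∈ A) (hy : y ∈ B) : dist (f x) (f y) ≤ K * dist x y := by
    refine le_of_forall_pos_le_add fun ε hε => ?_
    have hK : K * (ε / (K + 1)) ≤ ε := by
      rw [mul_div_assoc', div_le_iff₀ (by positivity)]
      linarith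
    obtain ⟨z, hz, hd⟩ :=
      exists_crossing hF (hFA x hx) (hFB y hy) (ε := ε / (K + 1)) (by positivity)
    calc dist (f x) (f y) ≤ dist (f x) (f z) + dist (f z) (f y) := dist_triangle _ _ _
      _ ≤ K * dist x z + K * dist z y :=
          add_le_add (hA.dist_le_mul x hx z (hAB z hz).1) (hB.dist_le_mul z (hAB z hz).2 y hy)
      _ ≤ K * (dist x y + ε / (K + 1)) := by rw [← mul_add]; gcongr
      _ ≤ K * dist x y + ε := by linarith
  refine LipschitzOnWith.of_dist_le_mul fun x hx y hy => ?_
  rcases hx with hx | hx <;> rcases hy with hy | hy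
  · exact hA.dist_le_mul x hx y hy
  · exact hcross hx hy
  · rw [dist_comm, dist_comm x]
    exact hcross hy hx
  · exact hB.dist_le_mul x hx y hy

theorem lipschitzOnWith_logMap_of_eq_dist_mul {z : ParkingLot} {s : Set ParkingLot} {v : ℂ}
    (hv : ‖v‖ = 1) (h : ∀ y ∈ s, logMap z y = (dist z y : ℝ) * v) :
    LipschitzOnWith 1 (logMap z) s := by
  refine LipschitzOnWith.of_dist_le_mul fun x hx y hy => ?_
  rw [h x hx, h y hy, dist_ofReal_mul_ofReal_mul hv, dist_comm z, dist_comm z, NNReal.coe_one,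
    one_mul]
  exact abs_dist_sub_le x y z

/-- The points visible from `z`, those ahead and those behind are separated from one another by the
tangent lines through `z`, and the logarithm map is non-expanding on each of the three sets. -/
theorem lipschitzWith_logMap (z : ParkingLot) : LipschitzWith 1 (logMap z) := by
  have hz := z.tangentAngle_nonneg
  have hvis : LipschitzOnWith 1 (logMap z)
      {y | |y.angle - z.angle| ≤ z.tangentAngle + y.tangentAngle} :=
    LipschitzOnWith.of_dist_le_mul fun u hu v hv => by
      rw [dist_logMap_of_visible hu hv, NNReal.coe_one, one_mul]
      exact dist_toPlane_le u v
  have hahead : LipschitzOnWith 1 (logMap z)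
      {y | z.tangentAngle + y.tangentAngle ≤ y.angle - z.angle} :=
    lipschitzOnWith_logMap_of_eq_dist_mul (norm_I_mul_exp _) fun _ => logMap_of_ahead
  have hbehind : LipschitzOnWith 1 (logMap z)
      {y | z.tangentAngle + y.tangentAngle ≤ z.angle - y.angle} :=
    lipschitzOnWith_logMap_of_eq_dist_mul ((norm_neg _).trans (norm_I_mul_exp (-z.tangentAngle)))
      fun y hy => by rw [logMap_of_behind hy, Complex.ofReal_neg, neg_mul, mul_neg]
  have hright := lipschitzOnWith_union
    (F := fun x => x.angle - z.angle - z.tangentAngle - x.tangentAngle)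
    (by unfold tangentAngle tangentLength; fun_prop) hvis hahead
    (fun x (hx : |x.angle - z.angle| ≤ z.tangentAngle + x.tangentAngle) => by
      linarith [(abs_le.1 hx).2])
    (fun x (hx : z.tangentAngle + x.tangentAngle ≤ x.angle - z.angle) => by linarith)
    (fun x hx => ⟨(abs_le.2 ⟨by linarith [x.tangentAngle_nonneg], by linarith⟩ :
        |x.angle - z.angle| ≤ z.tangentAngle + x.tangentAngle),
      (by linarith : z.tangentAngle + x.tangentAngle ≤ x.angle - z.angle)⟩)
  have hall := lipschitzOnWith_union
    (F := fun x => z.angle - x.angle - z.tangentAngle - x.tangentAngle)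
    (by unfold tangentAngle tangentLength; fun_prop) hright hbehind
    (fun x (hx : |x.angle - z.angle| ≤ z.tangentAngle + x.tangentAngle ∨
        z.tangentAngle + x.tangentAngle ≤ x.angle - z.angle) => by
      rcases hx with hx | hx <;> grind [x.tangentAngle_nonneg])
    (fun x (hx : z.tangentAngle + x.tangentAngle ≤ z.angle - x.angle) => by linarith)
    (fun x hx => ⟨Or.inl (abs_le.2 ⟨by linarith, by linarith [x.tangentAngle_nonneg]⟩ :
        |x.angle - z.angle| ≤ z.tangentAngle + x.tangentAngle),
      (by linarith : z.tangentAngle + x.tangentAngle ≤ z.angle - x.angle)⟩)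
  refine lipschitzOnWith_univ.1 (hall.mono fun x _ => ?_)
  rcases le_total |x.angle - z.angle| (z.tangentAngle + x.tangentAngle) with h | h
  · exact Or.inl (Or.inl h)
  · rcases le_abs.1 h with h | h
    · exact Or.inl (Or.inr h)
    · exact Or.inr (h.trans_eq (neg_sub _ _))

theorem isLogMap_logMap_of_opposite {x z y : ParkingLot} {v : ℂ} (hv : ‖v‖ = 1)
    (hx : logMap z x = (-dist z x : ℝ) * v) (hy : logMap z y = (dist z y : ℝ) * v)
    (h : dist x z + dist z y = dist x y) : IsLogMap (logMap z) x z y := by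
  refine ⟨fun u v => by simpa using (lipschitzWith_logMap z).dist_le_mul u v, norm_logMap z, ?_⟩
  rw [hx, hy, dist_ofReal_mul_ofReal_mul hv, ← h, dist_comm x z, abs_sub_comm, sub_neg_eq_add,
    add_comm, abs_of_nonneg (by positivity)]

theorem exists_isLogMap_of_visible {x y : ParkingLot}
    (h : |y.angle - x.angle| ≤ x.tangentAngle + y.tangentAngle) {s : ℝ} (hs : s ∈ Icc (0 : ℝ) 1) :
    ∃ z, dist x z = s * dist x y ∧ dist z y = (1 - s) * dist x y ∧
      IsLogMap (logMap z) x z y := by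
  obtain ⟨β, hx, hy⟩ := exists_halfPlane h
  obtain ⟨w, hw, rfl⟩ := exists_eq_ofHalfPlane hx
  obtain ⟨w', hw', rfl⟩ := exists_eq_ofHalfPlane hy
  have hz := abs_angle_sub_le_tangentAngle_ofHalfPlane β _ (one_le_re_lineMap hw hw' hs)
  refine ⟨ofHalfPlane β _ (one_le_re_lineMap hw hw' hs), ?_, ?_,
    fun u v => by simpa using (lipschitzWith_logMap _).dist_le_mul u v, norm_logMap _, ?_⟩
  · rw [dist_ofHalfPlane, dist_ofHalfPlane, dist_left_lineMap, Real.norm_of_nonneg hs.1]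
  · rw [dist_ofHalfPlane, dist_ofHalfPlane, dist_lineMap_right,
      Real.norm_of_nonneg (sub_nonneg.2 hs.2)]
  · rw [dist_logMap_of_visible (visible_of_halfPlane hz hx) (visible_of_halfPlane hz hy),
      dist_eq_of_halfPlane hx hy]

theorem dist_tangentLine_add_tangentAngle (x : ParkingLot) {e : ℝ} (he : -x.tangentLength ≤ e) :
    dist x (tangentLine (x.angle + x.tangentAngle) e) = x.tangentLength + e := by
  have h := dist_tangentLine (x.angle + x.tangentAngle) (-x.tangentLength) e
  rw [tangentLine_neg_tangentLength, abs_of_nonpos (by linarith)] at h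
  linarith

theorem dist_tangentLine_sub_tangentAngle (y : ParkingLot) {e : ℝ} (he : e ≤ y.tangentLength) :
    dist (tangentLine (y.angle - y.tangentAngle) e) y = y.tangentLength - e := by
  have h := dist_tangentLine (y.angle - y.tangentAngle) e y.tangentLength
  rwa [tangentLine_tangentLength, abs_sub_comm, abs_of_nonneg (sub_nonneg.2 he)] at h

theorem isLogMap_tangentLine_left {x y : ParkingLot}
    (h : x.tangentAngle + y.tangentAngle ≤ y.angle - x.angle) {e : ℝ} (he : -x.tangentLength ≤ e)
    (he0 : e ≤ 0) {z : ParkingLot} (hz : z = tangentLine (x.angle + x.tangentAngle) e) :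
    dist x z + dist z y = dist x y ∧ IsLogMap (logMap z) x z y := by
  have hdist : dist x z = x.tangentLength + e := hz ▸ dist_tangentLine_add_tangentAngle x he
  have hta : z.tangentAngle = -Real.arctan e := by
    rw [hz, tangentAngle_tangentLine, abs_of_nonpos he0, Real.arctan_neg]
  have hangle : z.angle = x.angle + x.tangentAngle + Real.arctan e := by rw [hz, angle_tangentLine]
  have hshadow : z.tangentAngle + y.tangentAngle ≤ y.angle - z.angle := by linarith
  have hbetween : dist x z + dist z y = dist x y := by
    rw [hdist, dist_eq_of_shadow hshadow, dist_eq_of_shadow h, hta, hangle, hz,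
      tangentLength_tangentLine, abs_of_nonpos he0]
    ring
  refine ⟨hbetween, isLogMap_logMap_of_opposite (norm_I_mul_exp _) ?_ (logMap_of_ahead hshadow)
    hbetween⟩
  have hlog := logMap_tangentLine (x.angle + x.tangentAngle) e (-x.tangentLength)
  rw [tangentLine_neg_tangentLength, ← hz] at hlog
  rw [hlog, dist_comm, hdist, hta, neg_add']

theorem isLogMap_tangentLine_right {x y : ParkingLot}
    (h : x.tangentAngle + y.tangentAngle ≤ y.angle - x.angle) {e : ℝ} (he0 : 0 ≤ e)
    (he : e ≤ y.tangentLength) {z : ParkingLot}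
    (hz : z = tangentLine (y.angle - y.tangentAngle) e) :
    dist x z + dist z y = dist x y ∧ IsLogMap (logMap z) x z y := by
  have hdist : dist z y = y.tangentLength - e := hz ▸ dist_tangentLine_sub_tangentAngle y he
  have hta : z.tangentAngle = Real.arctan e := by
    rw [hz, tangentAngle_tangentLine, abs_of_nonneg he0]
  have hangle : z.angle = y.angle - y.tangentAngle + Real.arctan e := by rw [hz, angle_tangentLine]
  have hshadow : x.tangentAngle + z.tangentAngle ≤ z.angle - x.angle := by linarith
  have hbetween : dist x z + dist z y = dist x y := by
    rw [hdist, dist_eq_of_shadow hshadow, dist_eq_of_shadow h, hta, hangle, hz,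
      tangentLength_tangentLine, abs_of_nonneg he0]
    ring
  refine ⟨hbetween, isLogMap_logMap_of_opposite (norm_I_mul_exp _)
    (logMap_of_behind ((add_comm _ _).trans_le hshadow)) ?_ hbetween⟩
  have hlog := logMap_tangentLine (y.angle - y.tangentAngle) e y.tangentLength
  rw [tangentLine_tangentLength, ← hz] at hlog
  rw [hlog, hdist, hta]

theorem dist_circlePoint_right {x : ParkingLot} {T : ℝ} (h : x.angle + x.tangentAngle ≤ T) :
    dist x (circlePoint T) = x.tangentLength + (T - x.angle - x.tangentAngle) := by
  rw [dist_eq_of_shadow (by rw [angle_circlePoint, tangentAngle_circlePoint]; linarith)]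
  simp

theorem isLogMap_circlePoint {x y : ParkingLot} {T : ℝ} (hx : x.angle + x.tangentAngle ≤ T)
    (hy : T ≤ y.angle - y.tangentAngle) :
    dist x (circlePoint T) + dist (circlePoint T) y = dist x y ∧
      IsLogMap (logMap (circlePoint T)) x (circlePoint T) y := by
  have hahead : (circlePoint T).tangentAngle + y.tangentAngle
      ≤ y.angle - (circlePoint T).angle := by
    rw [tangentAngle_circlePoint, angle_circlePoint]
    linarith
  have hbehind : (circlePoint T).tangentAngle + x.tangentAngle
      ≤ (circlePoint T).angle - x.angle := by
    rw [tangentAngle_circlePoint, angle_circlePoint]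
    linarith
  have hbetween : dist x (circlePoint T) + dist (circlePoint T) y = dist x y := by
    rw [dist_circlePoint_right hx, dist_eq_of_shadow hahead, dist_eq_of_shadow (by linarith),
      tangentAngle_circlePoint, angle_circlePoint, tangentLength_circlePoint]
    ring
  refine ⟨hbetween, isLogMap_logMap_of_opposite (norm_I_mul_exp _) ?_ (logMap_of_ahead hahead)
    hbetween⟩
  rw [logMap_of_behind hbehind, tangentAngle_circlePoint, neg_zero]

theorem exists_isLogMap_of_shadow {x y : ParkingLot}
    (h : x.tangentAngle + y.tangentAngle ≤ y.angle - x.angle) {r : ℝ} (hr : 0 ≤ r)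
    (hrD : r ≤ dist x y) :
    ∃ z, dist x z = r ∧ dist x z + dist z y = dist x y ∧ IsLogMap (logMap z) x z y := by
  have hD := dist_eq_of_shadow h
  rcases le_total r x.tangentLength with hleft | hleft
  · refine ⟨_, ?_, isLogMap_tangentLine_left h (e := r - x.tangentLength) (by linarith)
      (by linarith) rfl⟩
    rw [dist_tangentLine_add_tangentAngle x (by linarith)]
    ring
  rcases le_total (dist x y - r) y.tangentLength with hright | hright
  · have hz := isLogMap_tangentLine_right h (e := y.tangentLength - (dist x y - r)) (by linarith)
      (by linarith) rfl
    refine ⟨_, ?_, hz⟩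
    have hdist := dist_tangentLine_sub_tangentAngle y (e := y.tangentLength - (dist x y - r))
      (by linarith)
    linarith [hz.1]
  · refine ⟨_, ?_, isLogMap_circlePoint (T := x.angle + x.tangentAngle + (r - x.tangentLength))
      (by linarith) (by linarith)⟩
    rw [dist_circlePoint_right (by linarith)]
    ring

theorem isLogMap_logMap {x z y : ParkingLot} (hz : dist x z + dist z y = dist x y) :
    IsLogMap (logMap z) x z y := by
  refine isLogMap_of_exists (fun x y s hs => ?_) hz
  wlog hxy : x.angle ≤ y.angle generalizing x y s
  · obtain ⟨z, hyz, hzx, hl⟩ :=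
      this y x (1 - s) ⟨by linarith [hs.2], by linarith [hs.1]⟩ (le_of_not_ge hxy)
    exact ⟨z, by rw [dist_comm, hzx, sub_sub_cancel, dist_comm y],
      by rw [dist_comm, hyz, dist_comm y], hl.symm⟩
  rcases le_total |y.angle - x.angle| (x.tangentAngle + y.tangentAngle) with hvis | hshadow
  · exact exists_isLogMap_of_visible hvis hs
  rw [abs_of_nonneg (sub_nonneg.2 hxy)] at hshadow
  obtain ⟨z, hxz, hz, hl⟩ := exists_isLogMap_of_shadow hshadow
    (mul_nonneg hs.1 dist_nonneg) (mul_le_of_le_one_left dist_nonneg hs.2)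
  exact ⟨z, hxz, by linarith, hl⟩

theorem hasLogMaps : HasLogMaps ParkingLot := fun _ _ _ hz => ⟨_, isLogMap_logMap hz⟩

theorem joinedByGeodesic_of_visible {x y : ParkingLot}
    (h : |y.angle - x.angle| ≤ x.tangentAngle + y.tangentAngle) : JoinedByGeodesic x y := by
  obtain ⟨β, hx, hy⟩ := exists_halfPlane h
  obtain ⟨w, hw, rfl⟩ := exists_eq_ofHalfPlane hx
  obtain ⟨w', hw', rfl⟩ := exists_eq_ofHalfPlane hy
  have hre (s : ℝ) := one_le_re_lineMap hw hw' (projIcc 0 1 zero_le_one s).2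
  have hc {s : ℝ} (hs : s ∈ Icc (0 : ℝ) 1) :
      ofHalfPlane β _ (hre s) = ofHalfPlane β _ (one_le_re_lineMap hw hw' hs) := by
    simp only [projIcc_of_mem _ hs]
  refine ⟨fun s => ofHalfPlane β _ (hre s), ?_, ?_, fun s hs t ht => ?_⟩
  · simp
  · simp
  · beta_reduce
    rw [hc hs, hc ht, dist_ofHalfPlane, dist_ofHalfPlane, dist_lineMap_lineMap, Real.dist_eq]

theorem joinedByGeodesic_of_shadow {x y : ParkingLot}
    (h : x.tangentAngle + y.tangentAngle ≤ y.angle - x.angle) : JoinedByGeodesic x y := by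
  have hx0 := x.tangentAngle_nonneg
  have hy0 := y.tangentAngle_nonneg
  have hST : x.angle + x.tangentAngle ≤ y.angle - y.tangentAngle := by linarith
  set S := x.angle + x.tangentAngle
  set T := y.angle - y.tangentAngle
  have hdist : dist (circlePoint S) (circlePoint T) = T - S := by
    rw [dist_circlePoint, abs_sub_comm, abs_of_nonneg (sub_nonneg.2 hST)]
  have hxS : JoinedByGeodesic x (circlePoint S) :=
    joinedByGeodesic_of_visible (by simp [S, abs_of_nonneg hx0])
  have hSy : JoinedByGeodesic (circlePoint S) (circlePoint T) :=
    .of_dist_le (fun s => circlePoint (S + s)) (by simp) (by rw [hdist, add_sub_cancel])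
      fun s t _ hst _ => by
        rw [dist_circlePoint, add_sub_add_left_eq_sub, abs_sub_comm,
          abs_of_nonneg (sub_nonneg.2 hst)]
  have hTy : JoinedByGeodesic (circlePoint T) y :=
    joinedByGeodesic_of_visible (by simp [T, abs_of_nonneg hy0])
  have hxT := hxS.trans hSy (by
    rw [hdist, dist_circlePoint_right le_rfl, dist_circlePoint_right hST]
    ring)
  exact hxT.trans hTy (isLogMap_circlePoint hST le_rfl).1

theorem joinedByGeodesic (x y : ParkingLot) : JoinedByGeodesic x y := by
  wlog hxy : x.angle ≤ y.angle generalizing x y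
  · exact (this y x (le_of_not_ge hxy)).symm
  rcases le_total |y.angle - x.angle| (x.tangentAngle + y.tangentAngle) with hvis | hshadow
  · exact joinedByGeodesic_of_visible hvis
  · exact joinedByGeodesic_of_shadow (hshadow.trans_eq (abs_of_nonneg (sub_nonneg.2 hxy)))

theorem isCAT0 : IsCAT0 ParkingLot := hasLogMaps.bruhatTits.isCAT0 joinedByGeodesic

end ParkingLot

/-! ## Curtains in the parking lot with rays attached -/

theorem card_le_card_of_pairwise_disjoint {κ X : Type*} [Fintype κ] {c : κ → Set X}
    (hc : ∀ i j, i ≠ j → Disjoint (c i) (c j)) {S : Finset X} (hS : ∀ i, ∃ x ∈ S, x ∈ c i) :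
    Fintype.card κ ≤ S.card :=
  Finset.card_le_card_of_forall_subsingleton (fun i x => x ∈ c i) (fun i _ => hS i)
    fun _ _ i hi j hj => by_contra fun hij => disjoint_left.1 (hc i j hij) hi.2 hj.2

namespace AttachRays

variable {ι : Type*} {p : ι → ParkingLot}

theorem bruhatTits_parkingLot (p : ι → ParkingLot) : BruhatTits (AttachRays p) :=
  (hasLogMaps ParkingLot.hasLogMaps).bruhatTits

theorem isCAT0_parkingLot (p : ι → ParkingLot) : IsCAT0 (AttachRays p) :=
  (bruhatTits_parkingLot p).isCAT0 (joinedByGeodesic ParkingLot.joinedByGeodesic)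

/-- The angular coordinate of the foot of a point of the parking lot with rays attached. -/
def angle (u : AttachRays p) : ℝ := u.foot.angle

theorem angle_eq_of_onSameRay {u v : AttachRays p} (h : OnSameRay u v) : u.angle = v.angle := by
  obtain ⟨i, ⟨s, hs, rfl⟩, ⟨t, ht, rfl⟩⟩ := h
  rfl

theorem abs_angle_sub_le (u v : AttachRays p) : |u.angle - v.angle| ≤ dist u v := by
  by_cases h : OnSameRay u v
  · rw [angle_eq_of_onSameRay h, sub_self, abs_zero]
    exact dist_nonneg
  · rw [dist_eq_of_not_onSameRay h, angle, angle]
    linarith [ParkingLot.abs_angle_sub_le u.foot v.foot, u.height_nonneg, v.height_nonneg]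

/-- The boundary circle of the parking lot, unrolled to a line and parametrized by the angle. -/
def boundaryLine (p : ι → ParkingLot) (s : ℝ) : AttachRays p := base (ParkingLot.circlePoint s)

theorem isGeodesicOn_boundaryLine (p : ι → ParkingLot) : IsGeodesicOn univ (boundaryLine p) :=
  ⟨isClosed_univ, ordConnected_univ, fun s _ t _ => ParkingLot.dist_circlePoint s t⟩

theorem isProj_boundaryLine (u : AttachRays p) : IsProj univ (boundaryLine p) u u.angle := by
  refine ⟨mem_univ _, fun t _ => ?_⟩
  rw [dist_comm, dist_comm u, boundaryLine, boundaryLine, dist_base, dist_base,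
    ParkingLot.dist_eq_of_angle_eq (x := ParkingLot.circlePoint u.angle) (y := u.foot) rfl]
  gcongr
  exact ParkingLot.abs_radius_sub_le (ParkingLot.circlePoint t) u.foot

theorem dist_add_boundaryLine {u v : AttachRays p} {T : ℝ} (hu : u.angle + Real.pi / 2 ≤ T)
    (hv : T + Real.pi / 2 ≤ v.angle) :
    dist u (boundaryLine p T) + dist (boundaryLine p T) v = dist u v := by
  have h : ¬ OnSameRay u v := fun h => by
    linarith [angle_eq_of_onSameRay h, Real.pi_pos]
  rw [dist_eq_of_not_onSameRay h, dist_comm u, boundaryLine, dist_base, dist_base,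
    ← ParkingLot.dist_add_circlePoint hu hv, dist_comm u.foot]
  ring

/-- The geodesic dual to the curtain moves by at most `1` in angle along the curtain, so one of the
two geodesics realizing the projections of `z` and `z'` passes through a boundary point. -/
theorem boundaryLine_mem_of_isCurtain {h : Set (AttachRays p)} (hc : IsCurtain h) {A : ℝ}
    {z z' : AttachRays p} (hz : z ∈ h) (hz' : z' ∈ h) (hA : z.angle ≤ A)
    (hA' : A + 19 ≤ z'.angle) :
    boundaryLine p (A + 2) ∈ h ∨ boundaryLine p (A + 9) ∈ h := by
  obtain ⟨I, α, r, hc⟩ := hc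
  obtain ⟨s, hs, hproj⟩ := hc.mem_iff.1 hz
  obtain ⟨s', hs', hproj'⟩ := hc.mem_iff.1 hz'
  have hpi := Real.pi_lt_four
  rcases le_or_gt (A + 4) (α s).angle with hfar | hnear
  · exact Or.inl (hc.mem_iff.2
      ⟨s, hs, hproj.of_between (dist_add_boundaryLine (by linarith) (by linarith))⟩)
  have hdist := abs_angle_sub_le (α s) (α s')
  rw [hc.1.2.2 s (hc.Icc_subset hs) s' (hc.Icc_subset hs')] at hdist
  have hss' : |s - s'| ≤ 1 := abs_le.2 ⟨by linarith [hs.1, hs'.2], by linarith [hs.2, hs'.1]⟩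
  have hangle := (abs_le.1 (hdist.trans hss')).1
  refine Or.inr (hc.mem_iff.2 ⟨s', hs', hproj'.of_between ?_⟩)
  rw [dist_comm z' (boundaryLine p _), dist_comm (boundaryLine p _) (α s'), dist_comm z' (α s'),
    add_comm]
  exact dist_add_boundaryLine (by linarith) (by linarith)

theorem mem_curtain_boundaryLine {A : ℝ} {z : AttachRays p} :
    z ∈ curtain univ (boundaryLine p) A ↔ z.angle ∈ Icc (A - 1 / 2) (A + 1 / 2) := by
  refine ⟨fun hz => ?_, fun hz => mem_projPreimage.2 ⟨_, hz, isProj_boundaryLine z⟩⟩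
  obtain ⟨s, hs, hproj⟩ := mem_projPreimage.1 hz
  rwa [(isProj_boundaryLine z).unique (bruhatTits_parkingLot p) (isGeodesicOn_boundaryLine p) hproj]

theorem lSeparated_boundaryLine {A B : ℝ} (hAB : A + 20 ≤ B) :
    LSeparated 2 (curtain univ (boundaryLine p) A) (curtain univ (boundaryLine p) B) := by
  have hdisj : 1 < |A - B| := by rw [abs_sub_comm]; linarith [le_abs_self (B - A)]
  refine ⟨disjoint_curtain (bruhatTits_parkingLot p) (isGeodesicOn_boundaryLine p) hdisj,
    fun n c hc hmeets => ?_⟩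
  classical
  let S : Finset (AttachRays p) :=
    {boundaryLine p (A + 1 / 2 + 2), boundaryLine p (A + 1 / 2 + 9)}
  have hmem (k : Fin n) : ∃ b ∈ S, b ∈ c k := by
    obtain ⟨⟨z, hz, hzA⟩, ⟨z', hz', hzB⟩⟩ := hmeets k
    simpa [S] using boundaryLine_mem_of_isCurtain (hc.1 k) hz hz' (mem_curtain_boundaryLine.1 hzA).2
      (by linarith [(mem_curtain_boundaryLine.1 hzB).1])
  simpa using (card_le_card_of_pairwise_disjoint hc.2.1 hmem).trans Finset.card_le_two

theorem angle_sub_le_dL {x y : AttachRays p} {L : ℕ} (hL : 2 ≤ L) {B : ℝ}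
    (hB : ChainBound L x y B) : (y.angle - x.angle) / 20 ≤ dL L x y :=
  hB.sub_div_le_dL (bruhatTits_parkingLot p) (isGeodesicOn_boundaryLine p) (by norm_num)
    (isProj_boundaryLine x) (isProj_boundaryLine y)
    fun _ _ _ h => (lSeparated_boundaryLine h).mono hL

end AttachRays

namespace ParkingLot

theorem abs_angle_sub_le_tangentAngle {x : ParkingLot} {β : ℝ} (hβ : |x.angle - β| < Real.pi / 2)
    (hcos : 1 ≤ x.radius * Real.cos (x.angle - β)) : |x.angle - β| ≤ x.tangentAngle := by
  by_contra! h
  have hlt := Real.cos_lt_cos_of_nonneg_of_le_pi x.tangentAngle_nonneg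
    (by linarith [Real.pi_pos]) h
  rw [Real.cos_abs] at hlt
  have hmul := mul_lt_mul_of_pos_left hlt x.radius_pos
  rw [radius_mul_cos_tangentAngle] at hmul
  linarith

theorem sq_dist_toPlane_of_radius_mul_cos {x y : ParkingLot} {ρ : ℝ}
    (h : x.radius * Real.cos (x.angle - y.angle) = ρ) :
    dist x.toPlane y.toPlane ^ 2 = x.radius ^ 2 - ρ ^ 2 + (y.radius - ρ) ^ 2 := by
  rw [sq_dist_toPlane, Real.sin_sq_eq_half_sub, mul_div_cancel₀ _ two_ne_zero, ← h]
  ring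

/-- The point of radius `1 + s` on the radial geodesic ray at the angle `k`. -/
def radialPoint (k s : ℝ) : ParkingLot := ⟨k, 1 + max s 0, by linarith [le_max_right s 0]⟩

theorem angle_radialPoint (k s : ℝ) : (radialPoint k s).angle = k := rfl

theorem radius_radialPoint (k : ℝ) {s : ℝ} (hs : 0 ≤ s) : (radialPoint k s).radius = 1 + s := by
  simp only [radialPoint, max_eq_left hs]

theorem exists_logMap_eq_smul_of_between {x z y : ParkingLot}
    (hz : dist x z + dist z y = dist x y) :
    ∃ v : ℂ, ‖v‖ = 1 ∧ logMap z x = -(dist x z • v) ∧ logMap z y = dist z y • v := by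
  have hl := isLogMap_logMap hz
  have hadd : ‖logMap z x - logMap z y‖ = ‖logMap z x‖ + ‖logMap z y‖ := by
    rw [← dist_eq_norm, hl.dist_eq, ← hz, norm_logMap, norm_logMap, dist_comm z x]
  obtain ⟨v, hv, hx, hy⟩ := exists_smul_of_norm_sub_eq_add hadd
  rw [norm_logMap] at hx hy
  exact ⟨v, hv, by rwa [dist_comm], hy⟩

theorem exists_logMap_eq_smul {β : ℝ → ParkingLot} {r δ : ℝ} (hδ : 0 < δ)
    (hβ : ∀ s ∈ Icc (r - δ) (r + δ), ∀ t ∈ Icc (r - δ) (r + δ), dist (β s) (β t) = |s - t|) :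
    ∃ v : ℂ, ‖v‖ = 1 ∧
      ∀ s ∈ Icc (r - δ) (r + δ), logMap (β r) (β s) = (s - r) • v := by
  have hmid : r ∈ Icc (r - δ) (r + δ) := ⟨by linarith, by linarith⟩
  have hleft : r - δ ∈ Icc (r - δ) (r + δ) := ⟨le_rfl, by linarith⟩
  have hright : r + δ ∈ Icc (r - δ) (r + δ) := ⟨by linarith, le_rfl⟩
  have hpair {s t : ℝ} (hs : s ∈ Icc (r - δ) (r + δ)) (ht : t ∈ Icc (r - δ) (r + δ)) (hsr : s ≤ r)
      (hrt : r ≤ t) : ∃ v : ℂ, ‖v‖ = 1 ∧ logMap (β r) (β s) = (s - r) • v ∧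
        logMap (β r) (β t) = (t - r) • v := by
    have hsr' : dist (β s) (β r) = r - s := by
      rw [hβ s hs r hmid, abs_sub_comm, abs_of_nonneg (sub_nonneg.2 hsr)]
    have hrt' : dist (β r) (β t) = t - r := by
      rw [hβ r hmid t ht, abs_sub_comm, abs_of_nonneg (sub_nonneg.2 hrt)]
    have hst : dist (β s) (β t) = t - s := by
      rw [hβ s hs t ht, abs_sub_comm, abs_of_nonneg (by linarith)]
    obtain ⟨v, hv, hl, hr⟩ := exists_logMap_eq_smul_of_between (x := β s) (z := β r) (y := β t)
      (by linarith)
    exact ⟨v, hv, by rw [hl, hsr', ← neg_smul, neg_sub], by rw [hr, hrt']⟩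
  obtain ⟨v, hv, hvl, hvr⟩ := hpair hleft hright (by linarith) (by linarith)
  refine ⟨v, hv, fun s hs => ?_⟩
  rcases le_total s r with hsr | hrs
  · obtain ⟨w, -, hw, hwr⟩ := hpair hs hright hsr (by linarith)
    have hwv : w = v := smul_right_injective ℂ (by simpa using hδ.ne') (hwr.symm.trans hvr)
    rw [hw, hwv]
  · obtain ⟨w, -, hwl, hw⟩ := hpair hleft hs (by linarith) hrs
    have hwv : w = v := smul_right_injective ℂ (by simpa using hδ.ne') (hwl.symm.trans hvl)
    rw [hw, hwv]

theorem exists_normal {β : ℝ → ParkingLot} {r δ : ℝ} (hδ : 0 < δ)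
    (hβ : ∀ s ∈ Icc (r - δ) (r + δ), ∀ t ∈ Icc (r - δ) (r + δ), dist (β s) (β t) = |s - t|) :
    ∃ n : ℂ, ‖n‖ = 1 ∧ 0 ≤ n.re ∧ ∀ (τ : ℝ) (z : ParkingLot), logMap (β r) z = τ • n →
      ∀ s ∈ Icc (r - δ) (r + δ), dist z (β r) ≤ dist z (β s) := by
  obtain ⟨v, hv, hre, hlog⟩ : ∃ v : ℂ, ‖v‖ = 1 ∧ 0 ≤ (Complex.I * v).re ∧
      ∀ s ∈ Icc (r - δ) (r + δ), ∃ c : ℝ, logMap (β r) (β s) = c • v := by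
    obtain ⟨v, hv, hlog⟩ := exists_logMap_eq_smul hδ hβ
    rcases le_total 0 (Complex.I * v).re with hre | hre
    · exact ⟨v, hv, hre, fun s hs => ⟨_, hlog s hs⟩⟩
    · exact ⟨-v, by rwa [norm_neg], by rwa [mul_neg, Complex.neg_re, neg_nonneg],
        fun s hs => ⟨-(s - r), by rw [hlog s hs, neg_smul_neg]⟩⟩
  refine ⟨Complex.I * v, by rw [norm_mul, Complex.norm_I, hv, one_mul], hre, fun τ z hz s hs => ?_⟩
  obtain ⟨c, hc⟩ := hlog s hs
  calc dist z (β r) = |τ| := by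
        rw [dist_comm, ← norm_logMap, hz, norm_smul, norm_mul, Complex.norm_I, hv, one_mul, mul_one,
          Real.norm_eq_abs]
    _ ≤ ‖(-c + τ * Complex.I : ℂ)‖ := by
        simpa using Complex.abs_im_le_norm (-c + τ * Complex.I)
    _ = dist (logMap (β r) z) (logMap (β r) (β s)) := by
        rw [dist_eq_norm, hz, hc, Complex.real_smul, Complex.real_smul,
          show (τ : ℂ) * (Complex.I * v) - c * v = (-c + τ * Complex.I) * v by ring, norm_mul, hv,
          mul_one]
    _ ≤ dist z (β s) := by simpa using (lipschitzWith_logMap (β r)).dist_le_mul z (β s)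

theorem logMap_ofHalfPlane (q : ParkingLot) (w : ℂ) (hw : 1 ≤ w.re) :
    logMap q (ofHalfPlane q.angle w hw) = w - q.radius := by
  have h := abs_angle_sub_le_tangentAngle_ofHalfPlane q.angle w hw
  rw [logMap_of_visible (h.trans (by linarith [q.tangentAngle_nonneg])), toPlane_ofHalfPlane,
    toPlane_eq, mul_comm (q.radius : ℂ), ← mul_sub, ← mul_assoc, ← Complex.exp_add, ← add_mul,
    ← Complex.ofReal_add, neg_add_cancel, Complex.ofReal_zero, zero_mul, Complex.exp_zero, one_mul]

theorem radius_mul_cos_ofHalfPlane (β k : ℝ) (w : ℂ) (hw : 1 ≤ w.re) :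
    (ofHalfPlane β w hw).radius * Real.cos ((ofHalfPlane β w hw).angle - k)
      = w.re * Real.cos (k - β) + w.im * Real.sin (k - β) := by
  rw [ofHalfPlane, show β + w.arg - k = w.arg - (k - β) by ring, Real.cos_sub, mul_add,
    ← mul_assoc, ← mul_assoc, Complex.norm_mul_cos_arg, Complex.norm_mul_sin_arg]

end ParkingLot

namespace AttachRays

variable {ι : Type*} {p : ι → ParkingLot}

/-- The radial geodesic ray at the angle `k`. -/
def radial (p : ι → ParkingLot) (k s : ℝ) : AttachRays p := base (ParkingLot.radialPoint k s)

theorem isGeodesicOn_radial (p : ι → ParkingLot) (k : ℝ) :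
    IsGeodesicOn (Ici 0) (radial p k) := by
  refine ⟨isClosed_Ici, ordConnected_Ici, fun s hs t ht => ?_⟩
  rw [radial, radial, dist_base_base, ParkingLot.dist_eq_of_angle_eq
    (x := ParkingLot.radialPoint k s) (y := ParkingLot.radialPoint k t) rfl,
    ParkingLot.radius_radialPoint k hs, ParkingLot.radius_radialPoint k ht,
    add_sub_add_left_eq_sub]

theorem isProj_radial {k s : ℝ} (hs : 0 ≤ s) {z : ParkingLot}
    (hangle : |z.angle - k| < Real.pi / 2)
    (hcos : z.radius * Real.cos (z.angle - k) = 1 + s) :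
    IsProj (Ici 0) (radial p k) (base z) s := by
  refine ⟨hs, fun t _ => ?_⟩
  rw [radial, radial, dist_base_base, dist_base_base]
  have hz := ParkingLot.abs_angle_sub_le_tangentAngle hangle (by linarith)
  have hk : |(ParkingLot.radialPoint k s).angle - k|
      ≤ (ParkingLot.radialPoint k s).tangentAngle := by
    rw [ParkingLot.angle_radialPoint, sub_self, abs_zero]
    exact ParkingLot.tangentAngle_nonneg _
  refine le_trans ?_ (ParkingLot.dist_toPlane_le _ _)
  rw [ParkingLot.dist_eq_of_halfPlane hz hk]
  refine le_of_sq_le_sq ?_ dist_nonneg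
  rw [ParkingLot.sq_dist_toPlane_of_radius_mul_cos (y := ParkingLot.radialPoint k s) hcos,
    ParkingLot.sq_dist_toPlane_of_radius_mul_cos (y := ParkingLot.radialPoint k t) hcos,
    ParkingLot.radius_radialPoint k hs, sub_self, zero_pow two_ne_zero, add_zero,
    le_add_iff_nonneg_right]
  exact sq_nonneg _

end AttachRays

namespace ParkingLot

theorem abs_lt_pi_div_two_of_cos_pos {x : ℝ} (h : |x| ≤ Real.pi + Real.pi / 2)
    (hcos : 0 < Real.cos x) : |x| < Real.pi / 2 := by
  by_contra! hx
  have hle := Real.cos_nonpos_of_pi_div_two_le_of_le hx h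
  rw [Real.cos_abs] at hle
  exact hle.not_gt hcos

theorem dist_add_dist_eq_of_angle_le {x x' y y' : ParkingLot} {A : ℝ} (hx : x.angle ≤ A)
    (hx' : x'.angle ≤ A) (hy : A + Real.pi ≤ y.angle) (hy' : A + Real.pi ≤ y'.angle) :
    dist x y + dist x' y' = dist x y' + dist x' y := by
  have hlt := x.tangentAngle_lt
  have hlt' := x'.tangentAngle_lt
  have hylt := y.tangentAngle_lt
  have hylt' := y'.tangentAngle_lt
  rw [dist_eq_of_shadow (x := x) (y := y) (by linarith),
    dist_eq_of_shadow (x := x') (y := y') (by linarith),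
    dist_eq_of_shadow (x := x) (y := y') (by linarith),
    dist_eq_of_shadow (x := x') (y := y) (by linarith)]
  ring

end ParkingLot

namespace AttachRays

variable {ι : Type*} {p : ι → ParkingLot}

/-- The set `h` goes to infinity in the direction of the angle `k`: it meets every line far out
which is orthogonal to this direction. -/
def HasEnd (h : Set (AttachRays p)) (k : ℝ) : Prop :=
  ∃ ρ₀ : ℝ, ∀ ρ ≥ ρ₀, ∃ z : ParkingLot, base z ∈ h ∧ |z.angle - k| < Real.pi / 2 ∧
    z.radius * Real.cos (z.angle - k) = ρ

/-- The curtains dual to the radial geodesic in the common direction meet both sets far out. -/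
theorem HasEnd.not_lSeparated {h h' : Set (AttachRays p)} {k : ℝ} (hk : HasEnd h k)
    (hk' : HasEnd h' k) (L : ℕ) : ¬ LSeparated L h h' := by
  rintro ⟨-, hsep⟩
  obtain ⟨ρ₀, hρ₀⟩ := hk
  obtain ⟨ρ₁, hρ₁⟩ := hk'
  set r := max 1 (max ρ₀ ρ₁)
  have hr : 1 ≤ r := le_max_left _ _
  have hρ₀r : ρ₀ ≤ r := (le_max_left _ _).trans (le_max_right _ _)
  have hρ₁r : ρ₁ ≤ r := (le_max_right _ _).trans (le_max_right _ _)
  have hj (j : Fin (L + 1)) : r ≤ r + 2 * (j : ℕ) := le_add_of_nonneg_right (by positivity)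
  have hchain : IsCurtainChain
      (fun j : Fin (L + 1) => curtain (Ici 0) (radial p k) (r + 2 * (j : ℕ))) := by
    refine isCurtainChain_curtain (bruhatTits_parkingLot p) (isGeodesicOn_radial p k) one_lt_two
      fun j s hs => ?_
    rw [interior_Ici, mem_Ioi]
    linarith [hs.1, hj j]
  refine (hsep _ _ hchain fun j => ?_).not_gt (Nat.lt_succ_self L)
  have hmeet {z : ParkingLot} (hz : |z.angle - k| < Real.pi / 2)
      (hcos : z.radius * Real.cos (z.angle - k) = 1 + (r + 2 * (j : ℕ))) :
      base z ∈ curtain (Ici 0) (radial p k) (r + 2 * (j : ℕ)) :=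
    mem_projPreimage.2 ⟨_, ⟨by linarith, by linarith⟩,
      isProj_radial (by linarith [hj j]) hz hcos⟩
  obtain ⟨z, hz, hangle, hcos⟩ := hρ₀ (1 + (r + 2 * (j : ℕ))) (by linarith [hj j])
  obtain ⟨z', hz', hangle', hcos'⟩ := hρ₁ (1 + (r + 2 * (j : ℕ))) (by linarith [hj j])
  exact ⟨⟨_, hmeet hangle hcos, hz⟩, ⟨_, hmeet hangle' hcos', hz'⟩⟩

theorem hasEnd_of_ray {h : Set (AttachRays p)} {q : ParkingLot} {n : ℂ} (hn : ‖n‖ = 1)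
    (hre : 0 ≤ n.re)
    (hmem : ∀ τ : ℝ, 0 ≤ τ → ∀ hw, base (ParkingLot.ofHalfPlane q.angle (q.radius + τ • n) hw) ∈ h)
    {k : ℝ} (hk : |q.angle + n.arg - k| < Real.pi / 2) : HasEnd h k := by
  have harg := abs_le.1 (Complex.abs_arg_le_pi_div_two_iff.2 hre)
  have hk' := abs_lt.1 hk
  have hcos : 0 < Real.cos (q.angle + n.arg - k) := Real.cos_pos_of_mem_Ioo hk'
  set a := q.radius * Real.cos (k - q.angle)
  refine ⟨max a 1, fun ρ hρ => ?_⟩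
  obtain ⟨hρa, hρ1⟩ := max_le_iff.1 hρ
  obtain ⟨τ, hτ, hτρ⟩ : ∃ τ : ℝ, 0 ≤ τ ∧ a + τ * Real.cos (q.angle + n.arg - k) = ρ :=
    ⟨(ρ - a) / Real.cos (q.angle + n.arg - k), div_nonneg (sub_nonneg.2 hρa) hcos.le, by
      rw [div_mul_cancel₀ _ hcos.ne', add_sub_cancel]⟩
  have hw : 1 ≤ ((q.radius : ℂ) + τ • n).re := by
    rw [Complex.add_re, Complex.ofReal_re, Complex.smul_re, smul_eq_mul]
    linarith [q.one_le_radius, mul_nonneg hτ hre]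
  set z := ParkingLot.ofHalfPlane q.angle _ hw with hz
  have hval : z.radius * Real.cos (z.angle - k) = ρ := by
    rw [hz, ParkingLot.radius_mul_cos_ofHalfPlane, ← hτρ,
      show q.angle + n.arg - k = n.arg - (k - q.angle) by ring, Real.cos_sub n.arg,
      ← one_mul (Real.cos n.arg), ← one_mul (Real.sin n.arg), ← hn, Complex.norm_mul_cos_arg,
      Complex.norm_mul_sin_arg]
    simp only [Complex.add_re, Complex.add_im, Complex.ofReal_re, Complex.ofReal_im,
      Complex.smul_re, Complex.smul_im, smul_eq_mul, a]
    ring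
  refine ⟨z, hmem τ hτ hw, ParkingLot.abs_lt_pi_div_two_of_cos_pos ?_ ?_, hval⟩
  · have hzq := abs_le.1 ((ParkingLot.abs_angle_sub_le_tangentAngle_ofHalfPlane q.angle _ hw).trans
      (ParkingLot.tangentAngle_lt _).le)
    exact abs_le.2 ⟨by linarith, by linarith⟩
  · exact pos_of_mul_pos_right (hval ▸ one_pos.trans_le hρ1) z.radius_pos.le

theorem exists_hasEnd {h : Set (AttachRays p)} {I : Set ℝ} {α : ℝ → AttachRays p} {r : ℝ}
    (hc : IsCurtainAt h I α r) {β : ℝ → ParkingLot}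
    (hβ : ∀ s ∈ Icc (r - 1 / 2) (r + 1 / 2), α s = base (β s)) :
    ∃ k : ℤ, HasEnd h k ∧ |(k : ℝ) - (β r).angle| ≤ 3 := by
  have hr : r ∈ Icc (r - 1 / 2) (r + 1 / 2) := ⟨by linarith, by linarith⟩
  obtain ⟨n, hn, hre, hproj⟩ := ParkingLot.exists_normal (β := β) (r := r) one_half_pos
    fun s hs t ht => by
      rw [← dist_base_base (p := p), ← hβ s hs, ← hβ t ht,
        hc.1.2.2 s (hc.Icc_subset hs) t (hc.Icc_subset ht)]
  have hmem (τ : ℝ) (_ : 0 ≤ τ) (hw) :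
      base (ParkingLot.ofHalfPlane (β r).angle ((β r).radius + τ • n) hw) ∈ h := by
    refine hc.mem_iff.2 ⟨r, hr, isProj_of_local (bruhatTits_parkingLot p) hc.1 one_half_pos
      (hc.Icc_subset hr) fun s hs => ?_⟩
    rw [hβ r hr, hβ s hs, dist_base_base, dist_base_base]
    exact hproj τ _ (by rw [ParkingLot.logMap_ofHalfPlane, add_sub_cancel_left]) s hs
  have harg := abs_le.1 (Complex.abs_arg_le_pi_div_two_iff.2 hre)
  have hround := abs_sub_round ((β r).angle + n.arg)
  refine ⟨round ((β r).angle + n.arg),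
    hasEnd_of_ray hn hre hmem (hround.trans_lt (by linarith [Real.pi_gt_three])), ?_⟩
  have hround' := abs_le.1 hround
  exact abs_le.2 ⟨by linarith [Real.pi_lt_four], by linarith [Real.pi_lt_four]⟩

/-- A point of the parking lot sees all points far ahead of it in angle through the same point of
the boundary circle, so the difference of the distances to `x` and `y` is constant there. -/
theorem angle_mem_of_injOn {I : Set ℝ} {α : ℝ → AttachRays p} {r : ℝ} {h : Set (AttachRays p)}
    (hc : IsCurtainAt h I α r) {x y : AttachRays p}
    (hinj : InjOn (fun s => dist x (α s) - dist y (α s)) (Icc (r - 1 / 2) (r + 1 / 2)))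
    {β : ℝ → ParkingLot} (hβ : ∀ s ∈ Icc (r - 1 / 2) (r + 1 / 2), α s = base (β s)) :
    (β r).angle ∈ Icc (min x.angle y.angle - 5) (max x.angle y.angle + 5) := by
  have hr : r ∈ Icc (r - 1 / 2) (r + 1 / 2) := ⟨by linarith, by linarith⟩
  have hr' : r + 1 / 2 ∈ Icc (r - 1 / 2) (r + 1 / 2) := ⟨by linarith, by linarith⟩
  have hfoot (u : AttachRays p) {s : ℝ} (hs : s ∈ Icc (r - 1 / 2) (r + 1 / 2)) :
      dist u (α s) = dist u.foot (β s) + u.height := by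
    rw [hβ s hs, dist_comm, dist_base, dist_comm]
  have hne : dist x.foot (β r) + dist y.foot (β (r + 1 / 2))
      ≠ dist x.foot (β (r + 1 / 2)) + dist y.foot (β r) := by
    intro heq
    have hs := hinj hr hr' (by simp only [hfoot _ hr, hfoot _ hr']; linarith)
    linarith
  have hangle : |(β r).angle - (β (r + 1 / 2)).angle| ≤ 1 / 2 := by
    refine (ParkingLot.abs_angle_sub_le _ _).trans_eq ?_
    rw [← dist_base_base (p := p), ← hβ _ hr, ← hβ _ hr',
      hc.1.2.2 _ (hc.Icc_subset hr) _ (hc.Icc_subset hr'), sub_add_cancel_left, abs_neg,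
      abs_of_pos one_half_pos]
  have hangle' := abs_le.1 hangle
  have hpi := Real.pi_lt_four
  constructor <;> by_contra! hlt
  · have hx : min x.angle y.angle ≤ x.foot.angle := min_le_left _ _
    have hy : min x.angle y.angle ≤ y.foot.angle := min_le_right _ _
    refine hne ?_
    rw [dist_comm x.foot, dist_comm y.foot, dist_comm x.foot, dist_comm y.foot, add_comm,
      ParkingLot.dist_add_dist_eq_of_angle_le (A := min x.angle y.angle - 4) (by linarith)
        (by linarith) (by linarith) (by linarith), add_comm]
  · have hx : x.foot.angle ≤ max x.angle y.angle := le_max_left _ _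
    have hy : y.foot.angle ≤ max x.angle y.angle := le_max_right _ _
    exact hne (ParkingLot.dist_add_dist_eq_of_angle_le (A := max x.angle y.angle) hx hy
      (by linarith) (by linarith))

end AttachRays

/-! ## Curtains meeting a ray -/

theorem exists_nat_div_two_mem_uIcc {v w : ℝ} (hv : 0 ≤ v) (hvw : 1 / 2 ≤ |w - v|) :
    ∃ m : ℕ, |(m : ℝ) / 2 - v| ≤ 1 / 2 ∧ (m : ℝ) / 2 ∈ uIcc v w := by
  have hv' : 0 ≤ 2 * v := by positivity
  rcases le_abs.1 hvw with hle | hle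
  · have h₁ := Nat.le_ceil (2 * v)
    have h₂ := Nat.ceil_lt_add_one hv'
    exact ⟨⌈2 * v⌉₊, abs_le.2 ⟨by linarith, by linarith⟩, mem_uIcc_of_le (by linarith)
      (by linarith)⟩
  · have h₁ := Nat.floor_le hv'
    have h₂ := Nat.lt_floor_add_one (2 * v)
    exact ⟨⌊2 * v⌋₊, abs_le.2 ⟨by linarith, by linarith⟩, mem_uIcc_of_ge (by linarith)
      (by linarith)⟩

namespace AttachRays

variable {X ι : Type*} {p : ι → X}

open Classical in
/-- Finitely many points of the `i`-th ray, one of which lies in each curtain that meets the ray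
at a height in `[a, b]`. -/
def rayMarks (p : ι → X) (i : ι) (a b : ℝ) : Finset (AttachRays p) :=
  (insert 0 (Finset.Icc ⌈2 * a - 1⌉₊ ⌊2 * b + 1⌋₊)).image fun m : ℕ => rayPoint p i ((m : ℝ) / 2)

theorem card_rayMarks_le (p : ι → X) (i : ι) {a b : ℝ} (hab : a ≤ b) (hb : 0 ≤ b) :
    ((rayMarks p i a b).card : ℝ) ≤ 2 * (b - a) + 4 := by
  classical
  have hcard : (rayMarks p i a b).card ≤ ⌊2 * b + 1⌋₊ + 1 - ⌈2 * a - 1⌉₊ + 1 :=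
    Finset.card_image_le.trans ((Finset.card_insert_le _ _).trans_eq (by rw [Nat.card_Icc]))
  have hle : ⌈2 * a - 1⌉₊ ≤ ⌊2 * b + 1⌋₊ + 1 :=
    Nat.ceil_le.2 (by push_cast; linarith [Nat.lt_floor_add_one (2 * b + 1)])
  have hcard' := (Nat.cast_le (α := ℝ)).2 hcard
  push_cast [Nat.cast_sub hle] at hcard'
  linarith [Nat.floor_le (by positivity : 0 ≤ 2 * b + 1), Nat.le_ceil (2 * a - 1)]

/-- The marks on the ray of `x`, if any, below `x`. -/
def heightMarks : AttachRays p → Finset (AttachRays p)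
  | base _ => ∅
  | ray i u _ => rayMarks p i 0 u

theorem card_heightMarks_le (x : AttachRays p) :
    ((heightMarks x).card : ℝ) ≤ 2 * x.height + 4 := by
  rcases x with x | ⟨i, u, hu⟩
  · simp [heightMarks, height]
  · exact (card_rayMarks_le p i hu.le hu.le).trans_eq (by rw [sub_zero]; rfl)

variable [MetricSpace X] {h : Set (AttachRays p)}

theorem rayPoint_rayCoord {i : ι} {u : AttachRays p} (hu : 0 ≤ rayCoord i u) :
    rayPoint p i (rayCoord i u) = u :=
  dist_eq_zero.1 (by rw [dist_rayPoint i hu, sub_self, abs_zero])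

theorem dist_sub_dist_of_rayHeight_le {i : ι} {x y u : AttachRays p}
    (hx : rayHeight i x ≤ rayCoord i u) (hy : rayHeight i y ≤ rayCoord i u) :
    dist x u - dist y u = rayCoord i y - rayCoord i x := by
  have hu : 0 ≤ rayCoord i u := (rayHeight_nonneg i x).trans hx
  rw [rayHeight_eq_max] at hx hy
  have hx' := (le_max_right _ _).trans hx
  have hy' := (le_max_right _ _).trans hy
  rw [← rayPoint_rayCoord hu, dist_comm x, dist_comm y, dist_rayPoint i hu, dist_rayPoint i hu,
    abs_of_nonneg (by linarith), abs_of_nonneg (by linarith), sub_sub_sub_cancel_left]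

theorem rayCoord_le_of_injOn {I : Set ℝ} {α : ℝ → AttachRays p} {r : ℝ}
    (hc : IsCurtainAt h I α r) {x y : AttachRays p}
    (hinj : InjOn (fun s => dist x (α s) - dist y (α s)) (Icc (r - 1 / 2) (r + 1 / 2)))
    {s : ℝ} (hs : s ∈ Icc (r - 1 / 2) (r + 1 / 2)) (i : ι) :
    rayCoord i (α s) ≤ max (rayHeight i x) (rayHeight i y) := by
  by_contra! hlt
  set M := max (rayHeight i x) (rayHeight i y)
  set ε := min (1 / 2) (rayCoord i (α s) - M)
  have hε : 0 < ε := lt_min one_half_pos (sub_pos.2 hlt)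
  have hε' : ε ≤ 1 / 2 := min_le_left _ _
  have hεM : ε ≤ rayCoord i (α s) - M := min_le_right _ _
  obtain ⟨s', hs', hss'⟩ : ∃ s' ∈ Icc (r - 1 / 2) (r + 1 / 2), |s - s'| = ε := by
    rcases le_total s r with hsr | hsr
    · exact ⟨s + ε, ⟨by linarith [hs.1], by linarith⟩,
        by rw [sub_add_cancel_left, abs_neg, abs_of_pos hε]⟩
    · exact ⟨s - ε, ⟨by linarith, by linarith [hs.2]⟩, by rw [sub_sub_cancel, abs_of_pos hε]⟩
  have hnear := (le_abs_self _).trans (abs_rayCoord_sub_le i (α s) (α s'))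
  rw [hc.1.2.2 s (hc.Icc_subset hs) s' (hc.Icc_subset hs'), hss'] at hnear
  have hconst {t : ℝ} (ht : M ≤ rayCoord i (α t)) :
      dist x (α t) - dist y (α t) = rayCoord i y - rayCoord i x :=
    dist_sub_dist_of_rayHeight_le ((le_max_left _ _).trans ht) ((le_max_right _ _).trans ht)
  have heq : s = s' := hinj hs hs' ((hconst hlt.le).trans (hconst (by linarith)).symm)
  rw [heq, sub_self, abs_zero] at hss'
  exact hε.ne hss'

/-- The difference of the distances to two points of a ray takes only two values away from the
segment between them, so it is not injective there. -/
theorem exists_rayCoord_mem_Icc (i : ι) {u v : ℝ} (hu : 0 ≤ u) (huv : u ≤ v) {J : Set ℝ}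
    (hJ : J.Infinite) {α : ℝ → AttachRays p}
    (hinj : InjOn (fun s => dist (rayPoint p i u) (α s) - dist (rayPoint p i v) (α s)) J) :
    ∃ s ∈ J, rayCoord i (α s) ∈ Icc u v := by
  by_contra! hout
  refine (hJ.image hinj) ((toFinite {u - v, v - u}).subset ?_)
  rintro _ ⟨s, hs, rfl⟩
  simp only [dist_rayPoint i hu, dist_rayPoint i (hu.trans huv), mem_insert_iff,
    mem_singleton_iff]
  rcases le_or_gt u (rayCoord i (α s)) with hle | hlt
  · have hlt : v < rayCoord i (α s) := not_le.1 fun hle' => hout s hs ⟨hle, hle'⟩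
    rw [abs_of_nonpos (by linarith), abs_of_nonpos (by linarith)]
    exact Or.inr (by ring)
  · rw [abs_of_nonneg (by linarith), abs_of_nonneg (by linarith)]
    exact Or.inl (by ring)

theorem rayPoint_mem_of_mem_Icc (hW : BruhatTits (AttachRays p)) (hc : IsCurtain h) {i : ι}
    {s t w : ℝ} (hs : 0 ≤ s) (hsh : rayPoint p i s ∈ h) (hth : rayPoint p i t ∈ h)
    (hw : w ∈ Icc s t) : rayPoint p i w ∈ h := by
  rcases hw.2.eq_or_lt with rfl | hwt
  · exact hth
  have hw₀ := hs.trans hw.1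
  exact rayPoint_mem_of_isCurtain hW hc hw₀ hsh ((rayHeight_rayPoint i hs).trans_le hw.1) hth
    (hwt.trans_eq (rayHeight_rayPoint i (hw₀.trans hwt.le)).symm)

theorem exists_rayPoint_mem_of_le (hW : BruhatTits (AttachRays p)) (hc : IsCurtain h) {i : ι}
    {v : ℝ} (hv : 0 ≤ v) (hvh : rayPoint p i v ∈ h) :
    rayPoint p i 0 ∈ h ∨ ∃ w, 0 ≤ w ∧ rayPoint p i w ∈ h ∧ 1 / 2 ≤ |w - v| := by
  refine or_iff_not_imp_left.2 fun h0 => ?_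
  have hpos : ∀ u ∈ h, 0 ≤ rayCoord i u := fun u hu => by
    by_contra! hneg
    refine h0 ?_
    rcases hv.eq_or_lt with rfl | hv'
    · exact hvh
    · exact rayPoint_mem_of_isCurtain hW hc le_rfl hu
        (by rw [rayHeight_eq_max, max_eq_left hneg.le]) hvh (by rwa [rayHeight_rayPoint i hv])
  obtain ⟨I, α, r, hcα⟩ := hc
  have hr₁ : r - 1 / 2 ∈ Icc (r - 1 / 2) (r + 1 / 2) := ⟨le_rfl, by linarith⟩
  have hr₂ : r + 1 / 2 ∈ Icc (r - 1 / 2) (r + 1 / 2) := ⟨by linarith, le_rfl⟩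
  set u := α (r - 1 / 2)
  set u' := α (r + 1 / 2)
  have hu := hcα.apply_mem hr₁
  have hu' := hcα.apply_mem hr₂
  have hdist : |rayCoord i u - rayCoord i u'| = 1 := by
    rw [← dist_rayPoint i (hpos u hu), rayPoint_rayCoord (hpos u hu),
      hcα.1.2.2 _ (hcα.Icc_subset hr₁) _ (hcα.Icc_subset hr₂), abs_sub_comm,
      add_sub_sub_cancel, add_halves, abs_one]
  rcases le_or_gt (1 / 2) |rayCoord i u - v| with hle | hlt
  · exact ⟨_, hpos u hu, by rwa [rayPoint_rayCoord (hpos u hu)], hle⟩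
  · refine ⟨_, hpos u' hu', by rwa [rayPoint_rayCoord (hpos u' hu')], ?_⟩
    have htri := abs_sub_le (rayCoord i u) v (rayCoord i u')
    rw [abs_sub_comm v] at htri
    linarith

theorem exists_nat_div_two_mem (hW : BruhatTits (AttachRays p)) (hc : IsCurtain h) {i : ι}
    {v : ℝ} (hv : 0 ≤ v) (hvh : rayPoint p i v ∈ h) :
    rayPoint p i 0 ∈ h ∨
      ∃ m : ℕ, |(m : ℝ) / 2 - v| ≤ 1 / 2 ∧ rayPoint p i ((m : ℝ) / 2) ∈ h := by
  refine (exists_rayPoint_mem_of_le hW hc hv hvh).imp_right fun ⟨w, hw, hwh, hvw⟩ => ?_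
  obtain ⟨m, hm, hmem⟩ := exists_nat_div_two_mem_uIcc hv hvw
  refine ⟨m, hm, ?_⟩
  rcases mem_uIcc.1 hmem with hmem | hmem
  · exact rayPoint_mem_of_mem_Icc hW hc hv hvh hwh hmem
  · exact rayPoint_mem_of_mem_Icc hW hc hw hwh hvh hmem

theorem exists_mem_rayMarks (hW : BruhatTits (AttachRays p)) (hc : IsCurtain h) {i : ι}
    {a b v : ℝ} (hv : 0 ≤ v) (hav : a ≤ v) (hvb : v ≤ b) (hvh : rayPoint p i v ∈ h) :
    ∃ z ∈ rayMarks p i a b, z ∈ h := by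
  simp only [rayMarks, Finset.exists_mem_image, Finset.exists_mem_insert, Nat.cast_zero, zero_div]
  refine (exists_nat_div_two_mem hW hc hv hvh).imp_right fun ⟨m, hm, hmh⟩ => ⟨m, ?_, hmh⟩
  have hm' := abs_le.1 hm
  exact Finset.mem_Icc.2 ⟨Nat.ceil_le.2 (by linarith), Nat.le_floor (by linarith)⟩

theorem exists_mem_heightMarks (hW : BruhatTits (AttachRays p)) (hc : IsCurtain h) {i : ι}
    {w : ℝ} (hw : 0 < w) (hwh : rayPoint p i w ∈ h) {x : AttachRays p} (hx : w ≤ rayHeight i x) :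
    ∃ z ∈ heightMarks x, z ∈ h := by
  obtain ⟨u, hu, rfl⟩ : OnRay i x := by
    by_contra hno
    rw [rayHeight_of_not_onRay hno] at hx
    exact hw.not_ge hx
  rw [rayHeight_of_onRay (onRay_ray i u hu)] at hx
  exact exists_mem_rayMarks hW hc hw.le hw.le hx hwh

end AttachRays

/-! ## Bounds on `L`-chains -/

theorem card_Icc_ceil_floor_le {a b : ℝ} (hab : a ≤ b) :
    ((Finset.Icc ⌈a⌉ ⌊b⌋).card : ℝ) ≤ b - a + 1 := by
  have hle : ⌈a⌉ ≤ ⌊b⌋ + 1 :=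
    Int.ceil_le.2 (by push_cast; exact hab.trans (Int.lt_floor_add_one b).le)
  have hcard : ((Finset.Icc ⌈a⌉ ⌊b⌋).card : ℝ) = ⌊b⌋ + 1 - ⌈a⌉ := by
    rw [← Int.cast_natCast, Int.card_Icc_of_le _ _ hle]
    push_cast
    rfl
  linarith [Int.floor_le b, Int.le_ceil a]

namespace AttachRays

variable {ι : Type*} {p : ι → ParkingLot}

theorem card_le_of_isLChain {L n : ℕ} {c : Fin n → Set (AttachRays p)} (hc : IsLChain L c)
    (S : Finset (AttachRays p)) (E : Finset ℤ)
    (h : ∀ a, (∃ z ∈ S, z ∈ c a) ∨ ∃ k ∈ E, HasEnd (c a) k) : n ≤ S.card + E.card := by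
  rw [← Finset.card_disjSum, ← Finset.card_fin n]
  refine Finset.card_le_card_of_forall_subsingleton
    (fun a => Sum.elim (fun z => z ∈ c a) fun k : ℤ => HasEnd (c a) k) (fun a _ => ?_) ?_
  · simpa [Finset.mem_disjSum] using h a
  · rintro (z | k) - a ⟨-, ha⟩ b ⟨-, hb⟩ <;> by_contra! hne
    · exact disjoint_left.1 (hc.1.2.1 a b hne) ha hb
    · exact HasEnd.not_lSeparated ha hb L (hc.2 a b hne)

/-- If the core geodesic of the curtain passes through a ray, the curtain meets this ray below `x`
or `y`. Otherwise it stays in the parking lot, and the curtain has an end near its angle. -/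
theorem exists_mark_or_hasEnd {h : Set (AttachRays p)} (hc : IsCurtain h) {x y : AttachRays p}
    (hs : Separates h {x} {y}) :
    (∃ z, (z ∈ heightMarks x ∨ z ∈ heightMarks y) ∧ z ∈ h) ∨
      ∃ k ∈ Finset.Icc ⌈min x.angle y.angle - 8⌉ ⌊max x.angle y.angle + 8⌋, HasEnd h k := by
  obtain ⟨I, α, r, hcα, hinj⟩ := hs.exists_injOn (bruhatTits_parkingLot p)
  by_cases hray : ∃ s ∈ Icc (r - 1 / 2) (r + 1 / 2), ∃ i, 0 < rayCoord i (α s)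
  · obtain ⟨s, hs, i, hpos⟩ := hray
    have hmem : rayPoint p i (rayCoord i (α s)) ∈ h := by
      rw [rayPoint_rayCoord hpos.le]
      exact hcα.apply_mem hs
    rcases le_max_iff.1 (rayCoord_le_of_injOn hcα hinj hs i) with hle | hle
    · obtain ⟨z, hz, hzh⟩ := exists_mem_heightMarks (bruhatTits_parkingLot p) hc hpos hmem hle
      exact Or.inl ⟨z, Or.inl hz, hzh⟩
    · obtain ⟨z, hz, hzh⟩ := exists_mem_heightMarks (bruhatTits_parkingLot p) hc hpos hmem hle
      exact Or.inl ⟨z, Or.inr hz, hzh⟩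
  · have hβ : ∀ s ∈ Icc (r - 1 / 2) (r + 1 / 2), α s = base (α s).foot := fun s hs => by
      rcases hα : α s with z | ⟨i, w, hw⟩
      · rfl
      · refine (hray ⟨s, hs, i, ?_⟩).elim
        rw [hα, rayCoord_of_onRay (onRay_ray i w hw)]
        exact hw
    obtain ⟨k, hk, hkr⟩ := exists_hasEnd hcα hβ
    have hangle := angle_mem_of_injOn hcα hinj hβ
    have hkr' := abs_le.1 hkr
    exact Or.inr ⟨k, Finset.mem_Icc.2 ⟨Int.ceil_le.2 (by linarith [hangle.1]),
      Int.le_floor.2 (by linarith [hangle.2])⟩, hk⟩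

theorem chainBound (L : ℕ) (x y : AttachRays p) :
    ChainBound L x y (2 * x.height + 2 * y.height + |x.angle - y.angle| + 25) := by
  classical
  intro n c hc hs
  have hn := card_le_of_isLChain hc (heightMarks x ∪ heightMarks y)
    (Finset.Icc ⌈min x.angle y.angle - 8⌉ ⌊max x.angle y.angle + 8⌋) fun a => by
      simpa only [Finset.mem_union] using exists_mark_or_hasEnd (hc.1.1 a) (hs a)
  have hn' : (n : ℝ) ≤ (heightMarks x).card + (heightMarks y).card
      + (Finset.Icc ⌈min x.angle y.angle - 8⌉ ⌊max x.angle y.angle + 8⌋).card := by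
    exact_mod_cast hn.trans (Nat.add_le_add_right (Finset.card_union_le _ _) _)
  have hends := card_Icc_ceil_floor_le
    (show min x.angle y.angle - 8 ≤ max x.angle y.angle + 8 by
      linarith [min_le_max (a := x.angle) (b := y.angle)])
  have habs := max_sub_min_eq_abs' x.angle y.angle
  linarith [card_heightMarks_le x, card_heightMarks_le y]

theorem chainBound_rayPoint (L : ℕ) (i : ι) {u v : ℝ} (hu : 0 ≤ u) (huv : u ≤ v) :
    ChainBound L (rayPoint p i u) (rayPoint p i v) (2 * (v - u) + 4) := by
  intro n c hc hs
  have hn := card_le_of_isLChain hc (rayMarks p i u v) ∅ fun a => Or.inl ?_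
  · rw [Finset.card_empty, add_zero] at hn
    exact (Nat.cast_le.2 hn).trans (card_rayMarks_le p i huv (hu.trans huv))
  obtain ⟨I, α, r, hcα, hinj⟩ := (hs a).exists_injOn (bruhatTits_parkingLot p)
  obtain ⟨s, hsI, hmem⟩ := exists_rayCoord_mem_Icc i hu huv (Icc_infinite (by linarith)) hinj
  refine exists_mem_rayMarks (bruhatTits_parkingLot p) (hc.1.1 a) (hu.trans hmem.1) hmem.1
    hmem.2 ?_
  rw [rayPoint_rayCoord (hu.trans hmem.1)]
  exact hcα.apply_mem hsI

end AttachRays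

/-! ## The curtain model of the parking lot with rays attached -/

namespace CurtainModel

variable {lam : ℕ+ → ℝ} {X : Type*} [MetricSpace X] {x y : CurtainModel lam X}

theorem point_surjective (lam : ℕ+ → ℝ) (X : Type*) :
    Function.Surjective (point : CurtainModel lam X → X) := fun x => ⟨⟨x⟩, rfl⟩

theorem summable_mul_dL (hlam : ∀ L, 0 ≤ lam L) (hsum : Summable lam) {B : ℝ}
    (hB : ∀ L : ℕ, dL L x.point y.point ≤ B) :
    Summable fun L : ℕ+ => lam L * dL (L : ℕ) x.point y.point :=
  (hsum.mul_right B).of_nonneg_of_le (fun L => mul_nonneg (hlam L) (dL_nonneg _ _ _))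
    fun L => mul_le_mul_of_nonneg_left (hB L) (hlam L)

theorem dist_le (hlam : ∀ L, 0 ≤ lam L) (hsum : Summable lam) {B : ℝ}
    (hB : ∀ L : ℕ, dL L x.point y.point ≤ B) : dist x y ≤ (∑' L, lam L) * B := by
  rw [← tsum_mul_right]
  exact (summable_mul_dL hlam hsum hB).tsum_le_tsum
    (fun L => mul_le_mul_of_nonneg_left (hB L) (hlam L)) (hsum.mul_right B)

theorem mul_dL_le_dist (hlam : ∀ L, 0 ≤ lam L) (hsum : Summable lam) {B : ℝ}
    (hB : ∀ L : ℕ, dL L x.point y.point ≤ B) (L : ℕ+) :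
    lam L * dL (L : ℕ) x.point y.point ≤ dist x y :=
  (summable_mul_dL hlam hsum hB).le_tsum L fun L _ => mul_nonneg (hlam L) (dL_nonneg _ _ _)

theorem isQIEmbedding_of_dL (hlam : ∀ L, 0 ≤ lam L) (hsum : Summable lam) {Y : Type*}
    [PseudoMetricSpace Y] {f : X → Y} {A B a : ℝ} (hA : 0 ≤ A) (hB : 0 ≤ B) (ha : 0 ≤ a)
    (hupper : ∀ (L : ℕ) (x y : X), dL L x y ≤ A * dist (f x) (f y) + B) {L₀ : ℕ+}
    (hL₀ : 0 < lam L₀) (hlower : ∀ x y : X, dist (f x) (f y) ≤ a * dL L₀ x y) :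
    IsQIEmbedding fun x : CurtainModel lam X => f x.point := by
  have hS : 0 ≤ ∑' L, lam L := tsum_nonneg hlam
  have hSA : 0 ≤ (∑' L, lam L) * A := mul_nonneg hS hA
  have haL : 0 ≤ a / lam L₀ := div_nonneg ha hL₀.le
  refine ⟨1 + (∑' L, lam L) * A + a / lam L₀, (∑' L, lam L) * B, by linarith,
    mul_nonneg hS hB, fun x y => ?_⟩
  have hbound : ∀ L : ℕ, dL L x.point y.point ≤ A * dist (f x.point) (f y.point) + B :=
    fun L => hupper L _ _
  have hle : dist x y ≤ (∑' L, lam L) * A * dist (f x.point) (f y.point) + (∑' L, lam L) * B :=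
    (dist_le hlam hsum hbound).trans_eq (by ring)
  have hge : lam L₀ * dL L₀ x.point y.point ≤ dist x y := mul_dL_le_dist hlam hsum hbound L₀
  have hdist : 0 ≤ dist x y := (mul_nonneg hL₀.le (dL_nonneg _ _ _)).trans hge
  have hf : dist (f x.point) (f y.point) ≤ a / lam L₀ * dist x y := calc
    dist (f x.point) (f y.point) ≤ a * dL L₀ x.point y.point := hlower _ _
    _ = a / lam L₀ * (lam L₀ * dL L₀ x.point y.point) := by field_simp
    _ ≤ a / lam L₀ * dist x y := by gcongr
  have hterm : 0 ≤ (1 + a / lam L₀) * dist (f x.point) (f y.point) := by positivity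
  have hterm' : 0 ≤ (1 + (∑' L, lam L) * A) * dist x y := by positivity
  have hterm'' : 0 ≤ (∑' L, lam L) * B := mul_nonneg hS hB
  exact ⟨by linarith, by linarith⟩

end CurtainModel

theorem IsWeight.summable {lam : ℕ+ → ℝ} (h : IsWeight lam) : Summable lam := by
  refine h.2.1.of_nonneg_of_le (fun L => (h.1 L).1.le) fun L => ?_
  exact le_mul_of_one_le_left (h.1 L).1.le (one_le_pow₀ (Nat.one_le_cast.2 L.pos))

namespace AttachRays

variable {ι : Type*} {p : ι → ParkingLot}

/-- The collapse of the parking lot to the line of angles, with the rays kept attached. -/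
def collapse (p : ι → ParkingLot) : AttachRays p → AttachRays fun i => (p i).angle :=
  map p (fun i => (p i).angle) ParkingLot.angle id

theorem collapse_surjective (p : ι → ParkingLot) : Function.Surjective (collapse p) :=
  map_surjective (fun t => ⟨ParkingLot.circlePoint t, rfl⟩) Function.surjective_id

theorem dist_collapse_of_onSameRay {u v : AttachRays p} (h : OnSameRay u v) :
    dist (collapse p u) (collapse p v) = dist u v := dist_map_of_onSameRay h

theorem dist_collapse_of_not_onSameRay {u v : AttachRays p} (h : ¬ OnSameRay u v) :
    dist (collapse p u) (collapse p v) = u.height + |u.angle - v.angle| + v.height :=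
  dist_map_of_not_onSameRay (q := fun i => (p i).angle) (f := ParkingLot.angle) (σ := id)
    (fun _ => rfl) Function.injective_id h

theorem dL_le_dist_collapse (L : ℕ) (u v : AttachRays p) :
    dL L u v ≤ 2 * dist (collapse p u) (collapse p v) + 26 := by
  by_cases h : OnSameRay u v
  · rw [dist_collapse_of_onSameRay h]
    obtain ⟨i, ⟨s, hs, rfl⟩, ⟨t, ht, rfl⟩⟩ := h
    wlog hst : s ≤ t generalizing s t
    · rw [dL_comm, dist_comm]
      exact this t ht s hs (le_of_not_ge hst)
    have hle := (chainBound_rayPoint (p := p) L i hs.le hst).dL_le (by linarith)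
    rw [rayPoint_of_pos i hs, rayPoint_of_pos i ht] at hle
    rw [dist_ray_same, abs_sub_comm, abs_of_nonneg (sub_nonneg.2 hst)]
    linarith
  · rw [dist_collapse_of_not_onSameRay h]
    have hangle := abs_nonneg (u.angle - v.angle)
    have hle := (chainBound L u v).dL_le
      (by linarith [u.height_nonneg, v.height_nonneg])
    linarith

theorem abs_angle_sub_le_dL {L : ℕ} (hL : 2 ≤ L) (u v : AttachRays p) :
    |u.angle - v.angle| ≤ 20 * dL L u v := by
  have huv := angle_sub_le_dL hL (chainBound L u v)
  have hvu := angle_sub_le_dL hL (chainBound L v u)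
  rw [dL_comm] at hvu
  exact abs_le.2 ⟨by linarith, by linarith⟩

theorem abs_rayHeight_sub_le_dL {L : ℕ} (hL : 1 ≤ L) (i : ι) (u v : AttachRays p) :
    |rayHeight i u - rayHeight i v| ≤ 2 * dL L u v := by
  have huv := rayHeight_sub_le_dL (bruhatTits_parkingLot p) i hL (chainBound L u v)
  have hvu := rayHeight_sub_le_dL (bruhatTits_parkingLot p) i hL (chainBound L v u)
  rw [dL_comm] at hvu
  exact abs_le.2 ⟨by linarith, by linarith⟩

theorem height_le_dL {L : ℕ} (hL : 1 ≤ L) {u v : AttachRays p} (h : ¬ OnSameRay u v) :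
    u.height ≤ 2 * dL L u v := by
  rcases u with x | ⟨i, s, hs⟩
  · exact mul_nonneg zero_le_two (dL_nonneg _ _ _)
  · have hray := abs_rayHeight_sub_le_dL hL i (ray i s hs) v
    rw [rayHeight_of_onRay (onRay_ray i s hs),
      rayHeight_of_not_onRay fun hv => h ⟨i, onRay_ray i s hs, hv⟩, sub_zero] at hray
    exact (le_abs_self _).trans hray

theorem dist_collapse_le_dL {L : ℕ} (hL : 2 ≤ L) (u v : AttachRays p) :
    dist (collapse p u) (collapse p v) ≤ 24 * dL L u v := by
  have hL1 : 1 ≤ L := one_le_two.trans hL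
  by_cases h : OnSameRay u v
  · rw [dist_collapse_of_onSameRay h]
    obtain ⟨i, hu, hv⟩ := h
    have hray := abs_rayHeight_sub_le_dL hL1 i u v
    rw [rayHeight_of_onRay hu, rayHeight_of_onRay hv] at hray
    rw [dist_eq_abs_rayCoord_sub hu, rayCoord_of_onRay hu, rayCoord_of_onRay hv]
    linarith [dL_nonneg L u v]
  · rw [dist_collapse_of_not_onSameRay h]
    have hv := height_le_dL hL1 (u := v) (v := u) fun ⟨i, hv, hu⟩ => h ⟨i, hu, hv⟩
    rw [dL_comm] at hv
    linarith [height_le_dL hL1 h, abs_angle_sub_le_dL hL u v]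

theorem isQIEmbedding_collapse {lam : ℕ+ → ℝ} (hlam : ∀ L, 0 ≤ lam L) (hsum : Summable lam)
    {L₀ : ℕ+} (hL₀ : 2 ≤ L₀) (hpos : 0 < lam L₀) (p : ι → ParkingLot) :
    IsQIEmbedding fun u : CurtainModel lam (AttachRays p) => collapse p u.point :=
  CurtainModel.isQIEmbedding_of_dL hlam hsum (by norm_num) (by norm_num) (by norm_num)
    dL_le_dist_collapse hpos (dist_collapse_le_dL (by exact_mod_cast hL₀))

end AttachRays

/-! ## The curtain models as trees -/

open AttachRays

/-- The isometry which shifts the line by one, so that the branch points become positive. -/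
def shiftLine : AttachRays (fun i : ℕ => (i : ℝ)) → LineWithRays :=
  AttachRays.map _ _ (· + 1) Nat.succPNat

theorem shiftLine_surjective : Function.Surjective shiftLine :=
  map_surjective (fun t => ⟨t - 1, by ring⟩) Equiv.pnatEquivNat.symm.surjective

theorem isQIEmbedding_shiftLine : IsQIEmbedding shiftLine := by
  have hp : ∀ i : ℕ, (i : ℝ) + 1 = (i.succPNat : ℕ+) := fun i => by simp
  have hiso : Isometry fun t : ℝ => t + 1 := isometry_add_right 1
  exact isQIEmbedding_of_lipschitz
    (lipschitzWith_map hp Nat.succPNat_injective le_rfl hiso.lipschitz)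
    (antilipschitzWith_map hp Nat.succPNat_injective le_rfl hiso.antilipschitz)

/-- The isometry which cuts the line into two rays, which become the rays `0` and `1`. -/
def cutLine : AttachRays (fun _ : ℕ => (0 : ℝ)) → WedgeOfRays
  | base t => if 0 ≤ t then rayPoint _ 0 t else rayPoint _ 1 (-t)
  | ray i s hs => ray (i + 2) s hs

theorem cutLine_surjective : Function.Surjective cutLine := by
  rintro (t | ⟨n, s, hs⟩)
  · exact ⟨base 0, by simp [cutLine, rayPoint_zero]⟩
  · match n with
    | 0 => exact ⟨base s, by simp [cutLine, hs.le, rayPoint_of_pos _ hs]⟩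
    | 1 => exact ⟨base (-s), by simp [cutLine, hs, rayPoint_of_pos _ hs]⟩
    | n + 2 => exact ⟨ray n s hs, rfl⟩

theorem dist_cutLine_base_ray (x : ℝ) (j : ℕ) (t : ℝ) (ht : 0 < t) :
    dist (cutLine (base x)) (cutLine (ray j t ht)) = |x| + t := by
  simp only [cutLine]
  rw [← rayPoint_of_pos (j + 2) ht]
  split_ifs with hx
  · rw [dist_rayPoint_rayPoint_of_ne (by omega) hx ht.le, dist_self, add_zero, abs_of_nonneg hx]
  · rw [dist_rayPoint_rayPoint_of_ne (by omega) (by linarith) ht.le, dist_self, add_zero,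
      abs_of_neg (by linarith)]

theorem dist_cutLine_base_base (x y : ℝ) :
    dist (cutLine (base x)) (cutLine (base y)) = |x - y| := by
  simp only [cutLine]
  split_ifs with hx hy hy
  · rw [dist_rayPoint_rayPoint 0 hx hy]
  · rw [dist_rayPoint_rayPoint_of_ne zero_ne_one hx (by linarith), dist_self, add_zero,
      abs_of_nonneg (by linarith), sub_eq_add_neg]
  · rw [dist_rayPoint_rayPoint_of_ne one_ne_zero (by linarith) hy, dist_self, add_zero,
      abs_of_neg (by linarith)]
    ring
  · rw [dist_rayPoint_rayPoint 1 (by linarith) (by linarith), abs_sub_comm, neg_sub_neg,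
      abs_sub_comm]

theorem isometry_cutLine : Isometry cutLine := by
  refine Isometry.of_dist_eq ?_
  rintro (x | ⟨i, s, hs⟩) (y | ⟨j, t, ht⟩)
  · exact dist_cutLine_base_base x y
  · rw [dist_cutLine_base_ray, dist_base_ray, Real.dist_eq, sub_zero]
  · rw [dist_comm, dist_comm (ray i s hs), dist_cutLine_base_ray, dist_base_ray, Real.dist_eq,
      sub_zero]
  · simp only [cutLine]
    rcases eq_or_ne i j with rfl | hij
    · rw [dist_ray_same, dist_ray_same]
    · rw [dist_ray_ray hij, dist_ray_ray (by omega), dist_self, dist_self]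

theorem isQIEmbedding_shiftLine_collapse {lam : ℕ+ → ℝ} (hlam : ∀ L, 0 ≤ lam L)
    (hsum : Summable lam) {L₀ : ℕ+} (hL₀ : 2 ≤ L₀) (hpos : 0 < lam L₀) :
    IsQIEmbedding fun u : CurtainModel lam SpaceW => shiftLine (collapse _ u.point) :=
  isQIEmbedding_shiftLine.comp (isQIEmbedding_collapse hlam hsum hL₀ hpos _)

theorem isQIEmbedding_cutLine_collapse {lam : ℕ+ → ℝ} (hlam : ∀ L, 0 ≤ lam L)
    (hsum : Summable lam) {L₀ : ℕ+} (hL₀ : 2 ≤ L₀) (hpos : 0 < lam L₀) :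
    IsQIEmbedding fun u : CurtainModel lam SpaceZ => cutLine (collapse _ u.point) :=
  (isQIEmbedding_of_lipschitz isometry_cutLine.lipschitz isometry_cutLine.antilipschitz).comp
    (isQIEmbedding_collapse hlam hsum hL₀ hpos _)

theorem quasiIsometric_curtainModel_spaceW {lam : ℕ+ → ℝ} (hlam : ∀ L, 0 ≤ lam L)
    (hsum : Summable lam) {L₀ : ℕ+} (hL₀ : 2 ≤ L₀) (hpos : 0 < lam L₀) :
    QuasiIsometric (CurtainModel lam SpaceW) LineWithRays :=
  ⟨_, (isQIEmbedding_shiftLine_collapse hlam hsum hL₀ hpos).isQuasiIsometry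
    (shiftLine_surjective.comp
      ((collapse_surjective _).comp (CurtainModel.point_surjective lam SpaceW)))⟩

theorem quasiIsometric_curtainModel_spaceZ {lam : ℕ+ → ℝ} (hlam : ∀ L, 0 ≤ lam L)
    (hsum : Summable lam) {L₀ : ℕ+} (hL₀ : 2 ≤ L₀) (hpos : 0 < lam L₀) :
    QuasiIsometric (CurtainModel lam SpaceZ) WedgeOfRays :=
  ⟨_, (isQIEmbedding_cutLine_collapse hlam hsum hL₀ hpos).isQuasiIsometry
    (cutLine_surjective.comp
      ((collapse_surjective _).comp (CurtainModel.point_surjective lam SpaceZ)))⟩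

/-! ## The line with rays does not embed in the wedge -/

theorem exists_mem_Ico_of_le_add {u : ℕ → ℝ} {R J : ℝ} (h0 : u 0 < R)
    (hJ : ∀ k, u (k + 1) ≤ u k + J) (hR : ∃ k, R ≤ u k) : ∃ k, u k ∈ Ico R (R + J) := by
  classical
  obtain ⟨m, hm⟩ := Nat.exists_eq_succ_of_ne_zero
    (fun h => h0.not_ge (h ▸ Nat.find_spec hR) : Nat.find hR ≠ 0)
  have hlt : u m < R := not_le.1 (Nat.find_min hR (by omega))
  exact ⟨m + 1, by simpa only [hm] using Nat.find_spec hR, by linarith [hJ m]⟩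

theorem exists_ne_abs_sub_le {ι : Type*} [Fintype ι] (hι : 2 < Fintype.card ι) {v : ι → ℝ}
    {R J : ℝ} (hv : ∀ a, |v a| ∈ Ico R (R + J)) : ∃ a b, a ≠ b ∧ |v a - v b| ≤ J := by
  obtain ⟨a, b, hab, hside⟩ := Fintype.exists_ne_map_eq_of_card_lt (fun a => decide (0 ≤ v a))
    (by simpa using hι)
  refine ⟨a, b, hab, abs_le.2 ?_⟩
  have ha := hv a
  have hb := hv b
  rcases le_or_gt 0 (v a) with h | h
  · have h' : 0 ≤ v b := by simpa [h] using hside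
    rw [abs_of_nonneg h] at ha
    rw [abs_of_nonneg h'] at hb
    constructor <;> linarith [ha.1, ha.2, hb.1, hb.2]
  · have h' : v b < 0 := by simpa [h.not_ge] using hside
    rw [abs_of_neg h] at ha
    rw [abs_of_neg h'] at hb
    constructor <;> linarith [ha.1, ha.2, hb.1, hb.2]

/-- Three sequences of points running at unit speed along the legs of an infinite tripod. -/
def IsTripod {X : Type*} [Dist X] (leg : Fin 3 → ℕ → X) : Prop :=
  ∀ a b k l, dist (leg a k) (leg b l) = if a = b then |(k : ℝ) - l| else k + l

theorem IsTripod.apply_zero {X : Type*} [MetricSpace X] {leg : Fin 3 → ℕ → X} (h : IsTripod leg)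
    (a : Fin 3) : leg a 0 = leg 0 0 :=
  dist_eq_zero.1 (by simp [h a 0 0 0])

theorem IsTripod.dist_apply_zero {X : Type*} [MetricSpace X] {leg : Fin 3 → ℕ → X}
    (h : IsTripod leg) (a : Fin 3) (k : ℕ) : dist (leg 0 0) (leg a k) = k := by
  rw [← h.apply_zero a, h, if_pos rfl, Nat.cast_zero, zero_sub, abs_neg, Nat.abs_cast]

section Tripod

variable {X Y ι : Type*} [MetricSpace X] [MetricSpace Y] {p : ι → Y} {f : X → AttachRays p}
  {K C : ℝ} {leg : Fin 3 → ℕ → X}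

theorem IsTripod.exists_exit (hleg : IsTripod leg)
    (hf : ∀ x x', dist (f x) (f x') ≤ K * dist x x' + C ∧ dist x x' ≤ K * dist (f x) (f x') + C)
    (hK : 0 ≤ K) {R : ℝ} (hR : 0 < R) (a : Fin 3) :
    ∃ k : ℕ, dist (f (leg 0 0)) (f (leg a k)) ∈ Ico R (R + (K + C)) := by
  refine exists_mem_Ico_of_le_add (by rwa [hleg.apply_zero a, dist_self]) (fun k => ?_) ?_
  · refine (dist_triangle _ (f (leg a k)) _).trans ((add_le_add_iff_left _).2 ?_)
    simpa [hleg a a] using (hf (leg a k) (leg a (k + 1))).1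
  · obtain ⟨k, hk⟩ := exists_nat_gt (K * R + C)
    refine ⟨k, le_of_not_gt fun hlt => ?_⟩
    have hle := (hf (leg 0 0) (leg a k)).2
    rw [hleg.dist_apply_zero] at hle
    linarith [mul_le_mul_of_nonneg_left hlt.le hK]

/-- On a single ray there are only two directions, so two of the three legs would have to leave a
long ray on the same side and stay close to each other. -/
theorem IsTripod.height_lt (hleg : IsTripod leg)
    (hf : ∀ x x', dist (f x) (f x') ≤ K * dist x x' + C ∧ dist x x' ≤ K * dist (f x) (f x') + C)
    (hK : 1 ≤ K) (hC : 0 ≤ C) :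
    (f (leg 0 0)).height < C + K * (K * (K + C) + C + 1) + (K + C) := by
  by_contra! hH
  set R := C + K * (K * (K + C) + C + 1)
  have hK0 : 0 < K := by linarith
  have hR : 0 < R := by positivity
  obtain ⟨i, hi⟩ := exists_onRay_of_height_pos (u := f (leg 0 0)) (by linarith)
  choose k hk using hleg.exists_exit hf hK0.le hR
  have far : ∀ a, K * (K + C) + C + 1 ≤ k a := fun a => by
    have hle := (hf (leg 0 0) (leg a (k a))).1
    rw [hleg.dist_apply_zero] at hle
    exact le_of_mul_le_mul_left (by linarith [(hk a).1]) hK0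
  have hdist : ∀ a, dist (f (leg 0 0)) (f (leg a (k a)))
      = |(f (leg 0 0)).height - rayCoord i (f (leg a (k a)))| := fun a => by
    rw [dist_eq_abs_rayCoord_sub hi, rayCoord_of_onRay hi]
  obtain ⟨a, b, hab, hclose⟩ := exists_ne_abs_sub_le (by simp) fun a => hdist a ▸ hk a
  have ha : OnRay i (f (leg a (k a))) := onRay_of_rayCoord_pos (by
    have := (abs_lt.1 ((hdist a).symm.trans_lt (hk a).2)).2
    linarith)
  have hle := (hf (leg a (k a)) (leg b (k b))).2
  rw [hleg, if_neg hab, dist_eq_abs_rayCoord_sub ha, ← sub_sub_sub_cancel_left, abs_sub_comm] at hle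
  linarith [far a, far b, mul_le_mul_of_nonneg_left hclose hK0.le]

end Tripod

/-- The tripod formed by the two half-lines and the ray which issue from the branch point `n`. -/
def leg (n : ℕ+) : Fin 3 → ℕ → LineWithRays :=
  ![fun k => base (n - k), fun k => base (n + k), fun k => rayPoint _ n k]

theorem leg_zero (n : ℕ+) : leg n 0 0 = base (n : ℝ) := by simp [leg]

theorem isTripod_leg (n : ℕ+) : IsTripod (leg n) := by
  have hray : ∀ (x : ℝ) (k : ℕ), dist (base x : LineWithRays) (rayPoint _ n k) = |x - n| + k :=
    fun x k => by
      rcases k.eq_zero_or_pos with rfl | hk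
      · rw [Nat.cast_zero, rayPoint_zero, dist_base_base, Real.dist_eq, add_zero]
      · rw [rayPoint_of_pos _ (Nat.cast_pos.2 hk), dist_base_ray, Real.dist_eq]
  intro a b k l
  wlog hab : a ≤ b generalizing a b k l
  · rw [dist_comm, this b a l k (le_of_not_ge hab), abs_sub_comm, add_comm]
    simp only [eq_comm]
  have hk : (0 : ℝ) ≤ k := k.cast_nonneg
  have hl : (0 : ℝ) ≤ l := l.cast_nonneg
  match a, b, hab with
  | 0, 0, _ =>
    change dist (base _) (base _) = |(k : ℝ) - l|
    rw [dist_base_base, Real.dist_eq, sub_sub_sub_cancel_left, abs_sub_comm]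
  | 0, 1, _ =>
    change dist (base _) (base _) = (k : ℝ) + l
    rw [dist_base_base, Real.dist_eq, abs_of_nonpos (by linarith)]
    ring
  | 0, 2, _ =>
    change dist (base _) (rayPoint _ n l) = (k : ℝ) + l
    rw [hray, sub_sub_cancel_left, abs_neg, abs_of_nonneg hk]
  | 1, 1, _ =>
    change dist (base _) (base _) = |(k : ℝ) - l|
    rw [dist_base_base, Real.dist_eq, add_sub_add_left_eq_sub]
  | 1, 2, _ =>
    change dist (base _) (rayPoint _ n l) = (k : ℝ) + l
    rw [hray, add_sub_cancel_left, abs_of_nonneg hk]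
  | 2, 2, _ => exact dist_rayPoint_rayPoint n hk hl

theorem not_isQIEmbedding_lineWithRays_wedgeOfRays (F : LineWithRays → WedgeOfRays) :
    ¬ IsQIEmbedding F := by
  rintro ⟨K, C, hK, hC, hF⟩
  obtain ⟨B, hB⟩ : ∃ B, ∀ n : ℕ+, (F (base (n : ℝ))).height < B :=
    ⟨_, fun n => leg_zero n ▸ (isTripod_leg n).height_lt hF hK hC⟩
  obtain ⟨N, hN⟩ := exists_nat_gt (K * (2 * B) + C)
  have hdist : dist (F (base (N.succPNat : ℝ))) (F (base ((1 : ℕ+) : ℝ))) ≤ 2 * B :=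
    calc _ ≤ dist (F (base (N.succPNat : ℝ))) (base PUnit.unit)
          + dist (base PUnit.unit) (F (base ((1 : ℕ+) : ℝ))) := dist_triangle _ _ _
      _ = (F (base (N.succPNat : ℝ))).height + (F (base ((1 : ℕ+) : ℝ))).height := by
        rw [dist_comm, dist_base, dist_base, dist_self, zero_add, zero_add]
      _ ≤ 2 * B := by linarith [hB N.succPNat, hB 1]
  have hle := (hF (base (N.succPNat : ℝ)) (base ((1 : ℕ+) : ℝ))).2
  have hN' : dist (base (N.succPNat : ℝ) : LineWithRays) (base ((1 : ℕ+) : ℝ)) = N := by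
    rw [dist_base_base, Real.dist_eq, Nat.succPNat_coe, Nat.cast_succ, PNat.one_coe, Nat.cast_one,
      add_sub_cancel_right, Nat.abs_cast]
  linarith [mul_le_mul_of_nonneg_left hdist (zero_le_one.trans hK)]

theorem not_quasiIsometric_curtainModel_spaceW_spaceZ {lam : ℕ+ → ℝ} (hlam : ∀ L, 0 ≤ lam L)
    (hsum : Summable lam) {L₀ : ℕ+} (hL₀ : 2 ≤ L₀) (hpos : 0 < lam L₀) :
    ¬ QuasiIsometric (CurtainModel lam SpaceW) (CurtainModel lam SpaceZ) := by
  rintro ⟨g, hg⟩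
  have hs : Function.Surjective fun u : CurtainModel lam SpaceW => shiftLine (collapse _ u.point) :=
    shiftLine_surjective.comp
      ((collapse_surjective _).comp (CurtainModel.point_surjective lam SpaceW))
  exact not_isQIEmbedding_lineWithRays_wedgeOfRays _
    ((isQIEmbedding_cutLine_collapse hlam hsum hL₀ hpos).comp
      (hg.isQIEmbedding.comp
        ((isQIEmbedding_shiftLine_collapse hlam hsum hL₀ hpos).of_rightInverse
          (Function.rightInverse_surjInv hs))))

/-! ## The spiral map -/

theorem dist_le_mul_of_joinedByGeodesic {X Y : Type*} [MetricSpace X] [PseudoMetricSpace Y]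
    {f : X → Y} {K δ : ℝ} (hδ : 0 < δ)
    (hf : ∀ x y, dist x y ≤ δ → dist (f x) (f y) ≤ K * dist x y) {x y : X}
    (hxy : JoinedByGeodesic x y) : dist (f x) (f y) ≤ K * dist x y := by
  obtain ⟨c, c0, c1, hc⟩ := hxy
  obtain ⟨N, hN⟩ := exists_nat_gt (dist x y / δ)
  have hN0 : (0 : ℝ) < N := lt_of_le_of_lt (by positivity) hN
  rw [div_lt_iff₀ hδ] at hN
  have hstep : ∀ k < N, dist (f (c (k / N))) (f (c ((k + 1 : ℕ) / N))) ≤ K * (dist x y / N) := by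
    intro k hk
    have hk' : (k : ℝ) + 1 ≤ N := by exact_mod_cast hk
    have hdist : dist (c (k / N)) (c ((k + 1 : ℕ) / N)) = dist x y / N := by
      rw [hc _ ⟨by positivity, (div_le_one hN0).2 (by linarith)⟩ _
        ⟨by positivity, (div_le_one hN0).2 (by push_cast; linarith)⟩, ← sub_div, abs_div,
        abs_of_pos hN0, Nat.cast_succ, sub_add_cancel_left, abs_neg, abs_one, one_div_mul_eq_div]
    exact hdist ▸ hf _ _ (by rw [hdist, div_le_iff₀ hN0]; linarith)
  have hsum := dist_le_range_sum_of_dist_le (f := fun k : ℕ => f (c (k / N))) N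
    (d := fun _ => K * (dist x y / N)) (hstep _)
  simp only [Finset.sum_const, Finset.card_range, nsmul_eq_mul, Nat.cast_zero, zero_div,
    div_self hN0.ne', c0, c1] at hsum
  exact hsum.trans_eq (by field_simp)

namespace ParkingLot

theorem dist_le_radial_add_angular (x y : ParkingLot) :
    dist x y ≤ |x.radius - y.radius| + x.radius * |x.angle - y.angle| :=
  calc dist x y ≤ dist x ⟨y.angle, x.radius, x.one_le_radius⟩
        + dist ⟨y.angle, x.radius, x.one_le_radius⟩ y := dist_triangle _ _ _
    _ ≤ x.radius * |x.angle - y.angle| + |x.radius - y.radius| :=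
      add_le_add (dist_le_of_radius_eq (x := x) rfl)
        (dist_eq_of_angle_eq (x := ⟨y.angle, x.radius, x.one_le_radius⟩) (y := y) rfl).le
    _ = _ := add_comm _ _

theorem two_mul_radius_mul_abs_sin_half_le_dist {x y : ParkingLot} (hr : x.radius ≤ y.radius) :
    2 * x.radius * |Real.sin ((x.angle - y.angle) / 2)| ≤ dist x y := by
  refine le_trans ?_ (dist_toPlane_le x y)
  refine abs_le_of_sq_le_sq' ?_ dist_nonneg |>.2
  rw [sq_dist_toPlane, mul_pow, sq_abs]
  have hsq := mul_nonneg (mul_nonneg x.radius_pos.le (sub_nonneg.2 hr))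
    (sq_nonneg (Real.sin ((x.angle - y.angle) / 2)))
  linarith [sq_nonneg (x.radius - y.radius)]

theorem radius_mul_abs_angle_sub_le {x y : ParkingLot} (hr : x.radius ≤ y.radius)
    (h : dist x y ≤ Real.pi) : x.radius * |x.angle - y.angle| ≤ Real.pi / 2 * dist x y := by
  have hx := x.radius_pos
  have hangle : |(x.angle - y.angle) / 2| ≤ Real.pi / 2 := by
    rw [abs_div, abs_two]
    linarith [abs_angle_sub_le x y]
  calc x.radius * |x.angle - y.angle|
      = Real.pi / 2 * (2 * x.radius * (2 / Real.pi * |(x.angle - y.angle) / 2|)) := by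
        rw [abs_div, abs_two]
        field_simp
    _ ≤ Real.pi / 2 * (2 * x.radius * |Real.sin ((x.angle - y.angle) / 2)|) := by
        gcongr
        exact Real.mul_abs_le_abs_sin hangle
    _ ≤ _ := by
        gcongr
        exact two_mul_radius_mul_abs_sin_half_le_dist hr

theorem radius_mul_abs_log_sub_le {x y : ParkingLot} (hr : x.radius ≤ y.radius) :
    x.radius * |Real.log x.radius - Real.log y.radius| ≤ |x.radius - y.radius| := by
  have hx := x.radius_pos
  have hy := y.radius_pos
  rw [abs_sub_comm, abs_sub_comm x.radius, abs_of_nonneg (sub_nonneg.2 (Real.log_le_log hx hr)),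
    abs_of_nonneg (sub_nonneg.2 hr), ← Real.log_div hy.ne' hx.ne']
  calc x.radius * Real.log (y.radius / x.radius) ≤ x.radius * (y.radius / x.radius - 1) := by
        gcongr
        exact Real.log_le_sub_one_of_pos (div_pos hy hx)
    _ = y.radius - x.radius := by field_simp

/-- The map `(t, r) ↦ (t + a log r, r)`, of which the spiral map and its inverse are instances. -/
def shear (a : ℝ) (x : ParkingLot) : ParkingLot :=
  ⟨x.angle + a * Real.log x.radius, x.radius, x.one_le_radius⟩

theorem shear_shear_neg (a : ℝ) (x : ParkingLot) : shear a (shear (-a) x) = x :=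
  ParkingLot.ext (by simp [shear]) rfl

theorem shear_surjective (a : ℝ) : Function.Surjective (shear a) :=
  fun x => ⟨shear (-a) x, shear_shear_neg a x⟩

theorem dist_shear_le_of_dist_le_pi (a : ℝ) {x y : ParkingLot} (h : dist x y ≤ Real.pi) :
    dist (shear a x) (shear a y) ≤ (1 + |a| + Real.pi / 2) * dist x y := by
  wlog hr : x.radius ≤ y.radius generalizing x y
  · rw [dist_comm, dist_comm x]
    exact this (by rwa [dist_comm]) (le_of_not_ge hr)
  have hangle : |(shear a x).angle - (shear a y).angle|
      ≤ |x.angle - y.angle| + |a| * |Real.log x.radius - Real.log y.radius| := by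
    rw [← abs_mul, mul_sub]
    exact (congrArg _ (add_sub_add_comm _ _ _ _)).trans_le (abs_add_le _ _)
  calc dist (shear a x) (shear a y)
      ≤ |x.radius - y.radius| + x.radius * |(shear a x).angle - (shear a y).angle| :=
        dist_le_radial_add_angular _ _
    _ ≤ |x.radius - y.radius| + (x.radius * |x.angle - y.angle|
          + |a| * (x.radius * |Real.log x.radius - Real.log y.radius|)) := by
        rw [mul_left_comm, ← mul_add]
        gcongr
        exact x.radius_pos.le
    _ ≤ dist x y + (Real.pi / 2 * dist x y + |a| * dist x y) := by
        have hradial := abs_radius_sub_le x y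
        refine add_le_add hradial (add_le_add (radius_mul_abs_angle_sub_le hr h) ?_)
        exact mul_le_mul_of_nonneg_left ((radius_mul_abs_log_sub_le hr).trans hradial)
          (abs_nonneg a)
    _ = _ := by ring

theorem lipschitzWith_shear (a : ℝ) : LipschitzWith (1 + ‖a‖₊ + NNReal.pi / 2) (shear a) :=
  .of_dist_le_mul fun x y => dist_le_mul_of_joinedByGeodesic Real.pi_pos
    (fun _ _ h => dist_shear_le_of_dist_le_pi a h) (joinedByGeodesic x y)

theorem antilipschitzWith_shear (a : ℝ) :
    AntilipschitzWith (1 + ‖a‖₊ + NNReal.pi / 2) (shear a) :=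
  nnnorm_neg a ▸ (lipschitzWith_shear (-a)).to_rightInverse fun x => by
    simpa only [neg_neg] using shear_shear_neg (-a) x

theorem spiralMap_eq_shear : spiralMap = shear (-(Real.log 2)⁻¹) := by
  funext x
  refine ParkingLot.ext ?_ rfl
  simp only [spiralMap, shear, Real.logb, div_eq_inv_mul, neg_mul, sub_eq_add_neg]

end ParkingLot

open ParkingLot

theorem isQuasiIsometry_spiralMap : IsQuasiIsometry spiralMap :=
  spiralMap_eq_shear ▸ (isQIEmbedding_of_lipschitz (lipschitzWith_shear _)
    (antilipschitzWith_shear _)).isQuasiIsometry (shear_surjective _)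

theorem quasiIsometric_spaceW_spaceZ : QuasiIsometric SpaceW SpaceZ := by
  set a := -(Real.log 2)⁻¹ with ha
  have hK : 1 ≤ 1 + ‖a‖₊ + NNReal.pi / 2 := by rw [add_assoc]; exact le_self_add
  have hp : ∀ i : ℕ, shear a ⟨i, 2 ^ i, one_le_pow₀ one_le_two⟩
      = ⟨0, 2 ^ i, one_le_pow₀ one_le_two⟩ := fun i => by
    rw [ha, ← spiralMap_eq_shear]
    exact ParkingLot.ext (by simp [spiralMap, Real.logb_pow]) rfl
  exact ⟨_, (isQIEmbedding_of_lipschitz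
    (lipschitzWith_map hp Function.injective_id hK (lipschitzWith_shear a))
    (antilipschitzWith_map hp Function.injective_id hK (antilipschitzWith_shear a))).isQuasiIsometry
      (map_surjective (shear_surjective a) Function.surjective_id)⟩

/-! ## The spiral map on the curtain model -/

theorem isQIEmbedding_curtainModelMap_isometryEquiv (lam : ℕ+ → ℝ) {X Y : Type*} [MetricSpace X]
    [MetricSpace Y] (e : X ≃ᵢ Y) : IsQIEmbedding (curtainModelMap lam e) := by
  refine ⟨1, 0, le_rfl, le_rfl, fun x x' => ?_⟩
  have hdist : dist (curtainModelMap lam e x) (curtainModelMap lam e x') = dist x x' :=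
    tsum_congr fun L => congrArg _ (dL_isometryEquiv e L _ _)
  simp only [hdist, one_mul, add_zero, le_refl, and_self]

/-- The parking lot with no rays attached. -/
def noRays : ParkingLot ≃ᵢ AttachRays (Empty.elim : Empty → ParkingLot) where
  toFun := base
  invFun := foot
  left_inv _ := rfl
  right_inv
    | base _ => rfl
  isometry_toFun := Isometry.of_dist_eq fun _ _ => rfl

theorem isQIEmbedding_angle {lam : ℕ+ → ℝ} (hlam : ∀ L, 0 ≤ lam L) (hsum : Summable lam)
    {L₀ : ℕ+} (hL₀ : 2 ≤ L₀) (hpos : 0 < lam L₀) :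
    IsQIEmbedding fun x : CurtainModel lam ParkingLot => x.point.angle :=
  (isQIEmbedding_collapse hlam hsum hL₀ hpos Empty.elim).comp
    (isQIEmbedding_curtainModelMap_isometryEquiv lam noRays)

theorem not_isQIEmbedding_curtainModelMap_spiralMap {lam : ℕ+ → ℝ} (hlam : ∀ L, 0 ≤ lam L)
    (hsum : Summable lam) {L₀ : ℕ+} (hL₀ : 2 ≤ L₀) (hpos : 0 < lam L₀) :
    ¬ IsQIEmbedding (curtainModelMap lam spiralMap) := by
  intro hspiral
  have hangle := isQIEmbedding_angle hlam hsum hL₀ hpos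
  obtain ⟨K', C', hK', -, h'⟩ := hangle.comp hspiral
  obtain ⟨K, C, -, -, h⟩ := hangle
  obtain ⟨N, hN⟩ := exists_nat_gt (K' * C + C')
  let x : CurtainModel lam ParkingLot := ⟨circlePoint 0⟩
  let y : CurtainModel lam ParkingLot := ⟨⟨0, 2 ^ N, one_le_pow₀ one_le_two⟩⟩
  have hxy : dist x y ≤ C := by simpa [x, y, circlePoint] using (h x y).2
  have hN' : dist (curtainModelMap lam spiralMap x).point.angle
      (curtainModelMap lam spiralMap y).point.angle = N := by
    simp [curtainModelMap, spiralMap, x, y, circlePoint, Real.logb_pow, Real.dist_eq]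
  have hle := (h' x y).1
  simp only [Function.comp_apply, hN'] at hle
  linarith [mul_le_mul_of_nonneg_left hxy (zero_le_one.trans hK')]

theorem theorem1_general {lam : ℕ+ → ℝ} (hlam : ∀ L, 0 ≤ lam L) (hsum : Summable lam) {L₀ : ℕ+}
    (hL₀ : 2 ≤ L₀) (hpos : 0 < lam L₀) :
    (IsCAT0 ParkingLot ∧ IsQuasiIsometry spiralMap ∧
      ¬ IsQuasiIsometry (curtainModelMap lam spiralMap)) ∧
    (IsCAT0 SpaceW ∧ IsCAT0 SpaceZ ∧ QuasiIsometric SpaceW SpaceZ ∧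
      ¬ QuasiIsometric (CurtainModel lam SpaceW) (CurtainModel lam SpaceZ)) ∧
    QuasiIsometric (CurtainModel lam SpaceW) LineWithRays ∧
    QuasiIsometric (CurtainModel lam SpaceZ) WedgeOfRays :=
  ⟨⟨ParkingLot.isCAT0, isQuasiIsometry_spiralMap, fun h =>
      not_isQIEmbedding_curtainModelMap_spiralMap hlam hsum hL₀ hpos h.isQIEmbedding⟩,
    ⟨isCAT0_parkingLot _, isCAT0_parkingLot _, quasiIsometric_spaceW_spaceZ,
      not_quasiIsometric_curtainModel_spaceW_spaceZ hlam hsum hL₀ hpos⟩,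
    quasiIsometric_curtainModel_spaceW hlam hsum hL₀ hpos,
    quasiIsometric_curtainModel_spaceZ hlam hsum hL₀ hpos⟩

end CurtainModels

end

open CurtainModels in
theorem theorem1 (lam : ℕ+ → ℝ) (hlam : IsWeight lam) :
    (IsCAT0 ParkingLot ∧ IsQuasiIsometry spiralMap ∧
      ¬ IsQuasiIsometry (curtainModelMap lam spiralMap)) ∧
    (IsCAT0 SpaceW ∧ IsCAT0 SpaceZ ∧ QuasiIsometric SpaceW SpaceZ ∧
      ¬ QuasiIsometric (CurtainModel lam SpaceW) (CurtainModel lam SpaceZ)) ∧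
    QuasiIsometric (CurtainModel lam SpaceW) LineWithRays ∧
    QuasiIsometric (CurtainModel lam SpaceZ) WedgeOfRays :=
  theorem1_general (fun L => (hlam.1 L).1.le) hlam.summable le_rfl (hlam.1 2).1
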